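/- Let $A$ be a unital commutative associative $\mathbb{C}$-algebra with identity $e$ and let $B$ be a vertex $A$-algebroid: a $\mathbb{C}$-vector space with $\mathbb{C}$-bilinear maps $A\times B\to B$, $(a,v)\mapsto av$ (with $ev=v$), $[\cdot,\cdot]:B\times B\to B$ (a left Leibniz bracket), a symmetric $\mathbb{C}$-bilinear pairing $\langle\cdot,\cdot\rangle:B\times B\to A$, a homomorphism of Leibniz algebras $\pi:B\to\mathrm{Der}(A)$ and a linear map $\partial:A\to B$ with $\pi\circ\partial=0$, such that for $a,a'\in A$, $u,v,v_1,v_2\in B$: $a(a'v)-(aa')v=\pi(v)(a)\partial a'+\pi(v)(a')\partial a$, $[u,av]=\pi(u)(a)v+a[u,v]$, $[u,v]+[v,u]=\partial\langle u,v\rangle$, $\pi(av)=a\pi(v)$, $\langle au,v\rangle=a\langle u,v\rangle-\pi(u)(\pi(v)(a))$, $\pi(v)\langle v_1,v_2\rangle=\langle[v,v_1],v_2\rangle+\langle v_1,[v,v_2]\rangle$, $\partial(aa')=a\,\partial a'+a'\,\partial a$, $[v,\partial a]=\partial(\pi(v)(a))$, $\langle v,\partial a\rangle=\pi(v)(a)$.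 Let $A\partial A$ be the span of the $a\,\partial a'$; then $B/A\partial A$ is a Lie $A$-algebroid, acting on $A$ through $\pi$. A module for it is a vector space $U$ that is an $A$-module and a module for the Lie algebra $B/A\partial A$ such that $x(au)-a(xu)=(xa)u$ and $a(xu)=(ax)u$. Let $\mathcal{L}$ be the Lie algebra $\big((A\oplus B)\otimes\mathbb{C}[t,t^{-1}]\big)/\{\partial a\otimes t^n+na\otimes t^{n-1}\}$ with $c(n)$ the class of $c\otimes t^n$ and $[a(m),a'(n)]=0$, $[b(m),a(n)]=(\pi(b)a)(m+n)$, $[b(m),b'(n)]=[b,b'](m+n)+m\langle b,b'\rangle(m+n-1)$, graded by $\deg a(n)=-n-1$, $\deg b(n)=-n$. Let $\mathcal{L}^{\ge0}$ be spanned by the $c(n)$ with $n\ge0$, let $V_{\mathcal{L}}=U(\mathcal{L})\otimes_{U(\mathcal{L}^{\ge0})}\mathbb{C}$ with $\mathbf{1}=1\otimes1$, let $\mathcal{D}$ be the operator on $V_{\mathcal{L}}$ with $\mathcal{D}\mathbf{1}=0$ and $[\mathcal{D},c(n)]=-n\,c(n-1)$, and let $I_B\subset V_{\mathcal{L}}$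 be the smallest $\mathcal{D}$-stable $\mathcal{L}$-submodule containing $e(-1)\mathbf{1}-\mathbf{1}$, $a(-1)a'(-1)\mathbf{1}-(aa')(-1)\mathbf{1}$ and $a(-1)b(-1)\mathbf{1}-(ab)(-1)\mathbf{1}$ for $a,a'\in A$, $b\in B$. Then $V_B=V_{\mathcal{L}}/I_B$ has a unique vertex algebra structure with vacuum $\mathbf{1}$ such that, for every $c\in A\oplus B$ and $n\in\mathbb{Z}$, the $n$-th mode of $c(-1)\mathbf{1}$ is the action of $c(n)$, and it is $\mathbb{N}$-graded with $\deg\mathbf 1=0$. For a module $U$ for the Lie $A$-algebroid $B/A\partial A$ let $M(U)=U(\mathcal{L})\otimes_{U(\mathcal{L}_{(\le0)})}U$, where $\mathcal{L}_{(\le 0)}$ is the part of $\mathcal{L}$ of degree at most $0$ and acts on $U$ by $a(n-1)u=\delta_{n,0}\,au$, $b(n)u=\delta_{n,0}\,bu$ for $n\ge0$; grade $M(U)$ by $\deg U=0$, let $J(U)$ be the largest graded $\mathcal{L}$-submodule of $M(U)$ with $J(U)\cap U=0$, and put $L(U)=M(U)/J(U)$. Then $L(U)$ is an $\mathbb{N}$-graded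 $V_B$-module for a unique $V_B$-module structure in which, for $c\in A\oplus B$, the $n$-th mode of $c(-1)\mathbf{1}$ is the action of $c(n)$. An $\mathbb{N}$-graded $V_B$-module $W=\coprod_{n\ge0}W(n)$ (where $v_mW(n)\subset W(k+n-m-1)$ for $v$ of degree $k$) is called graded simple if $W(0)\ne0$ and its only graded submodules are $0$ and $W$; isomorphisms of $\mathbb{N}$-graded modules preserve degrees. Then, for any complete set $H$ of representatives of the isomorphism classes of simple modules for the Lie $A$-algebroid $B/A\partial A$, the family $(L(U))_{U\in H}$ is a complete set of representatives of the isomorphism classes of graded simple $\mathbb{N}$-graded $V_B$-modules: each $L(U)$ is graded simple, and each graded simple $\mathbb{N}$-graded $V_B$-module is isomorphic to $L(U)$ for exactly one $U\in H$. -/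

import Mathlib

open scoped TensorProduct

universe u v w

noncomputable section

/-! ### Vertex algebras and their modules -/

/-- The Jacobi identity for modes acting on `W`, written out by coefficients: `Y` gives the modes
`u_n` of a space `V` acting on itself and `YW` the modes of `V` acting on `W`. The identity at
`l m n` is the coefficient of `x₀^(-l-1) x₁^(-m-1) x₂^(-n-1)` in the delta-function form. All
sums are finite when `YW` and `Y` satisfy truncation. -/
def JacobiIdentity {V : Type u} {W : Type v} [AddCommGroup V] [Module ℂ V] [AddCommGroup W]
    [Module ℂ W] (Y : V →ₗ[ℂ] (ℤ → Module.End ℂ V)) (YW : V →ₗ[ℂ] (ℤ → Module.End ℂ W)) : Prop :=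
  ∀ (a b : V) (x : W) (l m n : ℤ),
    (∑ᶠ i : ℕ, (Ring.choose m i : ℤ) • YW (Y a (l + i) b) (m + n - i) x) =
      ∑ᶠ i : ℕ, ((-1) ^ i * Ring.choose l i : ℤ) •
        (YW a (l + m - i) (YW b (n + i) x)
          - ((Int.negOnePow l : ℤˣ) : ℤ) • YW b (l + n - i) (YW a (m + i) x))

/-- A vertex algebra structure on a complex vector space `V`. `Y v n` is the mode `v_n`, the
coefficient of `x^(-n-1)` in `Y(v, x)`. -/
@[ext]
structure VertexAlgebra (V : Type u) [AddCommGroup V] [Module ℂ V] where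
  Y : V →ₗ[ℂ] (ℤ → Module.End ℂ V)
  vac : V
  truncation : ∀ a b : V, ∃ N : ℤ, ∀ n : ℤ, N ≤ n → Y a n b = 0
  vacuum : ∀ (n : ℤ) (b : V), Y vac n b = if n = -1 then b else 0
  creation_regular : ∀ (a : V) (n : ℤ), 0 ≤ n → Y a n vac = 0
  creation : ∀ a : V, Y a (-1) vac = a
  jacobi : JacobiIdentity Y Y

/-- An `ℕ`-indexed family of subspaces, extended by zero to negative integers. -/
def intDegree {W : Type v} [AddCommGroup W] [Module ℂ W] (gr : ℕ → Submodule ℂ W) (d : ℤ) :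
    Submodule ℂ W :=
  if 0 ≤ d then gr d.toNat else ⊥

namespace VertexAlgebra

variable {V : Type u} [AddCommGroup V] [Module ℂ V]

/-- `V = ⨁ gr n` is an `ℕ`-graded vertex algebra: the vacuum has degree `0` and
`u_m V_(n) ⊆ V_(k+n-m-1)` for `u ∈ V_(k)`. -/
structure IsNGraded (𝒱 : VertexAlgebra V) (gr : ℕ → Submodule ℂ V) : Prop where
  internal : DirectSum.IsInternal gr
  vac_mem : 𝒱.vac ∈ gr 0
  mode_mem : ∀ (k n : ℕ) (m : ℤ), ∀ a ∈ gr k, ∀ b ∈ gr n,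
    𝒱.Y a m b ∈ intDegree gr ((k : ℤ) + n - m - 1)

/-- A module structure for the vertex algebra `𝒱` on a complex vector space `W`. -/
@[ext]
structure VModule (𝒱 : VertexAlgebra V) (W : Type v) [AddCommGroup W] [Module ℂ W] where
  Y : V →ₗ[ℂ] (ℤ → Module.End ℂ W)
  truncation : ∀ (a : V) (x : W), ∃ N : ℤ, ∀ n : ℤ, N ≤ n → Y a n x = 0
  vacuum : ∀ (n : ℤ) (x : W), Y 𝒱.vac n x = if n = -1 then x else 0
  jacobi : JacobiIdentity 𝒱.Y Y

/-- `W = ⨁ grW n` is an `ℕ`-graded module for the graded vertex algebra `V = ⨁ gr n`. -/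
structure VModule.IsNGraded {𝒱 : VertexAlgebra V} {W : Type v} [AddCommGroup W]
    [Module ℂ W] (𝒲 : 𝒱.VModule W) (gr : ℕ → Submodule ℂ V) (grW : ℕ → Submodule ℂ W) :
    Prop where
  internal : DirectSum.IsInternal grW
  mode_mem : ∀ (k n : ℕ) (m : ℤ), ∀ a ∈ gr k, ∀ x ∈ grW n,
    𝒲.Y a m x ∈ intDegree grW ((k : ℤ) + n - m - 1)

/-- An `ℕ`-graded module for the vertex algebra `𝒱` with grading `gr`. -/
structure GradedModule (𝒱 : VertexAlgebra V) (gr : ℕ → Submodule ℂ V) where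
  carrier : Type w
  [addCommGroup : AddCommGroup carrier]
  [module : Module ℂ carrier]
  str : 𝒱.VModule carrier
  grading : ℕ → Submodule ℂ carrier
  isNGraded : str.IsNGraded gr grading

attribute [instance] GradedModule.addCommGroup GradedModule.module

namespace GradedModule

variable {𝒱 : VertexAlgebra V} {gr : ℕ → Submodule ℂ V}

/-- Graded simplicity, the grading being normalized to start in degree zero: `W(0) ≠ 0` and the
only graded submodules are `0` and `W`. -/
def IsSimple (W : GradedModule.{u, w} 𝒱 gr) : Prop :=
  W.grading 0 ≠ ⊥ ∧
    ∀ N : Submodule ℂ W.carrier,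
      (∀ (a : V) (n : ℤ), ∀ x ∈ N, W.str.Y a n x ∈ N) →
      N = ⨆ n, N ⊓ W.grading n →
      N = ⊥ ∨ N = ⊤

/-- Isomorphism of `ℕ`-graded modules. -/
def Isomorphic (W W' : GradedModule.{u, w} 𝒱 gr) : Prop :=
  ∃ e : W.carrier ≃ₗ[ℂ] W'.carrier,
    (∀ n, (W.grading n).map (e : W.carrier →ₗ[ℂ] W'.carrier) = W'.grading n) ∧
    ∀ (a : V) (n : ℤ) (x : W.carrier), e (W.str.Y a n x) = W'.str.Y a n (e x)

end GradedModule

end VertexAlgebra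

/-- `H` is a complete system of representatives, up to the equivalence `r`, of the objects with
property `P`: each `H i` has the property, and each object with the property is equivalent to
`H i` for exactly one index `i`. -/
def IsCompleteSetOfReps {T : Type u} (P : T → Prop) (r : T → T → Prop) {ι : Type v} (H : ι → T) :
    Prop :=
  (∀ i, P (H i)) ∧ ∀ t, P t → ∃! i, r t (H i)

/-! ### Modules for a Lie algebroid

A Lie `A`-algebroid is a Lie-Rinehart algebra over `A`. -/

/-- A module for the Lie `A`-algebroid `G`. -/
structure LieAlgebroidModule (A : Type u) (G : Type v) [CommRing A] [Algebra ℂ A] [LieRing G]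
    [LieAlgebra ℂ G] [Module A G] [LieRingModule G A] where
  carrier : Type w
  [addCommGroup : AddCommGroup carrier]
  [moduleℂ : Module ℂ carrier]
  [moduleA : Module A carrier]
  [isScalarTower : IsScalarTower ℂ A carrier]
  [lieRingModule : LieRingModule G carrier]
  [lieModule : LieModule ℂ G carrier]
  lie_smul' : ∀ (g : G) (a : A) (x : carrier), ⁅g, a • x⁆ - a • ⁅g, x⁆ = ⁅g, a⁆ • x
  smul_lie' : ∀ (a : A) (g : G) (x : carrier), a • ⁅g, x⁆ = ⁅a • g, x⁆

attribute [instance] LieAlgebroidModule.addCommGroup LieAlgebroidModule.moduleℂ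
  LieAlgebroidModule.moduleA LieAlgebroidModule.isScalarTower LieAlgebroidModule.lieRingModule
  LieAlgebroidModule.lieModule

namespace LieAlgebroidModule

variable {A : Type u} {G : Type v} [CommRing A] [Algebra ℂ A] [LieRing G]
    [LieAlgebra ℂ G] [Module A G] [LieRingModule G A]

/-- Simplicity: nonzero, without proper nonzero subspaces stable under `A` and `G`. -/
def IsSimple (U : LieAlgebroidModule.{u, v, w} A G) : Prop :=
  Nontrivial U.carrier ∧
    ∀ N : Submodule A U.carrier, (∀ (g : G), ∀ x ∈ N, ⁅g, x⁆ ∈ N) → N = ⊥ ∨ N = ⊤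

/-- Isomorphism of modules for a Lie algebroid. -/
def Isomorphic (U U' : LieAlgebroidModule.{u, v, w} A G) : Prop :=
  ∃ e : U.carrier ≃ₗ[A] U'.carrier, ∀ (g : G) (x : U.carrier), e ⁅g, x⁆ = ⁅g, e x⁆

end LieAlgebroidModule

/-! ### Vertex algebroids -/

/-- A vertex `A`-algebroid structure on a complex vector space `B`: `act a v` is `a * v`,
`br` the Leibniz bracket, `anchor` is `π`, `pair` the pairing `⟨·,·⟩` and `d` is `∂`. -/
structure VertexAlgebroid (A : Type u) (B : Type v) [CommRing A] [Algebra ℂ A] [AddCommGroup B]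
    [Module ℂ B] where
  act : A →ₗ[ℂ] B →ₗ[ℂ] B
  br : B →ₗ[ℂ] B →ₗ[ℂ] B
  anchor : B →ₗ[ℂ] Derivation ℂ A A
  pair : B →ₗ[ℂ] B →ₗ[ℂ] A
  d : A →ₗ[ℂ] B
  one_act : ∀ x, act 1 x = x
  br_leibniz : ∀ x y z, br x (br y z) = br (br x y) z + br y (br x z)
  anchor_br : ∀ x y, anchor (br x y) = ⁅anchor x, anchor y⁆
  pair_symm : ∀ x y, pair x y = pair y x
  anchor_d : ∀ a, anchor (d a) = 0
  act_act : ∀ a a' x,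
    act a (act a' x) - act (a * a') x = act (anchor x a) (d a') + act (anchor x a') (d a)
  br_act : ∀ x a y, br x (act a y) = act (anchor x a) y + act a (br x y)
  br_add_br : ∀ x y, br x y + br y x = d (pair x y)
  anchor_act : ∀ a x, anchor (act a x) = a • anchor x
  pair_act : ∀ a x y, pair (act a x) y = a * pair x y - anchor x (anchor y a)
  anchor_pair : ∀ x y z, anchor x (pair y z) = pair (br x y) z + pair y (br x z)
  d_mul : ∀ a a', d (a * a') = act a (d a') + act a' (d a)
  br_d : ∀ x a, br x (d a) = d (anchor x a)
  pair_d : ∀ x a, pair x (d a) = anchor x a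

namespace VertexAlgebroid

variable {A : Type u} {B : Type v} [CommRing A] [Algebra ℂ A] [AddCommGroup B] [Module ℂ B]
  (X : VertexAlgebroid A B)

/-! ### The Lie algebroid `B / A∂A` -/

/-- The subspace `A∂A` of `B`. -/
def AdA : Submodule ℂ B := Submodule.span ℂ {x | ∃ a a', x = X.act a (X.d a')}

/-- The quotient `B / A∂A`. -/
def G : Type v := B ⧸ X.AdA

instance : AddCommGroup X.G := inferInstanceAs (AddCommGroup (B ⧸ X.AdA))
instance : Module ℂ X.G := inferInstanceAs (Module ℂ (B ⧸ X.AdA))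

/-- The projection `B → B / A∂A`. -/
def toG : B →ₗ[ℂ] X.G := X.AdA.mkQ

theorem toG_surjective : Function.Surjective X.toG := X.AdA.mkQ_surjective

theorem toG_eq_zero {x : B} : X.toG x = 0 ↔ x ∈ X.AdA := Submodule.Quotient.mk_eq_zero _

theorem act_d_mem (a a' : A) : X.act a (X.d a') ∈ X.AdA := Submodule.subset_span ⟨a, a', rfl⟩

theorem d_mem (a : A) : X.d a ∈ X.AdA := by
  simpa [X.one_act] using X.act_d_mem 1 a

theorem act_mem (a : A) : X.AdA ≤ X.AdA.comap (X.act a) := by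
  refine Submodule.span_le.2 ?_
  rintro _ ⟨b, b', rfl⟩
  have h := X.act_act a b (X.d b')
  simp only [X.anchor_d, Derivation.coe_zero, Pi.zero_apply, map_zero, LinearMap.zero_apply,
    add_zero] at h
  simp only [Submodule.comap_coe, Set.mem_preimage, SetLike.mem_coe]
  rw [sub_eq_zero.1 h]
  exact X.act_d_mem _ _

theorem br_mem (x : B) : X.AdA ≤ X.AdA.comap (X.br x) := by
  refine Submodule.span_le.2 ?_
  rintro _ ⟨b, b', rfl⟩
  simp only [Submodule.comap_coe, Set.mem_preimage, SetLike.mem_coe]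
  rw [X.br_act, X.br_d]
  exact add_mem (X.act_d_mem _ _) (X.act_d_mem _ _)

theorem br_mem_left {x : B} (hx : x ∈ X.AdA) (y : B) : X.br x y ∈ X.AdA := by
  have h := X.br_add_br x y
  rw [eq_sub_of_add_eq h]
  exact sub_mem (X.d_mem _) (X.br_mem y hx)

theorem anchor_eq_zero {x : B} (hx : x ∈ X.AdA) : X.anchor x = 0 := by
  have : X.AdA ≤ LinearMap.ker X.anchor := by
    refine Submodule.span_le.2 ?_
    rintro _ ⟨b, b', rfl⟩
    simp [X.anchor_act, X.anchor_d]
  exact this hx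

/-- The bracket induced on `B / A∂A`. -/
def brG : X.G →ₗ[ℂ] X.G →ₗ[ℂ] X.G :=
  X.AdA.liftQ
    { toFun := fun x => X.AdA.mapQ X.AdA (X.br x) (X.br_mem x)
      map_add' := fun x y => by
        refine LinearMap.ext fun z => ?_
        obtain ⟨z, rfl⟩ := X.toG_surjective z
        change X.toG (X.br (x + y) z) = X.toG (X.br x z) + X.toG (X.br y z)
        simp
      map_smul' := fun c x => by
        refine LinearMap.ext fun z => ?_
        obtain ⟨z, rfl⟩ := X.toG_surjective z
        change X.toG (X.br (c • x) z) = c • X.toG (X.br x z)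
        simp }
    (fun x hx => by
      refine LinearMap.mem_ker.2 (LinearMap.ext fun z => ?_)
      obtain ⟨z, rfl⟩ := X.toG_surjective z
      exact X.toG_eq_zero.2 (X.br_mem_left hx z))

theorem brG_toG (x y : B) : X.brG (X.toG x) (X.toG y) = X.toG (X.br x y) := rfl

instance : LieRing X.G where
  bracket x y := X.brG x y
  add_lie x y z := by change X.brG _ _ = X.brG _ _ + X.brG _ _; simp
  lie_add x y z := by change X.brG _ _ = X.brG _ _ + X.brG _ _; simp
  lie_self x := by
    obtain ⟨x, rfl⟩ := X.toG_surjective x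
    change X.brG _ _ = 0
    rw [brG_toG]
    have h : X.toG (X.br x x) + X.toG (X.br x x) = 0 := by
      rw [← map_add, X.br_add_br]
      exact X.toG_eq_zero.2 (X.d_mem _)
    rw [← two_smul ℂ] at h
    exact (smul_eq_zero.1 h).resolve_left two_ne_zero
  leibniz_lie x y z := by
    obtain ⟨x, rfl⟩ := X.toG_surjective x
    obtain ⟨y, rfl⟩ := X.toG_surjective y
    obtain ⟨z, rfl⟩ := X.toG_surjective z
    change X.brG _ (X.brG _ _) = X.brG (X.brG _ _) _ + X.brG _ (X.brG _ _)
    simp only [brG_toG, ← map_add, X.br_leibniz x y z]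

theorem lie_toG (x y : B) : ⁅X.toG x, X.toG y⁆ = X.toG (X.br x y) := rfl

instance : LieAlgebra ℂ X.G where
  lie_smul c x y := by change X.brG _ _ = c • X.brG _ _; simp

/-- The action of `a ∈ A` on `B / A∂A`. -/
def actG (a : A) : X.G →ₗ[ℂ] X.G := X.AdA.mapQ X.AdA (X.act a) (X.act_mem a)

instance : Module A X.G where
  smul a x := X.actG a x
  one_smul x := by
    obtain ⟨x, rfl⟩ := X.toG_surjective x
    exact congrArg X.toG (X.one_act x)
  mul_smul a b x := by
    obtain ⟨x, rfl⟩ := X.toG_surjective x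
    change X.toG (X.act (a * b) x) = X.toG (X.act a (X.act b x))
    rw [eq_comm, ← sub_eq_zero, ← map_sub, X.act_act]
    exact X.toG_eq_zero.2 (add_mem (X.act_d_mem _ _) (X.act_d_mem _ _))
  smul_zero a := map_zero (X.actG a)
  smul_add a := map_add (X.actG a)
  add_smul a b x := by
    obtain ⟨x, rfl⟩ := X.toG_surjective x
    change X.toG (X.act (a + b) x) = X.toG (X.act a x) + X.toG (X.act b x)
    simp
  zero_smul x := by
    obtain ⟨x, rfl⟩ := X.toG_surjective x
    change X.toG (X.act 0 x) = 0
    simp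

theorem smul_toG (a : A) (x : B) : a • X.toG x = X.toG (X.act a x) := rfl

/-- The anchor of `B / A∂A`. -/
def anchorG : X.G →ₗ[ℂ] Derivation ℂ A A :=
  X.AdA.liftQ X.anchor (fun _ hx => X.anchor_eq_zero hx)

theorem anchorG_toG (x : B) : X.anchorG (X.toG x) = X.anchor x := rfl

instance : LieRingModule X.G A where
  bracket g a := X.anchorG g a
  add_lie g h a := by
    change X.anchorG _ _ = X.anchorG _ _ + X.anchorG _ _
    simp
  lie_add g a b := map_add (X.anchorG g) a b
  leibniz_lie g h a := by
    obtain ⟨g, rfl⟩ := X.toG_surjective g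
    obtain ⟨h, rfl⟩ := X.toG_surjective h
    change X.anchor g (X.anchor h a) = X.anchor (X.br g h) a + X.anchor h (X.anchor g a)
    rw [X.anchor_br, Derivation.commutator_apply]
    ring

theorem lie_toG_apply (x : B) (a : A) : ⁅X.toG x, a⁆ = X.anchor x a := rfl

instance : LieRinehartRing A X.G where
  lie_smul_eq_mul' a b g := by
    obtain ⟨g, rfl⟩ := X.toG_surjective g
    rw [smul_toG, lie_toG_apply, lie_toG_apply, X.anchor_act]
    rfl
  leibniz_mul_right' g a b := by
    obtain ⟨g, rfl⟩ := X.toG_surjective g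
    simp only [lie_toG_apply, Derivation.leibniz, smul_eq_mul]
    ring
  leibniz_smul_right' g h a := by
    obtain ⟨g, rfl⟩ := X.toG_surjective g
    obtain ⟨h, rfl⟩ := X.toG_surjective h
    simp only [lie_toG_apply, smul_toG, lie_toG, X.br_act, map_add]
    exact add_comm _ _

/-- `B / A∂A` is a Lie `A`-algebroid. -/
instance : LieRinehartAlgebra ℂ A X.G where
  smul_assoc c a g := by
    obtain ⟨g, rfl⟩ := X.toG_surjective g
    change X.toG (X.act (c • a) g) = c • X.toG (X.act a g)
    simp
  smul_lie c g a := by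
    change X.anchorG (c • g) a = c • X.anchorG g a
    simp
  lie_smul c g a := by
    change X.anchorG g (c • a) = c • X.anchorG g a
    simp

/-! ### The Lie algebra `𝓛 = L(A ⊕ B) / ∂̂ L(A)`

`L(A ⊕ B) = (A ⊕ B) ⊗ ℂ[t, t⁻¹]` is realized as `ℤ →₀ A × B`, with `c ⊗ t^n = single n c`. -/

/-- The map `∂̂ = ∂ ⊗ 1 + 1 ⊗ d/dt` from `L(A)` to `L(A ⊕ B)`. -/
def dHat : (ℤ →₀ A) →ₗ[ℂ] (ℤ →₀ A × B) :=
  Finsupp.lsum ℂ fun n : ℤ =>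
    Finsupp.lsingle n ∘ₗ LinearMap.inr ℂ A B ∘ₗ X.d
      + (n : ℂ) • (Finsupp.lsingle (n - 1) ∘ₗ LinearMap.inl ℂ A B)

/-- The product `c₀c'` of `A ⊕ B`: `a₀a' = 0`, `b₀a = π(b)(a) = -a₀b`, `b₀b' = [b, b']`. -/
def prod0 : A × B →ₗ[ℂ] A × B →ₗ[ℂ] A × B :=
  LinearMap.mk₂ ℂ (fun c c' => (X.anchor c.2 c'.1 - X.anchor c'.2 c.1, X.br c.2 c'.2))
    (fun c c' e => by ext <;> simp; ring) (fun r c e => by ext <;> simp [smul_sub])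
    (fun c e e' => by ext <;> simp; ring) (fun r c e => by ext <;> simp [smul_sub])

/-- The product `c₁c'` of `A ⊕ B`: `b₁b' = ⟨b, b'⟩`, zero if an argument lies in `A`. -/
def prod1 : A × B →ₗ[ℂ] A × B →ₗ[ℂ] A × B :=
  LinearMap.mk₂ ℂ (fun c c' => (X.pair c.2 c'.2, 0))
    (fun c c' e => by ext <;> simp) (fun r c e => by ext <;> simp)
    (fun c e e' => by ext <;> simp) (fun r c e => by ext <;> simp)

@[simp] theorem prod0_apply (c c' : A × B) :
    X.prod0 c c' = (X.anchor c.2 c'.1 - X.anchor c'.2 c.1, X.br c.2 c'.2) := rfl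

@[simp] theorem prod1_apply (c c' : A × B) : X.prod1 c c' = (X.pair c.2 c'.2, 0) := rfl

/-- The product of `L(A ⊕ B)`:
`[c ⊗ t^m, c' ⊗ t^n] = c₀c' ⊗ t^(m+n) + m (c₁c') ⊗ t^(m+n-1)`. -/
def loopBr : (ℤ →₀ A × B) →ₗ[ℂ] (ℤ →₀ A × B) →ₗ[ℂ] (ℤ →₀ A × B) :=
  Finsupp.lsum ℂ fun m : ℤ => LinearMap.flip <| Finsupp.lsum ℂ fun n : ℤ => LinearMap.flip <|
    X.prod0.compr₂ (Finsupp.lsingle (m + n))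
      + (m : ℂ) • X.prod1.compr₂ (Finsupp.lsingle (m + n - 1))

theorem dHat_single (n : ℤ) (a : A) :
    X.dHat (Finsupp.single n a) =
      Finsupp.single n (0, X.d a) + (n : ℂ) • Finsupp.single (n - 1) (a, 0) := by
  rw [dHat, Finsupp.lsum_single]
  simp

theorem loopBr_single (m n : ℤ) (c c' : A × B) :
    X.loopBr (Finsupp.single m c) (Finsupp.single n c') =
      Finsupp.single (m + n) (X.prod0 c c')
        + (m : ℂ) • Finsupp.single (m + n - 1) (X.prod1 c c') := by
  simp [loopBr]

/-- The space `𝓛 = L(A ⊕ B) / ∂̂ L(A)`. -/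
def L : Type (max u v) := (ℤ →₀ A × B) ⧸ LinearMap.range X.dHat

instance : AddCommGroup X.L := inferInstanceAs (AddCommGroup ((ℤ →₀ A × B) ⧸ _))
instance : Module ℂ X.L := inferInstanceAs (Module ℂ ((ℤ →₀ A × B) ⧸ _))

/-- The projection `ρ : L(A ⊕ B) → 𝓛`. -/
def rho : (ℤ →₀ A × B) →ₗ[ℂ] X.L := (LinearMap.range X.dHat).mkQ

/-- The element `c(n) = ρ(c ⊗ t^n)`, linear in `c ∈ A ⊕ B`. -/
def mode (n : ℤ) : A × B →ₗ[ℂ] X.L := X.rho ∘ₗ Finsupp.lsingle n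

theorem rho_surjective : Function.Surjective X.rho := Submodule.mkQ_surjective _

theorem rho_dHat (f : ℤ →₀ A) : X.rho (X.dHat f) = 0 :=
  (Submodule.Quotient.mk_eq_zero _).2 ⟨f, rfl⟩

theorem br_d_left (a : A) (y : B) : X.br (X.d a) y = 0 := by
  have h := X.br_add_br (X.d a) y
  rw [X.br_d, X.pair_symm, X.pair_d] at h
  simpa using h

theorem loopBr_dHat_left (f : ℤ →₀ A) (y : ℤ →₀ A × B) : X.loopBr (X.dHat f) y = 0 := by
  induction f using Finsupp.induction_linear with
  | zero => simp
  | add f g hf hg => simp [hf, hg]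
  | single n a =>
    induction y using Finsupp.induction_linear with
    | zero => simp
    | add f g hf hg => simp only [map_add, hf, hg, add_zero]
    | single m c =>
      rw [dHat_single, map_add, map_smul, LinearMap.add_apply, LinearMap.smul_apply,
        loopBr_single, loopBr_single, show n - 1 + m = n + m - 1 by ring]
      have h1 : X.prod0 (0, X.d a) c = 0 := by simp [X.anchor_d, X.br_d_left]
      have h2 : X.prod1 (0, X.d a) c = (X.anchor c.2 a, 0) := by
        simp [X.pair_symm _ c.2, X.pair_d]
      have h3 : X.prod0 (a, 0) c = -(X.anchor c.2 a, 0) := by simp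
      have h4 : X.prod1 (a, 0) c = 0 := by simp
      rw [h1, h2, h3, h4, Finsupp.single_neg]
      simp only [Finsupp.single_zero, smul_zero, add_zero, zero_add, smul_neg]
      exact add_neg_cancel _

theorem loopBr_dHat_right (f : ℤ →₀ A) (y : ℤ →₀ A × B) :
    X.loopBr y (X.dHat f) ∈ LinearMap.range X.dHat := by
  induction f using Finsupp.induction_linear with
  | zero => simp
  | add f g hf hg => rw [map_add, map_add]; exact add_mem hf hg
  | single n a =>
    induction y using Finsupp.induction_linear with
    | zero => simp
    | add f g hf hg => rw [map_add, LinearMap.add_apply]; exact add_mem hf hg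
    | single m c =>
      refine ⟨Finsupp.single (m + n) (X.anchor c.2 a), ?_⟩
      rw [dHat_single, dHat_single, map_add, map_smul, loopBr_single, loopBr_single,
        show m + (n - 1) = m + n - 1 by ring]
      have h1 : X.prod0 c (0, X.d a) = (0, X.d (X.anchor c.2 a)) := by simp [X.anchor_d, X.br_d]
      have h2 : X.prod1 c (0, X.d a) = (X.anchor c.2 a, 0) := by simp [X.pair_d]
      have h3 : X.prod0 c (a, 0) = (X.anchor c.2 a, 0) := by simp
      have h4 : X.prod1 c (a, 0) = 0 := by simp
      rw [h1, h2, h3, h4]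
      push_cast
      simp only [add_smul, Finsupp.single_zero, smul_zero, add_zero]
      abel

/-- The bracket of `𝓛`. -/
def brL : X.L →ₗ[ℂ] X.L →ₗ[ℂ] X.L :=
  (LinearMap.range X.dHat).liftQ
    { toFun := fun x => (LinearMap.range X.dHat).mapQ (LinearMap.range X.dHat) (X.loopBr x)
        (by rintro _ ⟨f, rfl⟩; exact X.loopBr_dHat_right f x)
      map_add' := fun x y => by
        refine LinearMap.ext fun z => ?_
        obtain ⟨z, rfl⟩ := X.rho_surjective z
        change X.rho (X.loopBr (x + y) z) = X.rho (X.loopBr x z) + X.rho (X.loopBr y z)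
        simp
      map_smul' := fun c x => by
        refine LinearMap.ext fun z => ?_
        obtain ⟨z, rfl⟩ := X.rho_surjective z
        change X.rho (X.loopBr (c • x) z) = c • X.rho (X.loopBr x z)
        simp }
    (by
      rintro _ ⟨f, rfl⟩
      refine LinearMap.mem_ker.2 (LinearMap.ext fun z => ?_)
      obtain ⟨z, rfl⟩ := X.rho_surjective z
      change X.rho (X.loopBr (X.dHat f) z) = 0
      rw [loopBr_dHat_left, map_zero])

theorem brL_rho (x y : ℤ →₀ A × B) : X.brL (X.rho x) (X.rho y) = X.rho (X.loopBr x y) := rfl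

theorem rho_skew (x y : ℤ →₀ A × B) : X.rho (X.loopBr x y) + X.rho (X.loopBr y x) = 0 := by
  induction x using Finsupp.induction_linear with
  | zero => simp
  | add f g hf hg =>
    simp only [map_add, LinearMap.add_apply]
    rw [add_add_add_comm, hf, hg, add_zero]
  | single m c =>
    induction y using Finsupp.induction_linear with
    | zero => simp
    | add f g hf hg =>
      simp only [map_add, LinearMap.add_apply]
      rw [add_add_add_comm, hf, hg, add_zero]
    | single n c' =>
      rw [← map_add, ← X.rho_dHat (Finsupp.single (m + n) (X.pair c.2 c'.2)), dHat_single,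
        loopBr_single, loopBr_single, show n + m = m + n by ring]
      have h1 : X.prod1 c' c = (X.pair c.2 c'.2, 0) := by simp [X.pair_symm c'.2]
      have h2 : ((0, X.d (X.pair c.2 c'.2)) : A × B) = X.prod0 c c' + X.prod0 c' c := by
        simp [X.br_add_br]
      rw [h1, h2, prod1_apply, Finsupp.single_add]
      push_cast
      rw [add_smul]
      congr 1
      abel

theorem loopBr_leibniz (x y z : ℤ →₀ A × B) :
    X.loopBr x (X.loopBr y z) = X.loopBr (X.loopBr x y) z + X.loopBr y (X.loopBr x z) := by
  induction x using Finsupp.induction_linear with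
  | zero => simp
  | add f g hf hg => simp only [map_add, LinearMap.add_apply, hf, hg]; abel
  | single m c =>
    induction y using Finsupp.induction_linear with
    | zero => simp
    | add f g hf hg => simp only [map_add, LinearMap.add_apply, hf, hg]; abel
    | single n c' =>
      induction z using Finsupp.induction_linear with
      | zero => simp
      | add f g hf hg => simp only [map_add, hf, hg]; abel
      | single k c'' =>
        have h0 : X.prod0 c (X.prod0 c' c'') =
            X.prod0 (X.prod0 c c') c'' + X.prod0 c' (X.prod0 c c'') := by
          ext
          · simp only [prod0_apply, Prod.fst_add, X.anchor_br, Derivation.commutator_apply,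
              map_sub]
            ring
          · simp [← X.br_leibniz]
        have h1 : X.prod0 c (X.prod1 c' c'') =
            X.prod1 (X.prod0 c c') c'' + X.prod1 c' (X.prod0 c c'') := by
          ext <;> simp [X.anchor_pair]
        have h2 : X.prod1 c (X.prod0 c' c'') = X.prod1 (X.prod0 c c') c''
            + X.prod0 (X.prod1 c c') c'' + X.prod0 c' (X.prod1 c c'') := by
          have e1 := X.pair_d c''.2 (X.pair c.2 c'.2)
          rw [← X.br_add_br, map_add, X.pair_symm, X.pair_symm _ (X.br c'.2 c.2)] at e1
          ext
          · simp [X.anchor_pair c'.2, ← e1]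
          · simp
        have h3 : X.prod1 c (X.prod1 c' c'') = 0 := by simp
        have h4 : X.prod1 (X.prod1 c c') c'' = 0 := by simp
        have h5 : X.prod1 c' (X.prod1 c c'') = 0 := by simp
        simp only [loopBr_single, map_add, map_smul, LinearMap.add_apply, LinearMap.smul_apply]
        rw [h0, h1, h2, h3, h4, h5]
        simp only [show m + (n + k) = m + n + k by ring, show n + (m + k) = m + n + k by ring,
          show m + (n + k - 1) = m + n + k - 1 by ring,
          show n + (m + k - 1) = m + n + k - 1 by ring,
          show m + n - 1 + k = m + n + k - 1 by ring]
        simp only [Finsupp.single_add, Finsupp.single_zero, smul_zero, add_zero, smul_add,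
          Int.cast_add, add_smul]
        abel

instance : LieRing X.L where
  bracket x y := X.brL x y
  add_lie x y z := by change X.brL _ _ = X.brL _ _ + X.brL _ _; simp
  lie_add x y z := by change X.brL _ _ = X.brL _ _ + X.brL _ _; simp
  lie_self x := by
    obtain ⟨x, rfl⟩ := X.rho_surjective x
    have h := X.rho_skew x x
    rw [← two_smul ℂ] at h
    exact (smul_eq_zero.1 h).resolve_left two_ne_zero
  leibniz_lie x y z := by
    obtain ⟨x, rfl⟩ := X.rho_surjective x
    obtain ⟨y, rfl⟩ := X.rho_surjective y
    obtain ⟨z, rfl⟩ := X.rho_surjective z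
    change X.brL _ (X.brL _ _) = X.brL (X.brL _ _) _ + X.brL _ (X.brL _ _)
    simp only [brL_rho, ← map_add, X.loopBr_leibniz x y z]

theorem lie_rho (x y : ℤ →₀ A × B) : ⁅X.rho x, X.rho y⁆ = X.rho (X.loopBr x y) := rfl

/-- The Lie algebra `𝓛`. -/
instance : LieAlgebra ℂ X.L where
  lie_smul c x y := by change X.brL _ _ = c • X.brL _ _; simp

/-- The homogeneous subspace `𝓛_(d)`, spanned by `a(-d-1)` and `b(-d)`. -/
def homog (d : ℤ) : Submodule ℂ X.L :=
  LinearMap.range (X.mode (-d - 1) ∘ₗ LinearMap.inl ℂ A B)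
    ⊔ LinearMap.range (X.mode (-d) ∘ₗ LinearMap.inr ℂ A B)

/-- The operator `-d/dt` on `L(A ⊕ B)`. -/
def loopD : (ℤ →₀ A × B) →ₗ[ℂ] (ℤ →₀ A × B) :=
  Finsupp.lsum ℂ fun n : ℤ => (-n : ℂ) • Finsupp.lsingle (n - 1)

theorem loopD_single (n : ℤ) (c : A × B) :
    loopD (Finsupp.single n c) = (-n : ℂ) • Finsupp.single (n - 1) c := by
  simp [loopD]

theorem loopD_dHat (f : ℤ →₀ A) : loopD (X.dHat f) ∈ LinearMap.range X.dHat := by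
  induction f using Finsupp.induction_linear with
  | zero => simp
  | add f g hf hg => rw [map_add, map_add]; exact add_mem hf hg
  | single n a =>
    refine ⟨(-n : ℂ) • Finsupp.single (n - 1) a, ?_⟩
    rw [map_smul, dHat_single, dHat_single, map_add, map_smul, loopD_single, loopD_single,
      smul_add, smul_smul, smul_smul]
    congr 2
    push_cast
    ring

theorem loopD_loopBr (x y : ℤ →₀ A × B) :
    loopD (X.loopBr x y) = X.loopBr (loopD x) y + X.loopBr x (loopD y) := by
  induction x using Finsupp.induction_linear with
  | zero => simp
  | add f g hf hg => simp only [map_add, LinearMap.add_apply, hf, hg]; abel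
  | single m c =>
    induction y using Finsupp.induction_linear with
    | zero => simp
    | add f g hf hg => simp only [map_add, hf, hg]; abel
    | single n c' =>
      simp only [loopBr_single, map_add, map_smul, loopD_single, LinearMap.smul_apply,
        show m - 1 + n = m + n - 1 by ring, show m + (n - 1) = m + n - 1 by ring]
      push_cast
      module

/-- The derivation of `𝓛` with `c(n) ↦ -n c(n-1)`. -/
def DL : X.L →ₗ[ℂ] X.L :=
  (LinearMap.range X.dHat).mapQ (LinearMap.range X.dHat) loopD
    (by rintro _ ⟨f, rfl⟩; exact X.loopD_dHat f)

theorem DL_rho (x : ℤ →₀ A × B) : X.DL (X.rho x) = X.rho (loopD x) := rfl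

theorem DL_mode (n : ℤ) (c : A × B) : X.DL (X.mode n c) = (-n : ℂ) • X.mode (n - 1) c := by
  simp only [mode, LinearMap.comp_apply, Finsupp.lsingle_apply, DL_rho, loopD_single, map_smul]

theorem DL_lie (x y : X.L) : X.DL ⁅x, y⁆ = ⁅X.DL x, y⁆ + ⁅x, X.DL y⁆ := by
  obtain ⟨x, rfl⟩ := X.rho_surjective x
  obtain ⟨y, rfl⟩ := X.rho_surjective y
  simp only [lie_rho, DL_rho, ← map_add, X.loopD_loopBr]

/-! ### The enveloping algebra `U(𝓛)`, its grading, and its derivation extending `c(n) ↦ -n c(n-1)` -/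

section Enveloping

attribute [local instance 100] LieRing.ofAssociativeRing

/-- The universal enveloping algebra `U(𝓛)`. -/
abbrev UL : Type (max u v) := UniversalEnvelopingAlgebra ℂ X.L

/-- The element `c(n)` of `U(𝓛)`. -/
def modeU (n : ℤ) : A × B →ₗ[ℂ] X.UL :=
  (UniversalEnvelopingAlgebra.ι ℂ : X.L →ₗ⁅ℂ⁆ X.UL).toLinearMap ∘ₗ X.mode n

/-- The degree `d` subspace of `U(𝓛)`, spanned by products of homogeneous elements of `𝓛` with
degrees summing up to `d`. -/
def ULdeg (d : ℤ) : Submodule ℂ X.UL :=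
  Submodule.span ℂ {y | ∃ l : List (ℤ × X.L), (∀ p ∈ l, p.2 ∈ X.homog p.1) ∧
    (l.map Prod.fst).sum = d ∧
    y = (l.map fun p => (UniversalEnvelopingAlgebra.ι ℂ p.2 : X.UL)).prod}

/-- The Lie homomorphism `x ↦ x + ε DL x` into the dual numbers over `U(𝓛)`. -/
def DLhom : X.L →ₗ⁅ℂ⁆ TrivSqZeroExt X.UL X.UL where
  toFun x := TrivSqZeroExt.inl (UniversalEnvelopingAlgebra.ι ℂ x)
    + TrivSqZeroExt.inr (UniversalEnvelopingAlgebra.ι ℂ (X.DL x))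
  map_add' x y := by ext <;> simp
  map_smul' c x := by ext <;> simp
  map_lie' := by
    intro x y
    ext
    · simp [LieRing.of_associative_ring_bracket]
    · rw [X.DL_lie, map_add]
      simp only [LieHom.map_lie, LieRing.of_associative_ring_bracket, TrivSqZeroExt.snd_add,
        TrivSqZeroExt.snd_sub, TrivSqZeroExt.snd_mul, TrivSqZeroExt.fst_add,
        TrivSqZeroExt.snd_inl, TrivSqZeroExt.snd_inr, TrivSqZeroExt.fst_inl,
        TrivSqZeroExt.fst_inr, smul_eq_mul, MulOpposite.smul_eq_mul_unop,
        MulOpposite.unop_op, zero_add, add_zero]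
      abel

/-- The derivation of `U(𝓛)` extending `c(n) ↦ -n c(n-1)`. -/
def DU : X.UL →ₗ[ℂ] X.UL :=
  (TrivSqZeroExt.sndHom X.UL X.UL).restrictScalars ℂ ∘ₗ
    (UniversalEnvelopingAlgebra.lift ℂ X.DLhom).toLinearMap

theorem fst_lift_DLhom (x : X.UL) : (UniversalEnvelopingAlgebra.lift ℂ X.DLhom x).fst = x := by
  have h : (TrivSqZeroExt.fstHom ℂ X.UL X.UL).comp (UniversalEnvelopingAlgebra.lift ℂ X.DLhom)
      = AlgHom.id ℂ X.UL := by
    refine UniversalEnvelopingAlgebra.hom_ext (R := ℂ) (LieHom.ext fun y => ?_)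
    change (UniversalEnvelopingAlgebra.lift ℂ X.DLhom (UniversalEnvelopingAlgebra.ι ℂ y)).fst = _
    rw [UniversalEnvelopingAlgebra.lift_ι_apply]
    simp [DLhom]
  exact DFunLike.congr_fun h x

theorem DU_mul (x y : X.UL) : X.DU (x * y) = x * X.DU y + X.DU x * y := by
  change (UniversalEnvelopingAlgebra.lift ℂ X.DLhom (x * y)).snd = _
  rw [map_mul, TrivSqZeroExt.snd_mul, fst_lift_DLhom, fst_lift_DLhom]
  rfl

theorem DU_modeU (n : ℤ) (c : A × B) : X.DU (X.modeU n c) = (-n : ℂ) • X.modeU (n - 1) c := by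
  change (UniversalEnvelopingAlgebra.lift ℂ X.DLhom
    (UniversalEnvelopingAlgebra.ι ℂ (X.mode n c))).snd = _
  rw [UniversalEnvelopingAlgebra.lift_ι_apply]
  change (TrivSqZeroExt.inl _ + TrivSqZeroExt.inr _ : TrivSqZeroExt X.UL X.UL).snd = _
  rw [TrivSqZeroExt.snd_add, TrivSqZeroExt.snd_inl, TrivSqZeroExt.snd_inr, zero_add, DL_mode,
    map_smul]
  rfl

end Enveloping

/-! ### The `𝓛`-module `V_𝓛`, the submodule `I_B` and the quotient `V_B` -/

/-- The left ideal `U(𝓛) 𝓛^{≥0}`, where `𝓛^{≥0}` is spanned by the `c(n)` with `n ≥ 0`. -/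
def vacIdeal : Submodule X.UL X.UL :=
  Submodule.span X.UL {y | ∃ (n : ℤ) (c : A × B), 0 ≤ n ∧ y = X.modeU n c}

/-- The module `V_𝓛 = U(𝓛) ⊗_{U(𝓛^{≥0})} ℂ` induced from the trivial module, realized as the
quotient `U(𝓛) / U(𝓛) 𝓛^{≥0}`. -/
def VL : Type (max u v) := X.UL ⧸ X.vacIdeal

instance : AddCommGroup X.VL := inferInstanceAs (AddCommGroup (X.UL ⧸ X.vacIdeal))
instance : Module X.UL X.VL := inferInstanceAs (Module X.UL (X.UL ⧸ X.vacIdeal))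
instance : Module ℂ X.VL := inferInstanceAs (Module ℂ (X.UL ⧸ X.vacIdeal))
instance : IsScalarTower ℂ X.UL X.VL := inferInstanceAs (IsScalarTower ℂ X.UL (X.UL ⧸ X.vacIdeal))

/-- The projection `U(𝓛) → V_𝓛`. -/
def toVL : X.UL →ₗ[X.UL] X.VL := X.vacIdeal.mkQ

/-- The vector `𝟏` of `V_𝓛`. -/
def vacL : X.VL := X.toVL 1

theorem DU_mem {x : X.UL} (hx : x ∈ X.vacIdeal) : X.DU x ∈ X.vacIdeal := by
  induction hx using Submodule.span_induction with
  | mem x hx =>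
    obtain ⟨n, c, hn, rfl⟩ := hx
    rw [DU_modeU]
    rcases hn.eq_or_lt with rfl | h
    · simp
    · exact Submodule.smul_of_tower_mem _ _ (Submodule.subset_span ⟨n - 1, c, by omega, rfl⟩)
  | zero => simp
  | add x y _ _ hx hy => rw [map_add]; exact add_mem hx hy
  | smul r x hx h =>
    rw [smul_eq_mul, DU_mul]
    exact add_mem (X.vacIdeal.smul_mem r h) (X.vacIdeal.smul_mem _ hx)

/-- The operator `𝒟` on `V_𝓛`, determined by `𝒟𝟏 = 0` and `[𝒟, c(n)] = -n c(n-1)`; for the vertex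
algebra `V_𝓛` it is `v ↦ v_{-2}𝟏`. -/
def DV : X.VL →ₗ[ℂ] X.VL :=
  (X.vacIdeal.restrictScalars ℂ).liftQ (X.toVL.restrictScalars ℂ ∘ₗ X.DU)
      (fun _ hx => (Submodule.Quotient.mk_eq_zero _).2 (X.DU_mem hx)) ∘ₗ
    (Submodule.Quotient.restrictScalarsEquiv ℂ X.vacIdeal).symm.toLinearMap

theorem DV_toVL (x : X.UL) : X.DV (X.toVL x) = X.toVL (X.DU x) := rfl

theorem DV_vacL : X.DV X.vacL = 0 := by
  have h := X.DU_mul 1 1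
  simp only [mul_one, one_mul] at h
  have h1 : X.DU 1 = 0 := by simpa using h
  rw [vacL, DV_toVL, h1, map_zero]

theorem DV_modeU (n : ℤ) (c : A × B) (x : X.VL) :
    X.DV (X.modeU n c • x) = X.modeU n c • X.DV x + (-n : ℂ) • X.modeU (n - 1) c • x := by
  obtain ⟨x, rfl⟩ := Submodule.mkQ_surjective _ x
  change X.DV (X.modeU n c • X.toVL x) = X.modeU n c • X.DV (X.toVL x)
    + (-n : ℂ) • X.modeU (n - 1) c • X.toVL x
  rw [← map_smul, DV_toVL, DV_toVL, smul_eq_mul, DU_mul, map_add, DU_modeU, smul_mul_assoc,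
    LinearMap.map_smul_of_tower, ← smul_eq_mul, ← smul_eq_mul, map_smul, map_smul]

/-- The vectors `e - 𝟏`, `a(-1)a' - aa'`, `a(-1)b - ab` of `V_𝓛`, where `c ∈ A ⊕ B` is identified
with `c(-1)𝟏`. Their span is `E`. -/
def E : Set X.VL :=
  {X.modeU (-1) (1, 0) • X.vacL - X.vacL}
    ∪ {x | ∃ a a' : A, x = X.modeU (-1) (a, 0) • X.modeU (-1) (a', 0) • X.vacL
        - X.modeU (-1) (a * a', 0) • X.vacL}
    ∪ {x | ∃ (a : A) (b : B), x = X.modeU (-1) (a, 0) • X.modeU (-1) (0, b) • X.vacL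
        - X.modeU (-1) (0, X.act a b) • X.vacL}

/-- `I_B = U(𝓛) ℂ[𝒟] E`. -/
def IB : Submodule X.UL X.VL :=
  Submodule.span X.UL {x | ∃ (k : ℕ), ∃ y ∈ X.E, x = (X.DV ^ k) y}

/-- The space `V_B = V_𝓛 / I_B`. -/
def VB : Type (max u v) := X.VL ⧸ X.IB

instance : AddCommGroup X.VB := inferInstanceAs (AddCommGroup (X.VL ⧸ X.IB))
instance : Module X.UL X.VB := inferInstanceAs (Module X.UL (X.VL ⧸ X.IB))
instance : Module ℂ X.VB := inferInstanceAs (Module ℂ (X.VL ⧸ X.IB))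
instance : IsScalarTower ℂ X.UL X.VB := inferInstanceAs (IsScalarTower ℂ X.UL (X.VL ⧸ X.IB))

/-- The vector `𝟏` of `V_B`. -/
def vac : X.VB := X.IB.mkQ X.vacL

/-- The vector of `V_B` given by `c ∈ A ⊕ B`, namely `c(-1)𝟏`. -/
def emb (c : A × B) : X.VB := X.modeU (-1) c • X.vac

/-- The degree `n` subspace of `V_B`. -/
def VBdeg (n : ℕ) : Submodule ℂ X.VB :=
  Submodule.span ℂ {x | ∃ y ∈ X.ULdeg n, x = y • X.vac}

/-- `𝒱` is the vertex algebra structure on `V_B` with vacuum `𝟏` such that `c_n = c(n)` for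
`c ∈ A ⊕ B`, that is, the quotient of the vertex algebra `V_𝓛` by its ideal `I_B`. -/
def IsAssociated (𝒱 : VertexAlgebra X.VB) : Prop :=
  𝒱.vac = X.vac ∧ ∀ (c : A × B) (n : ℤ) (x : X.VB), 𝒱.Y (X.emb c) n x = X.modeU n c • x

/-! ### The modules `M(U)` and `L(U)` -/

section Induced

variable (U : LieAlgebroidModule.{u, v, w} A X.G)

/-- The submodule of `U(𝓛) ⊗ U` by which one divides to obtain `U(𝓛) ⊗_{U(𝓛_(≤0))} U`.
Here `𝓛_(≤0)` is spanned by `a(n-1)` and `b(n)` with `n ≥ 0`, which act on `U` by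
`a(n-1)u = δ_{n,0} au` and `b(n)u = δ_{n,0} bu`. -/
def indRel : Submodule X.UL (X.UL ⊗[ℂ] U.carrier) :=
  Submodule.span X.UL
    ({x | ∃ (n : ℤ) (a : A) (y : U.carrier), 0 ≤ n ∧
        x = X.modeU (n - 1) (a, 0) ⊗ₜ[ℂ] y - 1 ⊗ₜ[ℂ] (if n = 0 then a • y else 0)}
      ∪ {x | ∃ (n : ℤ) (b : B) (y : U.carrier), 0 ≤ n ∧
        x = X.modeU n (0, b) ⊗ₜ[ℂ] y - 1 ⊗ₜ[ℂ] (if n = 0 then ⁅X.toG b, y⁆ else 0)})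

/-- The induced module `M(U) = U(𝓛) ⊗_{U(𝓛_(≤0))} U`. -/
def M : Type (max u v w) := (X.UL ⊗[ℂ] U.carrier) ⧸ X.indRel U

instance : AddCommGroup (X.M U) := inferInstanceAs (AddCommGroup (_ ⧸ X.indRel U))
instance : Module X.UL (X.M U) := inferInstanceAs (Module X.UL (_ ⧸ X.indRel U))
instance : Module ℂ (X.M U) := inferInstanceAs (Module ℂ (_ ⧸ X.indRel U))
instance : IsScalarTower ℂ X.UL (X.M U) :=
  inferInstanceAs (IsScalarTower ℂ X.UL (_ ⧸ X.indRel U))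

/-- The map `U → M(U)`. -/
def toM : U.carrier →ₗ[ℂ] X.M U :=
  (X.indRel U).mkQ.restrictScalars ℂ ∘ₗ TensorProduct.mk ℂ X.UL U.carrier 1

/-- The degree `n` subspace of `M(U)`, where `U` has degree `0`. -/
def Mdeg (n : ℕ) : Submodule ℂ (X.M U) :=
  Submodule.span ℂ {x | ∃ y ∈ X.ULdeg n, ∃ z : U.carrier, x = y • X.toM U z}

/-- The maximal graded submodule `J(U)` of `M(U)` with `J(U) ∩ U = 0`, as the sum of all of these
submodules. -/
def J : Submodule X.UL (X.M U) :=
  sSup {N | N.restrictScalars ℂ = ⨆ n, N.restrictScalars ℂ ⊓ X.Mdeg U n ∧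
    N.restrictScalars ℂ ⊓ LinearMap.range (X.toM U) = ⊥}

/-- `L(U) = M(U) / J(U)`. -/
def LU : Type (max u v w) := X.M U ⧸ X.J U

instance : AddCommGroup (X.LU U) := inferInstanceAs (AddCommGroup (_ ⧸ X.J U))
instance : Module X.UL (X.LU U) := inferInstanceAs (Module X.UL (_ ⧸ X.J U))
instance : Module ℂ (X.LU U) := inferInstanceAs (Module ℂ (_ ⧸ X.J U))
instance : IsScalarTower ℂ X.UL (X.LU U) :=
  inferInstanceAs (IsScalarTower ℂ X.UL (_ ⧸ X.J U))

/-- The degree `n` subspace of `L(U)`. -/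
def LUdeg (n : ℕ) : Submodule ℂ (X.LU U) :=
  (X.Mdeg U n).map ((X.J U).mkQ.restrictScalars ℂ)

/-- `𝒲` is the `V_B`-module structure on `L(U)` with `c_n = c(n)` for `c ∈ A ⊕ B`. -/
def IsAssociatedModule {𝒱 : VertexAlgebra X.VB} (𝒲 : 𝒱.VModule (X.LU U)) : Prop :=
  ∀ (c : A × B) (n : ℤ) (x : X.LU U), 𝒲.Y (X.emb c) n x = X.modeU n c • x

end Induced

end VertexAlgebroid

end

/-! Everything rests on one construction. If `W` is a restricted 𝓛-module (`c(n)x = 0` for `n ≫ 0`),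
the series with modes `c(n)` are fields on `W`, and they are pairwise local because `[c(m), c'(n)]`
has the form `P(m+n) + m Q(m+n-1)`. The space of all fields on `W` carries the products `a_(n) b`,
and the same commutator formula holds for the operators `b ↦ a_(n) b` (`Fld.nprod_comm`). So the
space of fields is itself an 𝓛-module. The identity field is killed by 𝓛^{≥0}, and the universal
property of `V_𝓛` gives an 𝓛-map `YL` from `V_𝓛` to the fields on `W` that takes 𝟏 to the identity
field.

Dong's lemma (`Fld.IsLocal.nprod_left`) keeps the image of `YL` local, and for local fields the
products satisfy the Borcherds identity (`Fld.borcherds`). The Jacobi identity is thereby reduced to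
`Y(x_n y) = Y(x)_(n) Y(y)` (`YL_YL`). Both sides are local with 𝓛 and agree at `y = 𝟏`, and this
forces equality (`eq_zero_of_local`). If the generators of `I_B` act by zero (`IsAdmissible`), the
action descends to `V_B`. This applies to `V_B` itself, which gives the vertex algebra, and to
`L(U)`. Conversely, every `V_B`-module arises from an admissible 𝓛-module. Structures are unique
because the iterate formula determines them from the fields of `c(-1)𝟏`.

Gradings are handled through Euler operators `T`, which satisfy `[T, x] = d x` for `x` of degree
`d`: homogeneous parts are eigenspaces of `T`, and graded subspaces are the `T`-stable ones. The map
from `U` to `M(U)` is injective because 𝓛 is the direct sum of its parts of positive and nonpositive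
degree, so that `U(𝓛_(>0)) ⊗ U` can be made an 𝓛-module containing `U` (`LieInduced.exists_module`).
The submodule `J(U)` consists of the vectors whose whole `U(𝓛)`-orbit stays in positive degrees
(`mem_J`).

That `L(U)` is admissible comes from the axioms of a Lie algebroid module: they say that the fields
of the generators of `I_B` send `U` into positive degrees. Since the span of these generators is
stable under 𝓛^{≥0}, commutators extend this to all of `M(U)`. The images of these fields then span
an 𝓛-submodule in positive degrees, hence inside `J(U)`.

For the classification, the degree zero part `W(0)` of a graded `V_B`-module is a module for
`B/A∂A`. If `W` is graded simple, `W(0)` is simple, and the map `M(W(0)) → W` is onto with kernel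
`J(W(0))`. In the other direction, `L(U)` is graded simple for simple `U` and has degree zero part
`U`. So `W` is isomorphic to `L(U)` exactly if `W(0)` is isomorphic to `U`. -/

noncomputable section

set_option linter.unusedSectionVars false

/-! ### Binomial transforms of doubly infinite arrays -/

section Arrays

variable {M : Type*} [AddCommGroup M] [Module ℂ M] {M' : Type*} [AddCommGroup M'] [Module ℂ M']

/-- The array `(x - y)^p A`, expanded in nonnegative powers of the second variable. -/
def binomShift (p : ℤ) (A : ℤ → ℤ → M) (m n : ℤ) : M :=
  ∑ᶠ i : ℕ, ((-1) ^ i * Ring.choose p i : ℤ) • A (p + m - i) (n + i)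

theorem finsum_eq_sum_range {f : ℕ → M} {K : ℕ} (h : ∀ i, K ≤ i → f i = 0) :
    ∑ᶠ i, f i = ∑ i ∈ Finset.range K, f i := by
  refine finsum_eq_sum_of_support_subset _ fun i hi => ?_
  simp only [Finset.coe_range, Set.mem_Iio]
  by_contra hK
  exact hi (h i (not_lt.1 hK))

theorem binomShift_eq_sum {A : ℤ → ℤ → M} {N p m n : ℤ} {K : ℕ}
    (h : ∀ m n, N ≤ n → A m n = 0) (hK : N ≤ n + K) :
    binomShift p A m n =
      ∑ i ∈ Finset.range K, ((-1) ^ i * Ring.choose p i : ℤ) • A (p + m - i) (n + i) :=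
  finsum_eq_sum_range fun i hi => by rw [h _ _ (by omega), smul_zero]

/-- The entries of `A` vanish if the second index is large. -/
def IsTrunc (A : ℤ → ℤ → M) : Prop := ∃ N, ∀ m n, N ≤ n → A m n = 0

theorem IsTrunc.add {A A' : ℤ → ℤ → M} (h : IsTrunc A) (h' : IsTrunc A') :
    IsTrunc fun m n => A m n + A' m n := by
  obtain ⟨N, h⟩ := h
  obtain ⟨N', h'⟩ := h'
  exact ⟨max N N', fun m n hn => by
    simp only [h _ _ (le_of_max_le_left hn), h' _ _ (le_of_max_le_right hn), add_zero]⟩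

theorem IsTrunc.map {A : ℤ → ℤ → M} (h : IsTrunc A) (f : M →ₗ[ℂ] M') :
    IsTrunc fun m n => f (A m n) := by
  obtain ⟨N, h⟩ := h
  exact ⟨N, fun m n hn => by simp only [h _ _ hn, map_zero]⟩

theorem IsTrunc.shift {A : ℤ → ℤ → M} (h : IsTrunc A) (k l : ℤ) :
    IsTrunc fun m n => A (m + k) (n + l) := by
  obtain ⟨N, h⟩ := h
  exact ⟨N - l, fun m n hn => h _ _ (by omega)⟩

theorem IsTrunc.sub {A A' : ℤ → ℤ → M} (h : IsTrunc A) (h' : IsTrunc A') :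
    IsTrunc fun m n => A m n - A' m n := by
  simpa [sub_eq_add_neg] using h.add (h'.map (-LinearMap.id))

theorem exists_common_range (N n : ℤ) : ∃ K : ℕ, N ≤ n + K :=
  ⟨(N - n).toNat, by omega⟩

theorem binomShift_add {A A' : ℤ → ℤ → M} (h : IsTrunc A) (h' : IsTrunc A') (p m n : ℤ) :
    binomShift p (fun m n => A m n + A' m n) m n
      = binomShift p A m n + binomShift p A' m n := by
  obtain ⟨N, hN⟩ := h
  obtain ⟨N', hN'⟩ := h'
  obtain ⟨K, hK⟩ := exists_common_range (max N N') n
  rw [binomShift_eq_sum (N := N) (K := K) hN (by omega),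
    binomShift_eq_sum (N := N') (K := K) hN' (by omega),
    binomShift_eq_sum (N := max N N') (fun m n h => by
      rw [hN _ _ (by omega), hN' _ _ (by omega), add_zero]) hK, ← Finset.sum_add_distrib]
  simp only [smul_add]

theorem map_binomShift {A : ℤ → ℤ → M} (h : IsTrunc A) (f : M →ₗ[ℂ] M') (p m n : ℤ) :
    f (binomShift p A m n) = binomShift p (fun m n => f (A m n)) m n := by
  obtain ⟨N, hN⟩ := h
  obtain ⟨K, hK⟩ := exists_common_range N n
  rw [binomShift_eq_sum hN hK, binomShift_eq_sum (N := N) (fun m n h => by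
    rw [hN _ _ h, map_zero]) hK, map_sum]
  simp only [map_zsmul]

theorem binomShift_smul {A : ℤ → ℤ → M} (h : IsTrunc A) (c : ℂ) (p m n : ℤ) :
    binomShift p (fun m n => c • A m n) m n = c • binomShift p A m n :=
  (map_binomShift h (LinearMap.lsmul ℂ M c) p m n).symm

theorem binomShift_sub {A A' : ℤ → ℤ → M} (h : IsTrunc A) (h' : IsTrunc A') (p m n : ℤ) :
    binomShift p (fun m n => A m n - A' m n) m n
      = binomShift p A m n - binomShift p A' m n := by
  have := binomShift_add h (h'.map (-LinearMap.id)) p m n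
  rw [← map_binomShift h' (-LinearMap.id)] at this
  simpa [sub_eq_add_neg] using this

@[simp] theorem binomShift_zero_left (A : ℤ → ℤ → M) (m n : ℤ) : binomShift 0 A m n = A m n := by
  rw [binomShift, finsum_eq_single _ 0]
  · simp
  · intro i hi
    rw [Ring.choose_zero_pos ℤ (Nat.pos_of_ne_zero hi)]
    simp

theorem binomShift_zero_array (p m n : ℤ) : binomShift p (fun _ _ => (0 : M)) m n = 0 := by
  simp [binomShift]

theorem binomShift_shift (A : ℤ → ℤ → M) (p m n k l : ℤ) :
    binomShift p (fun m n => A (m + k) (n + l)) m n = binomShift p A (m + k) (n + l) := by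
  simp only [binomShift]
  refine finsum_congr fun i => ?_
  rw [show p + m - (i : ℤ) + k = p + (m + k) - i by ring, show n + (i : ℤ) + l = n + l + i by ring]

/-- `(x - y)^(p + 1) A = x (x - y)^p A - y (x - y)^p A`. -/
theorem binomShift_succ {A : ℤ → ℤ → M} (h : IsTrunc A) (p m n : ℤ) :
    binomShift (p + 1) A m n = binomShift p A (m + 1) n - binomShift p A m (n + 1) := by
  obtain ⟨N, hN⟩ := h
  obtain ⟨K, hK⟩ := exists_common_range N n
  rw [binomShift_eq_sum (K := K + 1) hN (by push_cast; omega),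
    binomShift_eq_sum (K := K + 1) hN (by push_cast; omega),
    binomShift_eq_sum (K := K) hN (by omega), Finset.sum_range_succ', Finset.sum_range_succ']
  have key : ∀ {a b c d e : M}, a = c - e → b = d → a + b = c + d - e := by
    rintro a b c d e rfl rfl
    abel
  refine key (Eq.trans ?_ (Finset.sum_sub_distrib _ _)) ?_
  · refine Finset.sum_congr rfl fun i _ => ?_
    rw [Ring.choose_succ_succ, show p + 1 + m - ((i + 1 : ℕ) : ℤ) = p + m - i by push_cast; ring,
      show p + (m + 1) - ((i + 1 : ℕ) : ℤ) = p + m - i by push_cast; ring,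
      show n + ((i + 1 : ℕ) : ℤ) = n + 1 + i by push_cast; ring, ← sub_smul]
    congr 1
    ring
  · simp only [Ring.choose_zero_right]
    rw [show p + 1 + m = p + (m + 1) by ring]

/-- The array `(x - y)^l A - (-y + x)^l B`; the index order of `B` is opposite to that of `A`. -/
def borcherdsSum (A B : ℤ → ℤ → M) (l m n : ℤ) : M :=
  binomShift l A m n - ((Int.negOnePow l : ℤˣ) : ℤ) • binomShift l B n m

theorem borcherdsSum_zero (A B : ℤ → ℤ → M) (m n : ℤ) :
    borcherdsSum A B 0 m n = A m n - B n m := by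
  simp [borcherdsSum]

/-- Pascal's rule for each of the two expansions. In the second the variables are exchanged, and the
alternating sign `(-1)^l` compensates. -/
theorem borcherdsSum_succ {A B : ℤ → ℤ → M} (hA : IsTrunc A) (hB : IsTrunc B) (l m n : ℤ) :
    borcherdsSum A B (l + 1) m n = borcherdsSum A B l (m + 1) n - borcherdsSum A B l m (n + 1) := by
  rw [borcherdsSum, binomShift_succ hA, binomShift_succ hB, borcherdsSum, borcherdsSum,
    Int.negOnePow_succ]
  push_cast
  rw [neg_smul, smul_sub]
  abel

/-- The bridge to the right side of `JacobiIdentity`: truncation allows both expansions to be summed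
over one common finite range. -/
theorem borcherdsSum_eq_finsum {A B : ℤ → ℤ → M} (hA : IsTrunc A) (hB : IsTrunc B) (l m n : ℤ) :
    borcherdsSum A B l m n = ∑ᶠ i : ℕ, ((-1) ^ i * Ring.choose l i : ℤ) •
        (A (l + m - i) (n + i) - ((Int.negOnePow l : ℤˣ) : ℤ) • B (l + n - i) (m + i)) := by
  obtain ⟨N, hN⟩ := hA
  obtain ⟨N', hN'⟩ := hB
  obtain ⟨K, hK⟩ := exists_common_range (max (N - n) (N' - m)) 0
  rw [borcherdsSum, binomShift_eq_sum (K := K) hN (by omega),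
    binomShift_eq_sum (K := K) hN' (by omega), finsum_eq_sum_range (K := K), Finset.smul_sum,
    ← Finset.sum_sub_distrib]
  · refine Finset.sum_congr rfl fun i _ => ?_
    rw [smul_sub, smul_comm]
  · intro i hi
    rw [hN _ _ (by omega), hN' _ _ (by omega)]
    simp

/-- A family `X l` of arrays with `X (l + 1) = (x - y) X l` that vanishes for large `l` is
determined by the entries `X l 0 n`. -/
theorem eq_finsum_of_recurrence {X : ℤ → ℤ → ℤ → M}
    (hX : ∀ l m n, X (l + 1) m n = X l (m + 1) n - X l m (n + 1)) {N : ℤ}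
    (hN : ∀ l m n, N ≤ l → X l m n = 0) (l m n : ℤ) :
    X l m n = ∑ᶠ i : ℕ, (Ring.choose m i : ℤ) • X (l + i) 0 (m + n - i) := by
  obtain ⟨k, hk⟩ : ∃ k : ℕ, N ≤ l + k := exists_common_range N l
  rw [finsum_eq_sum_range (K := k) (fun i hi => by rw [hN _ _ _ (by omega), smul_zero])]
  induction k generalizing l m n with
  | zero => rw [hN _ _ _ (by simpa using hk)]; simp
  | succ k ih =>
    -- The induction runs downward in `l`, with `k` bounding the distance to `N`. By the recurrence
    -- and the induction hypothesis at `l + 1`, the defect `D` is constant on antidiagonals. It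
    -- vanishes at `m = 0`, where only the term `i = 0` survives.
    set D : ℤ → ℤ → M := fun m n => X l m n -
      ∑ i ∈ Finset.range (k + 1), (Ring.choose m i : ℤ) • X (l + i) 0 (m + n - i) with hD
    have h1 : ∀ m n, D (m + 1) n = D m (n + 1) := by
      intro m n
      rw [← sub_eq_zero]
      have e := ih (l + 1) m n (by push_cast at hk; omega)
      rw [hX] at e
      have e2 : ∑ i ∈ Finset.range (k + 1),
            (Ring.choose (m + 1) i : ℤ) • X (l + i) 0 (m + 1 + n - i)
          - ∑ i ∈ Finset.range (k + 1), (Ring.choose m i : ℤ) • X (l + i) 0 (m + (n + 1) - i)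
          = ∑ i ∈ Finset.range k, (Ring.choose m i : ℤ) • X (l + 1 + i) 0 (m + n - i) := by
        rw [← Finset.sum_sub_distrib, Finset.sum_range_succ']
        have : (Ring.choose (m + 1) 0 : ℤ) • X (l + (0 : ℕ)) 0 (m + 1 + n - (0 : ℕ))
          - (Ring.choose m 0 : ℤ) • X (l + (0 : ℕ)) 0 (m + (n + 1) - (0 : ℕ)) = 0 := by
          rw [Ring.choose_zero_right, Ring.choose_zero_right,
            show m + 1 + n = m + (n + 1) by ring, sub_self]
        rw [this, add_zero]
        refine Finset.sum_congr rfl fun i _ => ?_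
        rw [Ring.choose_succ_succ, show m + 1 + n - ((i + 1 : ℕ) : ℤ) = m + n - i by push_cast; ring,
          show m + (n + 1) - ((i + 1 : ℕ) : ℤ) = m + n - i by push_cast; ring,
          show l + ((i + 1 : ℕ) : ℤ) = l + 1 + i by push_cast; ring, ← sub_smul, add_sub_cancel_right]
      simp only [hD]
      rw [sub_sub_sub_comm, e, e2, sub_self]
    have h0 : ∀ n, D 0 n = 0 := by
      intro n
      simp only [hD]
      rw [Finset.sum_range_succ', Finset.sum_eq_zero]
      · simp
      · intro i _
        rw [Ring.choose_zero_pos ℤ (Nat.succ_pos i), zero_smul]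
    have h2 : ∀ m n, D m n = 0 := by
      intro m
      induction m using Int.induction_on with
      | zero => exact h0
      | succ i hi => intro n; rw [h1]; exact hi _
      | pred i hi =>
        intro n
        have := h1 (-(i : ℤ) - 1) (n - 1)
        rw [sub_add_cancel, sub_add_cancel] at this
        rw [← this]
        exact hi _
    exact sub_eq_zero.1 (h2 m n)

/-- Multiplication by `x - y` on two-variable arrays. -/
def diffOp : (ℤ → ℤ → M) →ₗ[ℂ] (ℤ → ℤ → M) where
  toFun C m n := C (m + 1) n - C m (n + 1)
  map_add' C C' := by funext m n; simp only [Pi.add_apply]; abel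
  map_smul' c C := by funext m n; simp [smul_sub]

theorem diffOp_apply (C : ℤ → ℤ → M) (m n : ℤ) : diffOp C m n = C (m + 1) n - C m (n + 1) := rfl

theorem diffOp_pow_map (f : M →ₗ[ℂ] M') (N : ℕ) (C : ℤ → ℤ → M) :
    (diffOp ^ N) (fun m n => f (C m n)) = fun m n => f ((diffOp ^ N) C m n) := by
  induction N with
  | zero => rfl
  | succ N ih =>
    rw [pow_succ', Module.End.mul_apply, ih, pow_succ', Module.End.mul_apply]
    funext m n
    simp [diffOp_apply]

theorem diffOp_pow_eq_zero_of_le {C : ℤ → ℤ → M} {N N' : ℕ} (h : (diffOp ^ N) C = 0)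
    (hN : N ≤ N') : (diffOp ^ N') C = 0 := by
  obtain ⟨k, rfl⟩ := Nat.exists_eq_add_of_le hN
  rw [add_comm, pow_add, Module.End.mul_apply, h, map_zero]

theorem diffOp_pow_trunc {C : ℤ → ℤ → M} (h : IsTrunc C) (N : ℕ) : IsTrunc ((diffOp ^ N) C) := by
  induction N with
  | zero => exact h
  | succ N ih =>
    rw [pow_succ', Module.End.mul_apply]
    have := (ih.shift 1 0).sub (ih.shift 0 1)
    simp only [add_zero] at this
    exact this

/-- Multiplication by `x - y` is injective on truncated arrays: an array that it kills is constant
on antidiagonals, and sliding along an antidiagonal reaches indices where the array vanishes. -/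
theorem eq_zero_of_diffOp_pow {C : ℤ → ℤ → M} (h : IsTrunc C) {N : ℕ} (hN : (diffOp ^ N) C = 0) :
    C = 0 := by
  induction N with
  | zero => exact hN
  | succ N ih =>
    apply ih
    rw [pow_succ', Module.End.mul_apply] at hN
    obtain ⟨K, hK⟩ := diffOp_pow_trunc h N
    set C' := (diffOp ^ N) C
    have e : ∀ m n, C' (m + 1) n = C' m (n + 1) := fun m n =>
      sub_eq_zero.1 (congrFun (congrFun hN m) n)
    have e' : ∀ (k : ℕ) m n, C' m n = C' (m - k) (n + k) := by
      intro k
      induction k with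
      | zero => simp
      | succ k ih =>
        intro m n
        rw [ih, show m - (k : ℤ) = (m - (k + 1 : ℕ)) + 1 by push_cast; ring, e]
        congr 1
        push_cast
        ring
    funext m n
    obtain ⟨k, hk⟩ := exists_common_range K n
    rw [e' k, hK _ _ hk]
    rfl

/-- For a nonnegative exponent the two expansions of `(x - y)^N` are the same polynomial, so it can
be applied to the commutator array as a whole. -/
theorem borcherdsSum_natCast {A B : ℤ → ℤ → M} (hA : IsTrunc A) (hB : IsTrunc B) (N : ℕ) :
    borcherdsSum A B N = (diffOp ^ N) fun m n => A m n - B n m := by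
  induction N with
  | zero => funext m n; simp [borcherdsSum_zero]
  | succ N ih =>
    rw [pow_succ', Module.End.mul_apply, ← ih]
    funext m n
    push_cast
    exact borcherdsSum_succ hA hB _ _ _

/-- A family of sequences with `Z (m + 1) k = Z m (k + 1) - τ (Z m k)`, where `τ` is the shift, is
zero if `Z 0` is zero and a truncation condition holds. -/
theorem eq_zero_of_shift_recurrence {Z : ℤ → ℤ → ℤ → M}
    (hZ : ∀ m k j, Z (m + 1) k j = Z m (k + 1) j - Z m k (j + 1)) (h0 : ∀ k j, Z 0 k j = 0)
    (ht : ∀ m, (∃ N, ∀ k j, N ≤ j → Z m k j = 0) ∨ ∃ N, ∀ k j, N ≤ k → Z m k j = 0) :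
    ∀ m k j, Z m k j = 0 := by
  intro m
  induction m using Int.induction_on with
  | zero => exact h0
  | succ i hi => intro k j; rw [hZ, hi, hi, sub_zero]
  | pred i hi =>
    set m := -(i : ℤ) - 1
    -- In the downward step the recurrence only says that `Z m` is constant on antidiagonals.
    -- Truncation in either index then kills it: slide towards large `j` or towards large `k`.
    have e : ∀ k j, Z m (k + 1) j = Z m k (j + 1) := fun k j => by
      rw [← sub_eq_zero, ← hZ, sub_add_cancel, hi]
    intro k j
    rcases ht m with ⟨N, hN⟩ | ⟨N, hN⟩
    · have e' : ∀ (t : ℕ) k j, Z m k j = Z m (k - t) (j + t) := by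
        intro t
        induction t with
        | zero => simp
        | succ t ih =>
          intro k j
          rw [ih, show k - (t : ℤ) = (k - (t + 1 : ℕ)) + 1 by push_cast; ring, e]
          congr 1
          push_cast
          ring
      obtain ⟨t, ht⟩ := exists_common_range N j
      rw [e' t, hN _ _ ht]
    · have e' : ∀ (t : ℕ) k j, Z m k j = Z m (k + t) (j - t) := by
        intro t
        induction t with
        | zero => simp
        | succ t ih =>
          intro k j
          rw [ih, show j - (t : ℤ) = (j - (t + 1 : ℕ)) + 1 by push_cast; ring, ← e]
          congr 1
          push_cast
          ring
      obtain ⟨t, ht⟩ := exists_common_range N k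
      rw [e' t, hN _ _ ht]

end Arrays

/-! ### Fields and their products -/

/-- The space of fields on `W`: sequences of operators `f n` with `f n x = 0` for `n ≫ 0`. -/
def Fld (W : Type w) [AddCommGroup W] [Module ℂ W] : Submodule ℂ (ℤ → Module.End ℂ W) where
  carrier := {f | ∀ x, ∃ N, ∀ n, N ≤ n → f n x = 0}
  add_mem' {f g} hf hg x := by
    obtain ⟨N, hN⟩ := hf x
    obtain ⟨N', hN'⟩ := hg x
    exact ⟨max N N', fun n hn => by
      rw [Pi.add_apply, LinearMap.add_apply, hN _ (le_of_max_le_left hn),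
        hN' _ (le_of_max_le_right hn), add_zero]⟩
  zero_mem' x := ⟨0, fun _ _ => rfl⟩
  smul_mem' c f hf x := by
    obtain ⟨N, hN⟩ := hf x
    exact ⟨N, fun n hn => by
      rw [Pi.smul_apply, LinearMap.smul_apply, hN _ hn, smul_zero]⟩

namespace Fld

variable {W : Type w} [AddCommGroup W] [Module ℂ W]

@[ext] theorem ext {f g : Fld W} (h : ∀ n x, f.1 n x = g.1 n x) : f = g :=
  Subtype.ext (funext fun n => LinearMap.ext (h n))

@[simp] theorem add_apply (f g : Fld W) (n : ℤ) (x : W) : (f + g).1 n x = f.1 n x + g.1 n x := rfl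
@[simp] theorem sub_apply (f g : Fld W) (n : ℤ) (x : W) : (f - g).1 n x = f.1 n x - g.1 n x := rfl
@[simp] theorem smul_apply (c : ℂ) (f : Fld W) (n : ℤ) (x : W) : (c • f).1 n x = c • f.1 n x := rfl
@[simp] theorem zsmul_apply (c : ℤ) (f : Fld W) (n : ℤ) (x : W) :
    (c • f).1 n x = c • f.1 n x := rfl
@[simp] theorem neg_apply (f : Fld W) (n : ℤ) (x : W) : (-f).1 n x = -f.1 n x := rfl
@[simp] theorem zero_apply (n : ℤ) (x : W) : (0 : Fld W).1 n x = 0 := rfl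

/-- The value of the `n`-th mode at `x`, as a linear function of the field. -/
def evalAt (n : ℤ) (x : W) : Fld W →ₗ[ℂ] W where
  toFun f := f.1 n x
  map_add' _ _ := rfl
  map_smul' _ _ := rfl

@[simp] theorem evalAt_apply (n : ℤ) (x : W) (f : Fld W) : evalAt n x f = f.1 n x := rfl

/-- Multiplication of fields by `z^k`. -/
def shift (k : ℤ) : Fld W →ₗ[ℂ] Fld W where
  toFun f := ⟨fun n => f.1 (n + k), fun x => by
    obtain ⟨N, hN⟩ := f.2 x
    exact ⟨N - k, fun n hn => hN _ (by omega)⟩⟩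
  map_add' _ _ := rfl
  map_smul' _ _ := rfl

@[simp] theorem shift_apply (k : ℤ) (f : Fld W) (n : ℤ) (x : W) :
    (shift k f).1 n x = f.1 (n + k) x := rfl

theorem shift_shift (k l : ℤ) (f : Fld W) : shift k (shift l f) = shift (k + l) f := by
  ext n x; simp [add_assoc]

theorem shift_zero (f : Fld W) : shift 0 f = f := by
  ext n x; simp

theorem isTrunc_left (a b : Fld W) (x : W) : IsTrunc fun m n => a.1 m (b.1 n x) := by
  obtain ⟨N, hN⟩ := b.2 x
  exact ⟨N, fun m n hn => by simp only [hN _ hn, map_zero]⟩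

/-- The modes of the field `Res_x (x - z)^p a(x) b(z)`. -/
def lmulFun (p : ℤ) (a b : Fld W) (n : ℤ) : Module.End ℂ W where
  toFun x := binomShift p (fun i j => a.1 i (b.1 j x)) 0 n
  map_add' x y := by
    rw [← binomShift_add (isTrunc_left a b x) (isTrunc_left a b y)]
    simp only [map_add]
  map_smul' c x := by
    rw [RingHom.id_apply, ← binomShift_smul (isTrunc_left a b x)]
    simp only [map_smul]

theorem lmulFun_apply (p : ℤ) (a b : Fld W) (n : ℤ) (x : W) :
    lmulFun p a b n x = binomShift p (fun i j => a.1 i (b.1 j x)) 0 n := rfl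

theorem lmulFun_eq_zero (p : ℤ) (a : Fld W) {b : Fld W} {N n : ℤ} {x : W}
    (h : ∀ j, N ≤ j → b.1 j x = 0) (hn : N ≤ n) : lmulFun p a b n x = 0 := by
  rw [lmulFun_apply, binomShift_eq_sum (N := N) (K := 0) (fun m n hn => by simp only [h _ hn, map_zero])
    (by simpa using hn)]
  rfl

/-- The operator `b(z) ↦ Res_x (x - z)^p a(x) b(z)`. -/
def lmul (p : ℤ) : Fld W →ₗ[ℂ] Module.End ℂ (Fld W) :=
  LinearMap.mk₂ ℂ
    (fun a b => ⟨lmulFun p a b, fun x => by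
        obtain ⟨N, hN⟩ := b.2 x
        exact ⟨N, fun n hn => lmulFun_eq_zero p a hN hn⟩⟩)
    (fun a a' b => by
      ext n x
      exact binomShift_add (isTrunc_left a b x) (isTrunc_left a' b x) p 0 n)
    (fun c a b => by
      ext n x
      exact binomShift_smul (isTrunc_left a b x) c p 0 n)
    (fun a b b' => by
      ext n x
      refine Eq.trans ?_ (binomShift_add (isTrunc_left a b x) (isTrunc_left a b' x) p 0 n)
      simp only [lmulFun_apply, ← map_add]
      rfl)
    (fun c a b => by
      ext n x
      refine Eq.trans ?_ (binomShift_smul (isTrunc_left a b x) c p 0 n)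
      simp only [lmulFun_apply, smul_apply, map_smul])

theorem lmul_apply (p : ℤ) (a b : Fld W) (n : ℤ) (x : W) :
    (lmul p a b).1 n x = binomShift p (fun i j => a.1 i (b.1 j x)) 0 n := rfl

theorem lmul_eq_zero (p : ℤ) (a : Fld W) {b : Fld W} {N n : ℤ} {x : W}
    (h : ∀ j, N ≤ j → b.1 j x = 0) (hn : N ≤ n) : (lmul p a b).1 n x = 0 :=
  lmulFun_eq_zero p a h hn

/-- The modes of the field `Res_x (-z + x)^p b(z) a(x)`. -/
def rmulFun (p : ℤ) (a b : Fld W) (n : ℤ) : Module.End ℂ W where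
  toFun x := ((Int.negOnePow p : ℤˣ) : ℤ) • binomShift p (fun j i => b.1 j (a.1 i x)) n 0
  map_add' x y := by
    rw [← smul_add, ← binomShift_add (isTrunc_left b a x) (isTrunc_left b a y)]
    simp only [map_add]
  map_smul' c x := by
    rw [RingHom.id_apply, smul_comm c, ← binomShift_smul (isTrunc_left b a x)]
    simp only [map_smul]

theorem rmulFun_apply (p : ℤ) (a b : Fld W) (n : ℤ) (x : W) : rmulFun p a b n x =
    ((Int.negOnePow p : ℤˣ) : ℤ) • binomShift p (fun j i => b.1 j (a.1 i x)) n 0 := rfl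

/-- For given `x`, only the values of `b` at finitely many vectors, with finitely many shifts of
the index, contribute to the modes of `Res_x (-z + x)^p b(z) a(x)` at `x`. -/
theorem exists_rmulFun_eq_zero (p : ℤ) (a : Fld W) (b : Fld W) (x : W) :
    ∃ N, ∀ b' : Fld W, (∀ y j, (∀ i, j ≤ i → b.1 i y = 0) → ∀ i, j ≤ i → b'.1 i y = 0) →
      ∀ n, N ≤ n → rmulFun p a b' n x = 0 := by
  obtain ⟨N, hN⟩ := a.2 x
  obtain ⟨K, hK⟩ := exists_common_range N 0
  choose f hf using fun i : ℕ => b.2 (a.1 (0 + i) x)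
  obtain ⟨B, hB⟩ := ((Finset.range K).image fun i : ℕ => f i + i - p).exists_le
  refine ⟨B, fun b' hb' n hn => ?_⟩
  rw [rmulFun_apply, binomShift_eq_sum (N := N) (K := K) (fun m n hn => by simp only [hN _ hn, map_zero]) hK,
    Finset.sum_eq_zero, smul_zero]
  intro i hi
  have := hB _ (Finset.mem_image_of_mem _ hi)
  rw [hb' _ (f i) (hf i) _ (by omega), smul_zero]

/-- The operator `b(z) ↦ Res_x (-z + x)^p b(z) a(x)`. -/
def rmul (p : ℤ) : Fld W →ₗ[ℂ] Module.End ℂ (Fld W) :=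
  LinearMap.mk₂ ℂ
    (fun a b => ⟨rmulFun p a b, fun x => by
        obtain ⟨N, hN⟩ := exists_rmulFun_eq_zero p a b x
        exact ⟨N, fun n hn => hN b (fun _ _ h => h) n hn⟩⟩)
    (fun a a' b => by
      ext n x
      simp only [add_apply, rmulFun_apply]
      rw [← smul_add, ← binomShift_add (isTrunc_left b a x) (isTrunc_left b a' x) p n 0]
      simp only [map_add])
    (fun c a b => by
      ext n x
      simp only [smul_apply, rmulFun_apply]
      rw [smul_comm c, ← binomShift_smul (isTrunc_left b a x) c p n 0]
      simp only [map_smul])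
    (fun a b b' => by
      ext n x
      simp only [add_apply, rmulFun_apply]
      rw [← smul_add, ← binomShift_add (isTrunc_left b a x) (isTrunc_left b' a x) p n 0])
    (fun c a b => by
      ext n x
      simp only [smul_apply, rmulFun_apply]
      rw [smul_comm c, ← binomShift_smul (isTrunc_left b a x) c p n 0])

theorem rmul_apply (p : ℤ) (a b : Fld W) (n : ℤ) (x : W) :
    (rmul p a b).1 n x =
      ((Int.negOnePow p : ℤˣ) : ℤ) • binomShift p (fun j i => b.1 j (a.1 i x)) n 0 := rfl

theorem rmul_eq_zero (p : ℤ) {a b : Fld W} {n : ℤ} {x : W}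
    (h : ∀ i j, 0 ≤ i → b.1 j (a.1 i x) = 0) : (rmul p a b).1 n x = 0 := by
  rw [rmul_apply, binomShift_eq_sum (N := 0) (K := 0) (fun m n hn => h _ _ hn) le_rfl]
  simp

/-- This is `(x - z)^(p+1) = x (x - z)^p - z (x - z)^p`, where `shift 1` is multiplication by `x` on
the inner field and by `z` on the outer one. Together with `eq_zero_of_shift_recurrence` it reduces
identities for all exponents, negative ones included, to the exponent `0`. -/
theorem lmul_succ (p : ℤ) (a b : Fld W) :
    lmul (p + 1) a b = lmul p (shift 1 a) b - shift 1 (lmul p a b) := by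
  ext n x
  rw [lmul_apply, binomShift_succ (isTrunc_left a b x), sub_apply, shift_apply, lmul_apply,
    lmul_apply]
  congr 1
  have := binomShift_shift (fun i j => a.1 i (b.1 j x)) p 0 n 1 0
  simp only [add_zero] at this
  exact this.symm

theorem rmul_succ (p : ℤ) (a b : Fld W) :
    rmul (p + 1) a b = rmul p (shift 1 a) b - shift 1 (rmul p a b) := by
  ext n x
  rw [rmul_apply, binomShift_succ (isTrunc_left b a x), sub_apply, shift_apply, rmul_apply,
    rmul_apply, Int.negOnePow_succ]
  have := binomShift_shift (fun j i => b.1 j (a.1 i x)) p n 0 0 1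
  simp only [add_zero] at this
  simp only [shift_apply]
  rw [this]
  push_cast
  rw [neg_smul, smul_sub]
  abel

theorem lmul_zero_apply (a b : Fld W) (n : ℤ) (x : W) : (lmul 0 a b).1 n x = a.1 0 (b.1 n x) := by
  rw [lmul_apply, binomShift_zero_left]

theorem rmul_zero_apply (a b : Fld W) (n : ℤ) (x : W) : (rmul 0 a b).1 n x = b.1 n (a.1 0 x) := by
  rw [rmul_apply, binomShift_zero_left]
  simp

theorem lmul_shift (p : ℤ) (a b : Fld W) (k : ℤ) :
    lmul p a (shift k b) = shift k (lmul p a b) := by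
  ext n x
  have := binomShift_shift (fun i j => a.1 i (b.1 j x)) p 0 n 0 k
  simp only [add_zero] at this
  exact this

theorem rmul_shift (p : ℤ) (a b : Fld W) (k : ℤ) :
    rmul p a (shift k b) = shift k (rmul p a b) := by
  ext n x
  have := binomShift_shift (fun j i => b.1 j (a.1 i x)) p n 0 k 0
  simp only [add_zero] at this
  rw [shift_apply, rmul_apply, rmul_apply, ← this]
  rfl

/-- The `p`-th product `a_(p) b` of fields. -/
def nprod (p : ℤ) : Fld W →ₗ[ℂ] Module.End ℂ (Fld W) where
  toFun a := lmul p a - rmul p a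
  map_add' a b := by
    refine LinearMap.ext fun g => ?_
    simp only [map_add, LinearMap.add_apply, LinearMap.sub_apply]
    abel
  map_smul' c a := by
    refine LinearMap.ext fun g => ?_
    simp only [map_smul, LinearMap.smul_apply, LinearMap.sub_apply, smul_sub, RingHom.id_apply]

theorem nprod_eq (p : ℤ) (a b : Fld W) : nprod p a b = lmul p a b - rmul p a b := rfl

theorem nprod_apply (p : ℤ) (a b : Fld W) (n : ℤ) (x : W) : (nprod p a b).1 n x =
    borcherdsSum (fun m n => a.1 m (b.1 n x)) (fun n m => b.1 n (a.1 m x)) p 0 n := rfl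

theorem nprod_succ (p : ℤ) (a b : Fld W) :
    nprod (p + 1) a b = nprod p (shift 1 a) b - shift 1 (nprod p a b) := by
  simp only [nprod_eq, lmul_succ, rmul_succ, map_sub]
  abel

/-- The commutators of the modes of `a` and `b`. -/
def comm (a b : Fld W) (m n : ℤ) : Module.End ℂ W := a.1 m * b.1 n - b.1 n * a.1 m

/-- Mutual locality of fields. -/
def IsLocal (a b : Fld W) : Prop := ∃ N : ℕ, (diffOp ^ N) (comm a b) = 0

/-- At `p = 0` left multiplication is composition with a single mode of `a` on the outside, which
passes through the finite sum defining `rmul q`. The recurrence in `p` does the rest, both sides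
being truncated in the mode index uniformly in the shift of `a`. -/
theorem lmul_comm_rmul (p q : ℤ) (a b g : Fld W) :
    lmul p a (rmul q b g) = rmul q b (lmul p a g) := by
  have key : ∀ x : W, ∀ m k j, (lmul m (shift k a) (rmul q b g)
      - rmul q b (lmul m (shift k a) g)).1 j x = 0 := by
    intro x
    refine eq_zero_of_shift_recurrence ?_ ?_ ?_
    · intro m k j
      rw [lmul_succ, lmul_succ, shift_shift, add_comm 1 k, map_sub, rmul_shift]
      simp only [sub_apply, shift_apply]
      abel
    · intro k j
      rw [sub_apply, lmul_zero_apply, rmul_apply, rmul_apply, map_zsmul,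
        map_binomShift (isTrunc_left g b x)]
      simp only [lmul_zero_apply, sub_self]
    · intro m
      left
      obtain ⟨N, hN⟩ := (rmul q b g).2 x
      obtain ⟨N', hN'⟩ := exists_rmulFun_eq_zero q b g x
      refine ⟨max N N', fun k j hj => ?_⟩
      rw [sub_apply, lmul_eq_zero m _ hN (by omega), zero_sub, neg_eq_zero]
      exact hN' _ (fun y j h i hi => lmul_eq_zero m _ h hi) j (by omega)
  have := key
  ext j x
  rw [← sub_eq_zero, ← sub_apply]
  simpa only [shift_zero] using this x p 0 j

/-- Here `m, n` are exponents and `k, l` are shifts of the two fields. By `h1` and `h2`, a factor `x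
- y` in `(m, n)` equals one in `(k, l)`, as the shifts of `j` cancel. Trading factors one at a time
leads to `N = 0`, where the zero array is propagated first in `m` and then in `n`. -/
theorem diffOp_pow_eq_zero_of_shift_recurrence {M : Type*} [AddCommGroup M] [Module ℂ M]
    {Y : ℤ → ℤ → ℤ → ℤ → ℤ → M}
    (h1 : ∀ m n k l j, Y (m + 1) n k l j = Y m n (k + 1) l j - Y m n k l (j + 1))
    (h2 : ∀ m n k l j, Y m (n + 1) k l j = Y m n k (l + 1) j - Y m n k l (j + 1))
    (ht : ((∀ m n l, ∃ N, ∀ k j, N ≤ j → Y m n k l j = 0)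
        ∧ ∀ m n k, ∃ N, ∀ l j, N ≤ j → Y m n k l j = 0)
      ∨ (∀ m n l, ∃ N, ∀ k j, N ≤ k → Y m n k l j = 0)
        ∧ ∀ m n k, ∃ N, ∀ l j, N ≤ l → Y m n k l j = 0) {N : ℕ}
    (h0 : ∀ j, (diffOp ^ N) (fun k l => Y 0 0 k l j) = 0) (k l j : ℤ) :
    (diffOp ^ N) (fun m n => Y m n k l j) = 0 := by
  induction N generalizing Y k l j with
  | zero =>
    have e0 : ∀ k l j, Y 0 0 k l j = 0 := fun k l j => congrFun (congrFun (h0 j) k) l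
    have e1 : ∀ m k l j, Y m 0 k l j = 0 := fun m k l j =>
      eq_zero_of_shift_recurrence (Z := fun m k j => Y m 0 k l j) (fun m k j => h1 m 0 k l j)
        (fun k j => e0 k l j) (fun m => ht.imp (fun h => h.1 m 0 l) (fun h => h.1 m 0 l)) m k j
    funext m n
    exact eq_zero_of_shift_recurrence (Z := fun n l j => Y m n k l j) (fun n l j => h2 m n k l j)
      (fun l j => e1 m k l j) (fun n => ht.imp (fun h => h.2 m n k) (fun h => h.2 m n k)) n l j
  | succ N ih =>
    have e : ∀ k l j, diffOp (fun m n => Y m n k l j) =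
        fun m n => Y m n (k + 1) l j - Y m n k (l + 1) j := by
      intro k l j
      funext m n
      rw [diffOp_apply, h1, h2]
      abel
    rw [pow_succ, Module.End.mul_apply, e]
    refine ih (Y := fun m n k l j => Y m n (k + 1) l j - Y m n k (l + 1) j) ?_ ?_ ?_ ?_ k l j
    · intro m n k l j
      simp only [h1]
      abel
    · intro m n k l j
      simp only [h2]
      abel
    · refine ht.imp (fun h => ⟨fun m n l => ?_, fun m n k => ?_⟩)
        (fun h => ⟨fun m n l => ?_, fun m n k => ?_⟩)
      · obtain ⟨N, hN⟩ := h.1 m n l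
        obtain ⟨N', hN'⟩ := h.1 m n (l + 1)
        exact ⟨max N N', fun k j hj => by
          simp only [hN _ _ (le_of_max_le_left hj), hN' _ _ (le_of_max_le_right hj), sub_zero]⟩
      · obtain ⟨N, hN⟩ := h.2 m n (k + 1)
        obtain ⟨N', hN'⟩ := h.2 m n k
        exact ⟨max N N', fun l j hj => by
          simp only [hN _ _ (le_of_max_le_left hj), hN' _ _ (le_of_max_le_right hj), sub_zero]⟩
      · obtain ⟨N, hN⟩ := h.1 m n l
        obtain ⟨N', hN'⟩ := h.1 m n (l + 1)
        exact ⟨max N N', fun k j hj => by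
          simp only [hN (k + 1) j (by omega), hN' k j (by omega), sub_zero]⟩
      · obtain ⟨N, hN⟩ := h.2 m n (k + 1)
        obtain ⟨N', hN'⟩ := h.2 m n k
        exact ⟨max N N', fun l j hj => by
          simp only [hN l j (by omega), hN' (l + 1) j (by omega), sub_zero]⟩
    · intro j
      have := h0 j
      rwa [pow_succ, Module.End.mul_apply] at this

/-- Locality of two fields passes, with the same order, to the operators of taking products with
them. The mixed terms cancel by `lmul_comm_rmul`, leaving a left-left and a right-right commutator.
At exponents zero these are the ordinary commutators `[a_k, b_l]` composed with a mode of `g`. -/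
theorem comm_eq_diffOp_shift {a b : Fld W} {N : ℕ} (h : (diffOp ^ N) (comm a b) = 0) :
    (diffOp ^ N) (fun m n => nprod m a * nprod n b - nprod n b * nprod m a) = 0 := by
  have hx : ∀ (x : W) (f : W →ₗ[ℂ] W) (j : ℤ), (diffOp ^ N) (fun k l =>
      f (comm a b k l x)) = 0 := by
    intro x f j
    refine (diffOp_pow_map (f ∘ₗ LinearMap.applyₗ x) N (comm a b)).trans ?_
    rw [h]
    funext k l
    simp
  have hL : ∀ (g : Fld W) (x : W) (j : ℤ), (diffOp ^ N) (fun m n =>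
      (lmul m a (lmul n b g) - lmul n b (lmul m a g)).1 j x) = 0 := by
    intro g x j
    have := diffOp_pow_eq_zero_of_shift_recurrence (N := N) (Y := fun m n k l j =>
      (lmul m (shift k a) (lmul n (shift l b) g)
        - lmul n (shift l b) (lmul m (shift k a) g)).1 j x) ?_ ?_ ?_ ?_ 0 0 j
    · simpa only [shift_zero] using this
    · intro m n k l j
      simp only [lmul_succ, shift_shift, add_comm 1 k, map_sub, lmul_shift, sub_apply, shift_apply]
      abel
    · intro m n k l j
      simp only [lmul_succ, shift_shift, add_comm 1 l, map_sub, lmul_shift, sub_apply, shift_apply]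
      abel
    · obtain ⟨N, hN⟩ := g.2 x
      have h : ∀ m n (a b : Fld W) j, N ≤ j → (lmul m a (lmul n b g)).1 j x = 0 :=
        fun m n a b j hj => lmul_eq_zero m a (fun j hj => lmul_eq_zero n b hN hj) hj
      exact Or.inl ⟨fun m n l => ⟨N, fun k j hj => by simp only [sub_apply, h _ _ _ _ _ hj, sub_zero]⟩,
        fun m n l => ⟨N, fun k j hj => by simp only [sub_apply, h _ _ _ _ _ hj, sub_zero]⟩⟩
    · intro j
      have := hx (g.1 j x) LinearMap.id j
      simpa only [sub_apply, lmul_zero_apply, shift_apply, zero_add, comm, LinearMap.id_apply,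
        LinearMap.sub_apply, Module.End.mul_apply] using this
  have hR : ∀ (g : Fld W) (x : W) (j : ℤ), (diffOp ^ N) (fun m n =>
      (rmul m a (rmul n b g) - rmul n b (rmul m a g)).1 j x) = 0 := by
    intro g x j
    have := diffOp_pow_eq_zero_of_shift_recurrence (N := N) (Y := fun m n k l j =>
      (rmul m (shift k a) (rmul n (shift l b) g)
        - rmul n (shift l b) (rmul m (shift k a) g)).1 j x) ?_ ?_ ?_ ?_ 0 0 j
    · simpa only [shift_zero] using this
    · intro m n k l j
      simp only [rmul_succ, shift_shift, add_comm 1 k, map_sub, rmul_shift, sub_apply, shift_apply]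
      abel
    · intro m n k l j
      simp only [rmul_succ, shift_shift, add_comm 1 l, map_sub, rmul_shift, sub_apply, shift_apply]
      abel
    · have h : ∀ m n (a b : Fld W), ∃ N, ∀ k j, N ≤ k →
          (rmul m (shift k a) (rmul n b g)).1 j x - (rmul n b (rmul m (shift k a) g)).1 j x = 0 := by
        intro m n a b
        obtain ⟨N, hN⟩ := a.2 x
        obtain ⟨N', hN'⟩ := b.2 x
        obtain ⟨K, hK⟩ := exists_common_range N' 0
        -- For right multiplications the truncation is in the shift of `a`: it must kill `x` and
        -- also the finitely many nonzero vectors `b_i x` with `i ≥ 0`.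
        choose f hf using fun i : ℕ => a.2 (b.1 i x)
        obtain ⟨B, hB⟩ := ((Finset.range K).image f).exists_le
        refine ⟨max N B, fun k j hk => ?_⟩
        rw [rmul_eq_zero, rmul_eq_zero, sub_zero]
        · intro i j hi
          by_cases h : N' ≤ i
          · rw [hN' _ h, map_zero]
          · lift i to ℕ using hi
            refine rmul_eq_zero _ fun t j ht => ?_
            have := hB _ (Finset.mem_image_of_mem f (Finset.mem_range.2 (by omega : i < K)))
            rw [shift_apply, hf i _ (by omega), map_zero]
        · intro i j hi
          rw [shift_apply, hN _ (by omega), map_zero]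
      refine Or.inr ⟨fun m n l => h m n a (shift l b), fun m n k => ?_⟩
      obtain ⟨N, hN⟩ := h n m b (shift k a)
      exact ⟨N, fun l j hl => by rw [sub_apply, ← neg_sub, hN l j hl, neg_zero]⟩
    · intro j
      have := hx x (-g.1 j) j
      simpa only [sub_apply, rmul_zero_apply, shift_apply, zero_add, comm, LinearMap.neg_apply,
        LinearMap.sub_apply, Module.End.mul_apply, map_sub, neg_sub_neg] using this
  funext m n
  refine LinearMap.ext fun g => ?_
  ext j x
  have e := diffOp_pow_map ((evalAt j x) ∘ₗ LinearMap.applyₗ g) N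
    (fun m n => (nprod m a * nprod n b - nprod n b * nprod m a : Module.End ℂ (Fld W)))
  refine (congrFun (congrFun e m) n).symm.trans ?_
  have e2 : (fun m n => (evalAt j x ∘ₗ LinearMap.applyₗ g)
        (nprod m a * nprod n b - nprod n b * nprod m a : Module.End ℂ (Fld W)))
      = (fun m n => (lmul m a (lmul n b g) - lmul n b (lmul m a g)).1 j x)
        + fun m n => (rmul m a (rmul n b g) - rmul n b (rmul m a g)).1 j x := by
    funext m n
    simp only [LinearMap.comp_apply, LinearMap.applyₗ_apply_apply, LinearMap.sub_apply,
      Module.End.mul_apply, nprod_eq, map_sub, lmul_comm_rmul, evalAt_apply, Pi.add_apply,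
      sub_apply]
    abel
  rw [e2, map_add, hL, hR]
  simp

/-- The commutators of an operator with the modes of a field. -/
def ad (T : Module.End ℂ W) : Fld W →ₗ[ℂ] Fld W where
  toFun g := ⟨fun n => T * g.1 n - g.1 n * T, fun x => by
    obtain ⟨N, hN⟩ := g.2 x
    obtain ⟨N', hN'⟩ := g.2 (T x)
    exact ⟨max N N', fun n hn => by
      rw [LinearMap.sub_apply, Module.End.mul_apply, Module.End.mul_apply,
        hN _ (le_of_max_le_left hn), hN' _ (le_of_max_le_right hn), map_zero, sub_zero]⟩⟩
  map_add' f g := by ext n x; simp; abel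
  map_smul' c g := by ext n x; simp [smul_sub]

theorem ad_apply (T : Module.End ℂ W) (g : Fld W) (n : ℤ) (x : W) :
    (ad T g).1 n x = T (g.1 n x) - g.1 n (T x) := rfl

theorem ad_nprod (T : Module.End ℂ W) (p : ℤ) (a b : Fld W) :
    ad T (nprod p a b) = nprod p (ad T a) b + nprod p a (ad T b) := by
  have hl : ad T (lmul p a b) = lmul p (ad T a) b + lmul p a (ad T b) := by
    ext n x
    rw [add_apply, ad_apply, lmul_apply, lmul_apply, lmul_apply, lmul_apply,
      map_binomShift (isTrunc_left a b x), ← binomShift_add (isTrunc_left _ _ _) (isTrunc_left _ _ _),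
      ← binomShift_sub ((isTrunc_left a b x).map T) (isTrunc_left _ _ _)]
    congr 1
    funext i j
    simp only [ad_apply, map_sub]
    abel
  have hr : ad T (rmul p a b) = rmul p (ad T a) b + rmul p a (ad T b) := by
    ext n x
    rw [add_apply, ad_apply, rmul_apply, rmul_apply, rmul_apply, rmul_apply, map_zsmul, ← smul_add,
      ← smul_sub,
      map_binomShift (isTrunc_left b a x), ← binomShift_add (isTrunc_left _ _ _) (isTrunc_left _ _ _),
      ← binomShift_sub ((isTrunc_left b a x).map T) (isTrunc_left _ _ _)]
    congr 2
    funext i j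
    simp only [ad_apply, map_sub]
    abel
  simp only [nprod_eq, map_sub, hl, hr]
  abel

theorem nprod_zero_eq_ad (a b : Fld W) : nprod 0 a b = ad (a.1 0) b := by
  ext n x
  rw [nprod_eq, sub_apply, lmul_zero_apply, rmul_zero_apply, ad_apply]

theorem nprod_shift (p : ℤ) (a b : Fld W) (k : ℤ) :
    nprod p a (shift k b) = shift k (nprod p a b) := by
  simp only [nprod_eq, lmul_shift, rmul_shift, map_sub]

theorem nprod_one_eq_ad (a b : Fld W) :
    nprod 1 a b = ad (a.1 1) b - shift 1 (ad (a.1 0) b) := by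
  have := nprod_succ 0 a b
  rw [zero_add] at this
  rw [this, nprod_zero_eq_ad, nprod_zero_eq_ad]
  rfl

/-- If `(x - y)² C = 0`, then `(x - y) C` is constant on antidiagonals, so `C` is affine in `m`
along each of them and is determined by the rows `m = 0` and `m = 1`. -/
theorem eq_of_diffOp_sq {M : Type*} [AddCommGroup M] [Module ℂ M] {C : ℤ → ℤ → M}
    (h : (diffOp ^ 2) C = 0) (m n : ℤ) :
    C m n = C 0 (m + n) + m • (C 1 (m + n - 1) - C 0 (m + n)) := by
  have e : ∀ m n, diffOp C (m + 1) n = diffOp C m (n + 1) := fun m n => by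
    have := congrFun (congrFun h m) n
    rw [pow_two, Module.End.mul_apply] at this
    exact sub_eq_zero.1 this
  have e' : ∀ m n, diffOp C m n = diffOp C 0 (m + n) := by
    intro m
    induction m using Int.induction_on with
    | zero => simp
    | succ i hi => intro n; rw [e, hi, show (i : ℤ) + (n + 1) = i + 1 + n by ring]
    | pred i hi =>
      intro n
      have := e (-(i : ℤ) - 1) (n - 1)
      rw [sub_add_cancel, sub_add_cancel] at this
      rw [← this, hi, show -(i : ℤ) + (n - 1) = -i - 1 + n by ring]
  have e2 : ∀ m n, C (m + 1) n = C m (n + 1) + (C 1 (m + n) - C 0 (m + n + 1)) := fun m n => by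
    rw [← sub_eq_iff_eq_add']
    exact e' m n
  induction m using Int.induction_on generalizing n with
  | zero => simp
  | succ i hi =>
    rw [e2, hi, show (i : ℤ) + (n + 1) = i + n + 1 by ring, show (i : ℤ) + 1 + n = i + n + 1 by ring,
      add_sub_cancel_right, add_smul, one_smul]
    abel
  | pred i hi =>
    have := e2 (-(i : ℤ) - 1) (n - 1)
    rw [sub_add_cancel, sub_add_cancel, hi] at this
    rw [← sub_eq_iff_eq_add] at this
    rw [← this, show -(i : ℤ) + (n - 1) = -i - 1 + n by ring,
      show -(i : ℤ) - 1 + (n - 1) = -i - 1 + n - 1 by ring,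
      show -(i : ℤ) - 1 + n - 1 + 1 = -i - 1 + n by ring, sub_smul, one_smul]
    abel

/-- If `[a_m, b_n] = P_(m+n) + m Q_(m+n-1)` then the same holds for the operators of taking
products with `a` and `b`. -/
theorem nprod_comm {a b P Q : Fld W}
    (h : ∀ m n x, a.1 m (b.1 n x) - b.1 n (a.1 m x) = P.1 (m + n) x + m • Q.1 (m + n - 1) x)
    (m n : ℤ) (g : Fld W) :
    nprod m a (nprod n b g) - nprod n b (nprod m a g)
      = nprod (m + n) P g + m • nprod (m + n - 1) Q g := by
  -- `P` and `Q` are recovered from the commutators of `a_0` and `a_1` with `b`. The rows `m = 0, 1`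
  -- of the claim can then be computed from the fact that `ad` is a derivation of all products, and
  -- locality of order two gives the other rows.
  have hP : ad (a.1 0) b = P := by
    ext n x
    rw [ad_apply, h]
    simp
  have hQ : ad (a.1 1) b - shift 1 P = Q := by
    ext n x
    rw [sub_apply, ad_apply, h, shift_apply, add_comm n 1, add_sub_cancel_left, add_sub_cancel_left,
      one_smul]
  have hc : (diffOp ^ 2) (comm a b) = 0 := by
    funext m n
    refine LinearMap.ext fun x => ?_
    have hc' : ∀ m n, comm a b m n x = P.1 (m + n) x + m • Q.1 (m + n - 1) x := fun m n => h m n x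
    rw [pow_two, Module.End.mul_apply]
    simp only [diffOp_apply, LinearMap.sub_apply, hc', Pi.zero_apply, LinearMap.zero_apply]
    simp only [show m + 1 + 1 + n = m + n + 2 by ring, show m + 1 + (n + 1) = m + n + 2 by ring,
      show m + (n + 1 + 1) = m + n + 2 by ring, add_smul]
    abel
  have key := LinearMap.congr_fun (eq_of_diffOp_sq (comm_eq_diffOp_shift hc) m n) g
  have h0 : ∀ n, nprod 0 a (nprod n b g) - nprod n b (nprod 0 a g) = nprod n P g := fun n => by
    rw [nprod_zero_eq_ad, nprod_zero_eq_ad, ad_nprod, hP, add_sub_cancel_right]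
  have h1 : ∀ n, nprod 1 a (nprod n b g) - nprod n b (nprod 1 a g)
      = nprod n (ad (a.1 1) b) g - shift 1 (nprod n P g) := fun n => by
    rw [nprod_one_eq_ad, nprod_one_eq_ad, map_sub, nprod_shift, ad_nprod, ad_nprod, hP, map_add]
    abel
  simp only [LinearMap.sub_apply, LinearMap.add_apply, LinearMap.smul_apply,
    Module.End.mul_apply] at key
  rw [key, h0, h1]
  congr 2
  have h2 := nprod_succ (m + n - 1) P g
  rw [sub_add_cancel] at h2
  rw [h2, ← hQ, map_sub, LinearMap.sub_apply]
  abel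

end Fld

/-! ### Products with the identity field, derivatives and weights of fields -/

namespace Fld

variable {W : Type w} [AddCommGroup W] [Module ℂ W]

/-- The product with `p = 0` is a commutator with the identity. Larger `p` follow from `nprod_succ`,
for all `a` at once because that recurrence shifts `a`. -/
theorem nprod_id (p : ℤ) (a : Fld W) {i : Fld W} (hi : ∀ n x, i.1 n x = if n = -1 then x else 0)
    (hp : 0 ≤ p) : nprod p a i = 0 := by
  have hs : ∀ k, ad (a.1 k) i = 0 := fun k => by
    ext n x
    rw [ad_apply, hi, hi]
    split_ifs <;> simp
  have h : ∀ (p : ℕ) (a : Fld W), (∀ k, ad (a.1 k) i = 0) → nprod p a i = 0 := by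
    intro p
    induction p with
    | zero => intro a ha; rw [Nat.cast_zero, nprod_zero_eq_ad, ha]
    | succ p ih =>
      intro a ha
      rw [Nat.cast_succ, nprod_succ, ih a ha, ih _ fun k => ha (k + 1)]
      simp
  lift p to ℕ using hp
  exact h p a hs

theorem choose_neg_one (i : ℕ) : Ring.choose (-1 : ℤ) i = (-1) ^ i := by
  have h : Ring.choose (1 + (i : ℤ) - 1) i = 1 := by
    rw [add_sub_cancel_left, Ring.choose_natCast, Nat.choose_self, Nat.cast_one]
  rw [Ring.choose_neg, h, Int.negOnePow_def]
  simp [Units.smul_def]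

/-- The two expansions of `(x - z)^(-1)` split the field `a`: left multiplication yields its modes
of negative index, right multiplication the negatives of the others. -/
theorem nprod_neg_one_id (a : Fld W) {i : Fld W} (hi : ∀ n x, i.1 n x = if n = -1 then x else 0) :
    nprod (-1) a i = a := by
  ext n x
  have hl : (lmul (-1) a i).1 n x = if n < 0 then a.1 n x else 0 := by
    rw [lmul_apply, binomShift]
    split_ifs with h
    · rw [finsum_eq_single _ (-1 - n).toNat]
      · rw [hi, if_pos (by omega), choose_neg_one, ← mul_pow]
        simp only [mul_neg, mul_one, neg_neg, one_pow, one_smul]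
        rw [show (-1 : ℤ) + 0 - ((-1 - n).toNat : ℤ) = n by omega]
      · intro k hk
        rw [hi, if_neg (by omega), map_zero, smul_zero]
    · rw [finsum_eq_zero_of_forall_eq_zero]
      intro k
      rw [hi, if_neg (by omega), map_zero, smul_zero]
  have hr : (rmul (-1) a i).1 n x = if n < 0 then 0 else -a.1 n x := by
    rw [rmul_apply, binomShift]
    split_ifs with h
    · rw [finsum_eq_zero_of_forall_eq_zero, smul_zero]
      intro k
      rw [hi, if_neg (by omega), smul_zero]
    · rw [finsum_eq_single _ n.toNat]
      · rw [hi, if_pos (by omega), choose_neg_one, ← mul_pow]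
        simp only [mul_neg, mul_one, neg_neg, one_pow, one_smul]
        rw [show (0 : ℤ) + (n.toNat : ℤ) = n by omega]
        simp
      · intro k hk
        rw [hi, if_neg (by omega), smul_zero]
  rw [nprod_eq, sub_apply, hl, hr]
  split_ifs <;> simp

/-- The derivative of a field. -/
def der : Fld W →ₗ[ℂ] Fld W where
  toFun g := ⟨fun n => (-n : ℤ) • g.1 (n - 1), fun x => by
    obtain ⟨N, hN⟩ := g.2 x
    exact ⟨N + 1, fun n hn => by
      rw [LinearMap.smul_apply, hN _ (by omega), smul_zero]⟩⟩
  map_add' f g := by ext n x; simp [smul_add]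
  map_smul' c g := by
    ext n x
    simp only [Submodule.coe_smul, Pi.smul_apply, LinearMap.smul_apply, RingHom.id_apply]
    rw [smul_comm]

theorem der_apply (g : Fld W) (n : ℤ) (x : W) : (der g).1 n x = (-n : ℤ) • g.1 (n - 1) x := rfl

theorem der_shift (g : Fld W) : der (shift 1 g) = shift 1 (der g) + g := by
  ext n x
  rw [add_apply, shift_apply, der_apply, der_apply, shift_apply, sub_add_cancel,
    add_sub_cancel_right, neg_smul, neg_smul, add_smul, one_smul]
  abel

/-- Integration by parts under the residue. At `p = 0` it says that a derivative has no residue, and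
the recurrence in `p` gives the other exponents. -/
theorem lmul_der_left (p : ℤ) (a b : Fld W) : lmul p (der a) b = (-p : ℤ) • lmul (p - 1) a b := by
  have key : ∀ x : W, ∀ p k j,
      (lmul p (der (shift k a)) b + p • lmul (p - 1) (shift k a) b).1 j x = 0 := by
    intro x
    refine eq_zero_of_shift_recurrence ?_ ?_ ?_
    · intro p k j
      have e1 := lmul_succ (p - 1) (shift k a) b
      rw [sub_add_cancel] at e1
      rw [← shift_apply, ← sub_apply]
      congr 2
      rw [lmul_succ, add_sub_cancel_right, add_comm k 1, ← shift_shift, der_shift]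
      simp only [map_add, LinearMap.add_apply, map_zsmul, add_smul, one_smul, e1, smul_sub]
      abel_nf
    · intro k j
      rw [zero_smul, add_zero, lmul_zero_apply, der_apply]
      simp
    · intro m
      left
      obtain ⟨N, hN⟩ := b.2 x
      refine ⟨N, fun k j hj => ?_⟩
      rw [add_apply, zsmul_apply, lmul_eq_zero _ _ hN hj, lmul_eq_zero _ _ hN hj, smul_zero,
        add_zero]
  rw [neg_smul, eq_neg_iff_add_eq_zero]
  ext j x
  simpa only [shift_zero, zero_apply] using key x p 0 j

theorem rmul_der_left (p : ℤ) (a b : Fld W) : rmul p (der a) b = (-p : ℤ) • rmul (p - 1) a b := by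
  have key : ∀ x : W, ∀ p k j,
      (rmul p (der (shift k a)) b + p • rmul (p - 1) (shift k a) b).1 j x = 0 := by
    intro x
    refine eq_zero_of_shift_recurrence ?_ ?_ ?_
    · intro p k j
      have e1 := rmul_succ (p - 1) (shift k a) b
      rw [sub_add_cancel] at e1
      rw [← shift_apply, ← sub_apply]
      congr 2
      rw [rmul_succ, add_sub_cancel_right, add_comm k 1, ← shift_shift, der_shift]
      simp only [map_add, LinearMap.add_apply, map_zsmul, add_smul, one_smul, e1, smul_sub]
      abel_nf
    · intro k j
      rw [zero_smul, add_zero, rmul_zero_apply, der_apply]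
      simp
    · intro m
      right
      obtain ⟨N, hN⟩ := a.2 x
      refine ⟨N + 1, fun k j hj => ?_⟩
      rw [add_apply, zsmul_apply, rmul_eq_zero, rmul_eq_zero, smul_zero, add_zero]
      · intro i j hi
        rw [shift_apply, hN _ (by omega), map_zero]
      · intro i j hi
        rw [der_apply, shift_apply, hN _ (by omega), smul_zero, map_zero]
  rw [neg_smul, eq_neg_iff_add_eq_zero]
  ext j x
  simpa only [shift_zero, zero_apply] using key x p 0 j

theorem nprod_der_left (p : ℤ) (a b : Fld W) :
    nprod p (der a) b = (-p : ℤ) • nprod (p - 1) a b := by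
  rw [nprod_eq, lmul_der_left, rmul_der_left, nprod_eq, smul_sub]

/-- At `p = 0` the mode `(der a)_0` vanishes, so only the derivative of `b` contributes. The
recurrence passes this to all `p`, with the extra term of `der_shift` matching on both sides. -/
theorem lmul_der (p : ℤ) (a b : Fld W) :
    der (lmul p a b) = lmul p (der a) b + lmul p a (der b) := by
  have key : ∀ x : W, ∀ p k j, (der (lmul p (shift k a) b) - (lmul p (der (shift k a)) b
      + lmul p (shift k a) (der b))).1 j x = 0 := by
    intro x
    refine eq_zero_of_shift_recurrence ?_ ?_ ?_
    · intro p k j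
      rw [← shift_apply, ← sub_apply]
      congr 2
      rw [lmul_succ, lmul_succ, lmul_succ, add_comm k 1, ← shift_shift, der_shift, map_sub,
        der_shift]
      simp only [map_add, map_sub, LinearMap.add_apply]
      abel_nf
    · intro k j
      simp only [sub_apply, add_apply, lmul_zero_apply, der_apply, shift_apply, map_zsmul]
      simp
    · intro m
      left
      obtain ⟨N, hN⟩ := b.2 x
      have h : ∀ j, N + 1 ≤ j → (der b).1 j x = 0 := fun j hj => by
        rw [der_apply, hN _ (by omega), smul_zero]
      refine ⟨N + 1, fun k j hj => ?_⟩
      rw [sub_apply, add_apply, der_apply, lmul_eq_zero _ _ hN (by omega),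
        lmul_eq_zero _ _ hN (by omega), lmul_eq_zero _ _ h hj]
      simp
  rw [← sub_eq_zero]
  ext j x
  simpa only [shift_zero, zero_apply] using key x p 0 j

theorem rmul_der (p : ℤ) (a b : Fld W) :
    der (rmul p a b) = rmul p (der a) b + rmul p a (der b) := by
  have key : ∀ x : W, ∀ p k j, (der (rmul p (shift k a) b) - (rmul p (der (shift k a)) b
      + rmul p (shift k a) (der b))).1 j x = 0 := by
    intro x
    refine eq_zero_of_shift_recurrence ?_ ?_ ?_
    · intro p k j
      rw [← shift_apply, ← sub_apply]
      congr 2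
      rw [rmul_succ, rmul_succ, rmul_succ, add_comm k 1, ← shift_shift, der_shift, map_sub,
        der_shift]
      simp only [map_add, map_sub, LinearMap.add_apply]
      abel_nf
    · intro k j
      simp only [sub_apply, add_apply, rmul_zero_apply, der_apply, shift_apply, map_zsmul]
      simp
    · intro m
      right
      obtain ⟨N, hN⟩ := a.2 x
      refine ⟨N + 1, fun k j hj => ?_⟩
      rw [sub_apply, add_apply, der_apply, rmul_eq_zero, rmul_eq_zero, rmul_eq_zero]
      · simp
      · intro i j hi
        rw [shift_apply, hN _ (by omega), map_zero]
      · intro i j hi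
        rw [der_apply, shift_apply, hN _ (by omega), smul_zero, map_zero]
      · intro i j hi
        rw [shift_apply, hN _ (by omega), map_zero]
  rw [← sub_eq_zero]
  ext j x
  simpa only [shift_zero, zero_apply] using key x p 0 j

theorem nprod_der (p : ℤ) (a b : Fld W) :
    der (nprod p a b) = nprod p (der a) b + nprod p a (der b) := by
  rw [nprod_eq, map_sub, lmul_der, rmul_der, nprod_eq, nprod_eq]
  abel

/-- The operator `g_n ↦ (n + 1) g_n` on fields. -/
def euler : Fld W →ₗ[ℂ] Fld W := -(shift 1 ∘ₗ der)

theorem euler_eq (g : Fld W) : euler g = -shift 1 (der g) := rfl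

theorem euler_apply (g : Fld W) (n : ℤ) (x : W) : (euler g).1 n x = (n + 1) • g.1 n x := by
  rw [euler_eq, neg_apply, shift_apply, der_apply, add_sub_cancel_right, neg_smul, neg_neg]

/-- The field form of the rule that `a_(p) b` has weight `wt a + wt b - p - 1`; the correction comes
from `nprod_succ` and integration by parts. -/
theorem nprod_euler (p : ℤ) (a b : Fld W) : euler (nprod p a b) =
    nprod p (euler a) b + nprod p a (euler b) - (p + 1) • nprod p a b := by
  have h1 := nprod_succ p (der a) b
  have h2 := nprod_der_left (p + 1) a b
  rw [add_sub_cancel_right, h1, sub_eq_iff_eq_add] at h2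
  simp only [euler_eq, nprod_der, map_add, map_neg, LinearMap.neg_apply, nprod_shift, h2, neg_smul]
  abel

/-! ### Locality -/

theorem borcherdsSum_eq_zero {a b : Fld W} {N : ℕ} (h : (diffOp ^ N) (comm a b) = 0) {l : ℤ}
    (hl : N ≤ l) (x : W) (m n : ℤ) :
    borcherdsSum (fun m n => a.1 m (b.1 n x)) (fun n m => b.1 n (a.1 m x)) l m n = 0 := by
  lift l to ℕ using by omega
  rw [borcherdsSum_natCast (isTrunc_left a b x) (isTrunc_left b a x)]
  have e := diffOp_pow_map (LinearMap.applyₗ x : (W →ₗ[ℂ] W) →ₗ[ℂ] W) l (comm a b)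
  rw [diffOp_pow_eq_zero_of_le h (by omega)] at e
  exact congrFun (congrFun e m) n

/-- The Borcherds identity for a pair of mutually local fields. -/
theorem borcherds {a b : Fld W} (h : IsLocal a b) (x : W) (l m n : ℤ) :
    ∑ᶠ i : ℕ, (Ring.choose m i : ℤ) • (nprod (l + i) a b).1 (m + n - i) x =
      ∑ᶠ i : ℕ, ((-1) ^ i * Ring.choose l i : ℤ) •
        (a.1 (l + m - i) (b.1 (n + i) x)
          - ((Int.negOnePow l : ℤˣ) : ℤ) • b.1 (l + n - i) (a.1 (m + i) x)) := by
  rw [← borcherdsSum_eq_finsum (isTrunc_left a b x) (isTrunc_left b a x)]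
  obtain ⟨N, hN⟩ := h
  refine (eq_finsum_of_recurrence (X := borcherdsSum (fun m n => a.1 m (b.1 n x))
    (fun n m => b.1 n (a.1 m x))) (N := N) (borcherdsSum_succ (isTrunc_left a b x)
      (isTrunc_left b a x)) ?_ l m n).symm
  exact fun l m n hl => borcherdsSum_eq_zero hN hl x m n

theorem comm_swap (a b : Fld W) : comm b a = fun m n => -comm a b n m := by
  funext m n
  simp [comm]

/-- Transposing the array only changes the sign of `x - y`. -/
theorem IsLocal.symm {a b : Fld W} (h : IsLocal a b) : IsLocal b a := by
  obtain ⟨N, hN⟩ := h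
  refine ⟨N, ?_⟩
  have : ∀ (N : ℕ) (C : ℤ → ℤ → Module.End ℂ W),
      (diffOp ^ N) (fun m n => -C n m) = fun m n => (-1) ^ (N + 1) * (diffOp ^ N) C n m := by
    intro N
    induction N with
    | zero => intro C; funext m n; simp
    | succ N ih =>
      intro C
      rw [pow_succ', Module.End.mul_apply, ih, pow_succ', Module.End.mul_apply]
      funext m n
      simp only [diffOp_apply]
      rw [pow_succ _ (N + 1)]
      noncomm_ring
  rw [comm_swap, this, hN]
  funext m n
  simp

theorem IsLocal.add_right {a b c : Fld W} (h : IsLocal a b) (h' : IsLocal a c) :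
    IsLocal a (b + c) := by
  obtain ⟨N, hN⟩ := h
  obtain ⟨N', hN'⟩ := h'
  refine ⟨max N N', ?_⟩
  have : comm a (b + c) = comm a b + comm a c := by
    funext m n
    refine LinearMap.ext fun x => ?_
    simp [comm]
    abel
  rw [this, map_add, diffOp_pow_eq_zero_of_le hN (le_max_left _ _),
    diffOp_pow_eq_zero_of_le hN' (le_max_right _ _), add_zero]

theorem IsLocal.smul_right {a b : Fld W} (h : IsLocal a b) (c : ℂ) : IsLocal a (c • b) := by
  obtain ⟨N, hN⟩ := h
  refine ⟨N, ?_⟩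
  have : comm a (c • b) = c • comm a b := by
    funext m n
    refine LinearMap.ext fun x => ?_
    simp [comm, smul_sub]
  rw [this, map_smul, hN, smul_zero]

theorem IsLocal.zero_right (a : Fld W) : IsLocal a 0 := by
  refine ⟨0, ?_⟩
  funext m n
  simp [comm]

/-- The fields local with a given field form a subspace. -/
def localTo (a : Fld W) : Submodule ℂ (Fld W) where
  carrier := {b | IsLocal a b}
  add_mem' h h' := h.add_right h'
  zero_mem' := IsLocal.zero_right a
  smul_mem' c _ h := h.smul_right c

end Fld

/-! ### Arrays in three variables -/

section TripleArrays

variable {M : Type*} [AddCommGroup M] [Module ℂ M]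

/-- Every term of the binomial expansion contains `f ^ K` or `g ^ k`. -/
theorem sub_pow_apply_eq_zero {f g : Module.End ℂ M} (h : Commute f g) {K k : ℕ} {v : M}
    (hf : (f ^ K) v = 0) (hg : (g ^ k) v = 0) : ((f - g) ^ (K + k)) v = 0 := by
  rw [sub_eq_add_neg, (h.neg_right).add_pow', LinearMap.sum_apply]
  refine Finset.sum_eq_zero fun ij hij => ?_
  rw [Finset.HasAntidiagonal.mem_antidiagonal] at hij
  rw [LinearMap.smul_apply]
  have : (f ^ ij.1 * (-g) ^ ij.2) v = 0 := by
    rcases le_or_gt K ij.1 with h1 | h1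
    · obtain ⟨t, ht⟩ := Nat.exists_eq_add_of_le h1
      rw [((h.neg_right).pow_pow _ _).eq, Module.End.mul_apply, ht, add_comm, pow_add,
        Module.End.mul_apply, hf, map_zero, map_zero]
    · obtain ⟨t, ht⟩ := Nat.exists_eq_add_of_le (show k ≤ ij.2 by omega)
      rw [Module.End.mul_apply, neg_pow, ht, add_comm, pow_add g, Module.End.mul_apply,
        Module.End.mul_apply, hg, map_zero, map_zero, map_zero]
  rw [this, smul_zero]

/-- Multiplication by `x - y` on three-variable arrays. -/
def diff12 : Module.End ℂ (ℤ → ℤ → ℤ → M) where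
  toFun F m n s := F (m + 1) n s - F m (n + 1) s
  map_add' C C' := by funext m n s; simp only [Pi.add_apply]; abel
  map_smul' c C := by funext m n s; simp [smul_sub]

/-- Multiplication by `x - z` on three-variable arrays. -/
def diff13 : Module.End ℂ (ℤ → ℤ → ℤ → M) where
  toFun F m n s := F (m + 1) n s - F m n (s + 1)
  map_add' C C' := by funext m n s; simp only [Pi.add_apply]; abel
  map_smul' c C := by funext m n s; simp [smul_sub]

/-- Multiplication by `y - z` on three-variable arrays. -/
def diff23 : Module.End ℂ (ℤ → ℤ → ℤ → M) where
  toFun F m n s := F m (n + 1) s - F m n (s + 1)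
  map_add' C C' := by funext m n s; simp only [Pi.add_apply]; abel
  map_smul' c C := by funext m n s; simp [smul_sub]

theorem diff12_apply (F : ℤ → ℤ → ℤ → M) (m n s : ℤ) :
    diff12 F m n s = F (m + 1) n s - F m (n + 1) s := rfl

theorem diff13_apply (F : ℤ → ℤ → ℤ → M) (m n s : ℤ) :
    diff13 F m n s = F (m + 1) n s - F m n (s + 1) := rfl

theorem diff23_apply (F : ℤ → ℤ → ℤ → M) (m n s : ℤ) :
    diff23 F m n s = F m (n + 1) s - F m n (s + 1) := rfl

/-- The identity `y - z = (x - z) - (x - y)` behind Dong's lemma. -/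
theorem diff23_eq : (diff23 : Module.End ℂ (ℤ → ℤ → ℤ → M)) = diff13 - diff12 := by
  refine LinearMap.ext fun F => ?_
  funext m n s
  simp only [LinearMap.sub_apply, Pi.sub_apply, diff12_apply, diff13_apply, diff23_apply]
  abel

theorem diff13_comm_diff12 : Commute (diff13 : Module.End ℂ (ℤ → ℤ → ℤ → M)) diff12 := by
  refine LinearMap.ext fun F => ?_
  funext m n s
  simp only [Module.End.mul_apply, diff12_apply, diff13_apply]
  abel

theorem diff13_comm_diff23 : Commute (diff13 : Module.End ℂ (ℤ → ℤ → ℤ → M)) diff23 := by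
  rw [diff23_eq]
  exact (Commute.refl _).sub_right diff13_comm_diff12

theorem diff23_pow_apply (F : ℤ → ℤ → ℤ → M) (K : ℕ) (m : ℤ) :
    (diff23 ^ K) F m = (diffOp ^ K) (F m) := by
  induction K with
  | zero => rfl
  | succ K ih =>
    rw [pow_succ', pow_succ', Module.End.mul_apply, Module.End.mul_apply, ← ih]
    rfl

theorem diff13_pow_apply (F : ℤ → ℤ → ℤ → M) (K : ℕ) (m n s : ℤ) :
    (diff13 ^ K) F m n s = (diffOp ^ K) (fun m s => F m n s) m s := by
  induction K generalizing m s with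
  | zero => rfl
  | succ K ih =>
    rw [pow_succ', pow_succ', Module.End.mul_apply, Module.End.mul_apply, diffOp_apply, ← ih, ← ih]
    rfl

/-- The array obtained by `binomShift` in the first two indices. -/
def binomShift₃ (q : ℤ) (F : ℤ → ℤ → ℤ → M) (m n s : ℤ) : M :=
  binomShift q (fun m n => F m n s) m n

theorem binomShift₃_diff13 (q : ℤ) {F : ℤ → ℤ → ℤ → M} (hF : ∀ s, IsTrunc fun m n => F m n s) :
    (∀ s, IsTrunc fun m n => diff13 F m n s)
      ∧ binomShift₃ q (diff13 F) = diff13 (binomShift₃ q F) := by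
  have h1 : ∀ s, IsTrunc fun m n => F (m + 1) n s := fun s => by
    simpa only [add_zero] using (hF s).shift 1 0
  refine ⟨fun s => (h1 s).sub (hF (s + 1)), ?_⟩
  funext m n s
  refine (binomShift_sub (h1 s) (hF (s + 1)) q m n).trans ?_
  have := binomShift_shift (fun m n => F m n s) q m n 1 0
  simp only [add_zero] at this
  rw [this]
  rfl

theorem binomShift₃_diff23 (q : ℤ) {F : ℤ → ℤ → ℤ → M} (hF : ∀ s, IsTrunc fun m n => F m n s) :
    (∀ s, IsTrunc fun m n => diff23 F m n s)
      ∧ binomShift₃ q (diff23 F) = diff23 (binomShift₃ q F) := by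
  have h1 : ∀ s, IsTrunc fun m n => F m (n + 1) s := fun s => by
    simpa only [add_zero] using (hF s).shift 0 1
  refine ⟨fun s => (h1 s).sub (hF (s + 1)), ?_⟩
  funext m n s
  refine (binomShift_sub (h1 s) (hF (s + 1)) q m n).trans ?_
  have := binomShift_shift (fun m n => F m n s) q m n 0 1
  simp only [add_zero] at this
  rw [this]
  rfl

/-- Multiplication by a polynomial in `x`, `y`, `z` commutes with the expansion of `(x - y)^q`.
Truncation must be carried along since the expansion is an infinite sum. -/
theorem binomShift₃_diff_pow (q : ℤ) {F : ℤ → ℤ → ℤ → M}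
    (hF : ∀ s, IsTrunc fun m n => F m n s) (K K' : ℕ) :
    binomShift₃ q ((diff13 ^ K) ((diff23 ^ K') F))
      = (diff13 ^ K) ((diff23 ^ K') (binomShift₃ q F)) := by
  have h1 : ∀ K' : ℕ, (∀ s, IsTrunc fun m n => (diff23 ^ K') F m n s)
      ∧ binomShift₃ q ((diff23 ^ K') F) = (diff23 ^ K') (binomShift₃ q F) := by
    intro K'
    induction K' with
    | zero => exact ⟨hF, rfl⟩
    | succ K' ih =>
      rw [pow_succ']
      exact ⟨(binomShift₃_diff23 q ih.1).1, (binomShift₃_diff23 q ih.1).2.trans (by rw [ih.2]; rfl)⟩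
  have h2 : ∀ K : ℕ, (∀ s, IsTrunc fun m n => (diff13 ^ K) ((diff23 ^ K') F) m n s)
      ∧ binomShift₃ q ((diff13 ^ K) ((diff23 ^ K') F))
        = (diff13 ^ K) ((diff23 ^ K') (binomShift₃ q F)) := by
    intro K
    induction K with
    | zero => exact h1 K'
    | succ K ih =>
      rw [pow_succ']
      exact ⟨(binomShift₃_diff13 q ih.1).1, (binomShift₃_diff13 q ih.1).2.trans (by rw [ih.2]; rfl)⟩
  exact (h2 K).2

end TripleArrays

/-! ### Dong's lemma -/

namespace Fld

variable {W : Type w} [AddCommGroup W] [Module ℂ W]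

/-- From `a b c - c a b = a [b, c] + [a, c] b`: a power of `y - z` kills the first term and a power
of `x - z` the second. -/
theorem diff_pow_triple_eq_zero {a b c : Fld W} {K K' : ℕ} (hac : (diffOp ^ K) (comm a c) = 0)
    (hbc : (diffOp ^ K') (comm b c) = 0) (x : W) :
    (diff13 ^ K) ((diff23 ^ K') fun m n s =>
      a.1 m (b.1 n (c.1 s x)) - c.1 s (a.1 m (b.1 n x))) = 0 := by
  have e : (fun m n s => a.1 m (b.1 n (c.1 s x)) - c.1 s (a.1 m (b.1 n x)))
      = (fun m n s => a.1 m (comm b c n s x)) + fun m n s => comm a c m s (b.1 n x) := by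
    funext m n s
    simp [comm]
  have h1 : (diff23 ^ K') (fun m n s => a.1 m (comm b c n s x)) = 0 := by
    funext m
    rw [diff23_pow_apply]
    refine (diffOp_pow_map (a.1 m ∘ₗ LinearMap.applyₗ x) K' (comm b c)).trans ?_
    rw [hbc]
    funext n s
    simp
  have h2 : (diff13 ^ K) (fun m n s => comm a c m s (b.1 n x)) = 0 := by
    funext m n s
    rw [diff13_pow_apply]
    have := diffOp_pow_map (LinearMap.applyₗ (b.1 n x) : (W →ₗ[ℂ] W) →ₗ[ℂ] W) K (comm a c)
    rw [hac] at this
    exact congrFun (congrFun this m) s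
  have hc := (diff13_comm_diff23 (M := W)).pow_pow K K'
  rw [e, map_add, map_add, h1, map_zero, zero_add, ← Module.End.mul_apply, hc.eq,
    Module.End.mul_apply, h2, map_zero]

/-- Dong's lemma. -/
theorem IsLocal.nprod_left {a b c : Fld W} (hab : IsLocal a b) (hac : IsLocal a c)
    (hbc : IsLocal b c) (p : ℤ) : IsLocal (nprod p a b) c := by
  obtain ⟨N, hab⟩ := hab
  obtain ⟨K, hac⟩ := hac
  obtain ⟨K', hbc⟩ := hbc
  obtain ⟨k, hk⟩ := exists_common_range N p
  set Jop : ℤ → ℤ → ℤ → W → W := fun q m n y =>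
    borcherdsSum (fun m n => a.1 m (b.1 n y)) (fun n m => b.1 n (a.1 m y)) q m n with hJ
  -- In the triple array of `[(x - y)^p [a(x), b(y)], c(z)]`, with the two expansions understood,
  -- `(y - z)^K'` and `(x - z)^K` remove the commutators with `c`, while `(x - y)^k` raises the
  -- exponent beyond the order of locality of `a` and `b`. The remaining `(y - z)^(K + k)` expands
  -- in powers of `x - z` and `x - y`, each term containing enough of one of them.
  refine ⟨K' + (K + k), ?_⟩
  have key : ∀ x : W, (diff23 ^ (K' + (K + k)))
      (fun m n s => Jop p m n (c.1 s x) - c.1 s (Jop p m n x)) = 0 := by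
    intro x
    set D : ℤ → ℤ → ℤ → ℤ → W := fun q m n s => Jop q m n (c.1 s x) - c.1 s (Jop q m n x)
    have h12 : (diff12 ^ k) (D p) = 0 := by
      have e : ∀ t : ℕ, (diff12 ^ t) (D p) = D (p + t) := by
        intro t
        induction t with
        | zero => simp
        | succ t ih =>
          rw [pow_succ', Module.End.mul_apply, ih]
          funext m n s
          have e1 : ∀ y, Jop (p + ((t + 1 : ℕ) : ℤ)) m n y
              = Jop (p + t) (m + 1) n y - Jop (p + t) m (n + 1) y := fun y => by
            simp only [hJ]
            rw [Nat.cast_succ, ← add_assoc,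
              borcherdsSum_succ (isTrunc_left a b y) (isTrunc_left b a y)]
          simp only [D, diff12_apply, e1, map_sub]
          abel
      rw [e]
      funext m n s
      simp only [D, hJ]
      rw [borcherdsSum_eq_zero hab hk, borcherdsSum_eq_zero hab hk, map_zero, sub_zero]
      rfl
    have h13 : (diff13 ^ K) ((diff23 ^ K') (D p)) = 0 := by
      set F : ℤ → ℤ → ℤ → W := fun m n s => a.1 m (b.1 n (c.1 s x)) - c.1 s (a.1 m (b.1 n x))
      set F' : ℤ → ℤ → ℤ → W := fun n m s => b.1 n (a.1 m (c.1 s x)) - c.1 s (b.1 n (a.1 m x))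
      have hF : ∀ s, IsTrunc fun m n => F m n s := fun s =>
        (isTrunc_left a b _).sub ((isTrunc_left a b x).map (c.1 s))
      have hF' : ∀ s, IsTrunc fun m n => F' m n s := fun s =>
        (isTrunc_left b a _).sub ((isTrunc_left b a x).map (c.1 s))
      -- The second half of the product has `a` and `b` in opposite order. Exchanging the first two
      -- variables swaps `x - z` and `y - z`, so that the same vanishing lemma applies to it.
      let sw : (ℤ → ℤ → ℤ → W) →ₗ[ℂ] (ℤ → ℤ → ℤ → W) :=
        { toFun := fun F m n s => F n m s
          map_add' := fun _ _ => rfl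
          map_smul' := fun _ _ => rfl }
      have hsw : ∀ (t t' : ℕ) (F : ℤ → ℤ → ℤ → W), (diff13 ^ t) ((diff23 ^ t') (sw F))
          = sw ((diff13 ^ t') ((diff23 ^ t) F)) := by
        have h1 : ∀ (t : ℕ) (F : ℤ → ℤ → ℤ → W), (diff13 ^ t) (sw F) = sw ((diff23 ^ t) F) := by
          intro t F
          induction t with
          | zero => rfl
          | succ t ih => rw [pow_succ', pow_succ', Module.End.mul_apply, ih]; rfl
        have h2 : ∀ (t : ℕ) (F : ℤ → ℤ → ℤ → W), (diff23 ^ t) (sw F) = sw ((diff13 ^ t) F) := by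
          intro t F
          induction t with
          | zero => rfl
          | succ t ih => rw [pow_succ', pow_succ', Module.End.mul_apply, ih]; rfl
        intro t t' F
        rw [h2, h1]
        exact congrArg sw
          (LinearMap.congr_fun ((diff13_comm_diff23 (M := W)).pow_pow t' t).eq F).symm
      have hD : D p = binomShift₃ p F
          - ((Int.negOnePow p : ℤˣ) : ℤ) • sw (binomShift₃ p F') := by
        funext m n s
        simp only [D, hJ, borcherdsSum, map_sub, map_zsmul]
        rw [map_binomShift (isTrunc_left a b x), map_binomShift (isTrunc_left b a x)]
        have e1 := binomShift_sub (isTrunc_left a b (c.1 s x))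
          ((isTrunc_left a b x).map (c.1 s)) p m n
        have e2 := binomShift_sub (isTrunc_left b a (c.1 s x))
          ((isTrunc_left b a x).map (c.1 s)) p n m
        change _ = binomShift p (fun m n => F m n s) m n
          - ((Int.negOnePow p : ℤˣ) : ℤ) • binomShift p (fun n m => F' n m s) n m
        rw [e1, e2, smul_sub]
        abel
      rw [hD, map_sub, map_sub, map_zsmul, map_zsmul, hsw, ← binomShift₃_diff_pow p hF,
        ← binomShift₃_diff_pow p hF', diff_pow_triple_eq_zero hac hbc,
        diff_pow_triple_eq_zero hbc hac]
      have hz : binomShift₃ p (0 : ℤ → ℤ → ℤ → W) = 0 := by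
        funext m n s
        exact binomShift_zero_array p m n
      rw [hz, map_zero, smul_zero, sub_zero]
    have h12' : (diff12 ^ k) ((diff23 ^ K') (D p)) = 0 := by
      have hc : Commute (diff12 : Module.End ℂ (ℤ → ℤ → ℤ → W)) diff23 := by
        rw [diff23_eq]
        exact (diff13_comm_diff12.symm).sub_right (Commute.refl _)
      rw [← Module.End.mul_apply, (hc.pow_pow k K').eq, Module.End.mul_apply, h12, map_zero]
    have := sub_pow_apply_eq_zero diff13_comm_diff12 h13 h12'
    rw [← diff23_eq, ← Module.End.mul_apply, ← pow_add] at this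
    rwa [add_comm K']
  funext n s
  refine LinearMap.ext fun x => ?_
  have e := diffOp_pow_map (LinearMap.applyₗ x : (W →ₗ[ℂ] W) →ₗ[ℂ] W) (K' + (K + k))
    (comm (nprod p a b) c)
  refine (congrFun (congrFun e n) s).symm.trans ?_
  -- The row of index `0` in the first variable is the residue that defines the product, hence the
  -- commutator array of `nprod p a b` and `c`.
  have e2 := congrFun (key x) 0
  rw [diff23_pow_apply] at e2
  exact congrFun (congrFun e2 n) s

end Fld

/-! ### The identity field and functoriality of products -/

namespace Fld

variable {W : Type w} [AddCommGroup W] [Module ℂ W]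
  {W' : Type*} [AddCommGroup W'] [Module ℂ W']

/-- The field `x^0 id`. -/
def one : Fld W := ⟨fun n => if n = -1 then LinearMap.id else 0, fun x =>
  ⟨0, fun n hn => by simp only [if_neg (show n ≠ -1 by omega), LinearMap.zero_apply]⟩⟩

theorem one_apply (n : ℤ) (x : W) : (one : Fld W).1 n x = if n = -1 then x else 0 := by
  simp only [one]
  split_ifs <;> rfl

theorem ad_one (T : Module.End ℂ W) : ad T one = 0 := by
  ext n x
  rw [ad_apply, one_apply, one_apply]
  split_ifs <;> simp

theorem der_one : der (one : Fld W) = 0 := by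
  ext n x
  rw [der_apply, one_apply]
  by_cases h : n = 0
  · simp [h]
  · rw [if_neg (by omega), smul_zero, zero_apply]

theorem isLocal_one (a : Fld W) : IsLocal a one := by
  refine ⟨0, ?_⟩
  funext m n
  refine LinearMap.ext fun x => ?_
  simp only [pow_zero, Module.End.one_apply, comm, LinearMap.sub_apply, Module.End.mul_apply,
    one_apply]
  split_ifs <;> simp

theorem nprod_map (f : W →ₗ[ℂ] W') {a b : Fld W} {a' b' : Fld W'}
    (ha : ∀ n x, f (a.1 n x) = a'.1 n (f x)) (hb : ∀ n x, f (b.1 n x) = b'.1 n (f x)) (p n : ℤ)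
    (x : W) : f ((nprod p a b).1 n x) = (nprod p a' b').1 n (f x) := by
  rw [nprod_apply, nprod_apply, borcherdsSum, borcherdsSum, map_sub, map_zsmul,
    map_binomShift (isTrunc_left a b x), map_binomShift (isTrunc_left b a x)]
  simp only [ha, hb]

theorem nprod_mem {N : Submodule ℂ W} {a b : Fld W} (ha : ∀ n, ∀ x ∈ N, a.1 n x ∈ N)
    (hb : ∀ n, ∀ x ∈ N, b.1 n x ∈ N) (p n : ℤ) {x : W} (hx : x ∈ N) :
    (nprod p a b).1 n x ∈ N := by
  rw [nprod_apply, borcherdsSum, binomShift, binomShift]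
  have h : ∀ f : ℕ → W, (∀ i, f i ∈ N) → ∑ᶠ i, f i ∈ N := fun f hf => by
    exact finsum_induction (· ∈ N) N.zero_mem (fun _ _ h h' => N.add_mem h h') hf
  refine N.sub_mem (h _ fun i => zsmul_mem (ha _ _ (hb _ _ hx)) _)
    (zsmul_mem (h _ fun i => zsmul_mem (hb _ _ (ha _ _ hx)) _) _)

/-- The commutator is affine in `m` along antidiagonals, so `(x - y)²` kills it. -/
theorem isLocal_of_comm {a b P Q : Fld W}
    (h : ∀ m n x, a.1 m (b.1 n x) - b.1 n (a.1 m x) = P.1 (m + n) x + m • Q.1 (m + n - 1) x) :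
    IsLocal a b := ⟨2, by
  funext m n
  refine LinearMap.ext fun x => ?_
  have hc' : ∀ m n, comm a b m n x = P.1 (m + n) x + m • Q.1 (m + n - 1) x := fun m n => h m n x
  rw [pow_two, Module.End.mul_apply]
  simp only [diffOp_apply, LinearMap.sub_apply, hc', Pi.zero_apply, LinearMap.zero_apply]
  simp only [show m + 1 + 1 + n = m + n + 2 by ring, show m + 1 + (n + 1) = m + n + 2 by ring,
    show m + (n + 1 + 1) = m + n + 2 by ring, add_smul]
  abel⟩

end Fld

namespace VertexAlgebroid

attribute [local instance 100] LieRing.ofAssociativeRing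

variable {A : Type u} {B : Type v} [CommRing A] [Algebra ℂ A] [AddCommGroup B] [Module ℂ B]
  (X : VertexAlgebroid A B)

/-! ### Modules for the Lie algebra -/

theorem UL_induction {p : X.UL → Prop} (hℂ : ∀ r : ℂ, p (algebraMap ℂ X.UL r))
    (hmode : ∀ n c, p (X.modeU n c)) (hadd : ∀ x y, p x → p y → p (x + y))
    (hmul : ∀ x y, p x → p y → p (x * y)) (x : X.UL) : p x := by
  obtain ⟨t, rfl⟩ : ∃ t, UniversalEnvelopingAlgebra.mkAlgHom ℂ X.L t = x :=
    RingCon.mk'_surjective _ x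
  induction t using TensorAlgebra.induction with
  | algebraMap r => rw [AlgHom.commutes]; exact hℂ r
  | ι x =>
    obtain ⟨f, rfl⟩ := X.rho_surjective x
    change p (UniversalEnvelopingAlgebra.ι ℂ (X.rho f))
    induction f using Finsupp.induction_linear with
    | zero => simpa using hℂ 0
    | add f g hf hg => rw [map_add, map_add]; exact hadd _ _ hf hg
    | single n c => exact hmode n c
  | mul a b ha hb => rw [map_mul]; exact hmul _ _ ha hb
  | add a b ha hb => rw [map_add]; exact hadd _ _ ha hb

theorem mode_d (n : ℤ) (a : A) :
    X.mode n (0, X.d a) = (-n : ℤ) • X.mode (n - 1) (a, 0) := by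
  have h := X.rho_dHat (Finsupp.single n a)
  rw [dHat_single, map_add, map_smul] at h
  change X.mode n (0, X.d a) + (n : ℂ) • X.mode (n - 1) (a, 0) = 0 at h
  rw [eq_neg_of_add_eq_zero_left h, neg_smul, Int.cast_smul_eq_zsmul]

theorem lie_mode (m n : ℤ) (c c' : A × B) : ⁅X.mode m c, X.mode n c'⁆ =
    X.mode (m + n) (X.prod0 c c') + m • X.mode (m + n - 1) (X.prod1 c c') := by
  change ⁅X.rho (Finsupp.single m c), X.rho (Finsupp.single n c')⁆ = _
  rw [lie_rho, loopBr_single, map_add, map_smul, Int.cast_smul_eq_zsmul]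
  rfl

theorem modeU_d (n : ℤ) (a : A) :
    X.modeU n (0, X.d a) = (-n : ℤ) • X.modeU (n - 1) (a, 0) := by
  change UniversalEnvelopingAlgebra.ι ℂ (X.mode n (0, X.d a)) = _
  rw [mode_d, map_zsmul]
  rfl

theorem modeU_comm (m n : ℤ) (c c' : A × B) :
    X.modeU m c * X.modeU n c' - X.modeU n c' * X.modeU m c =
      X.modeU (m + n) (X.prod0 c c') + m • X.modeU (m + n - 1) (X.prod1 c c') := by
  have h := congrArg (UniversalEnvelopingAlgebra.ι ℂ : X.L →ₗ⁅ℂ⁆ X.UL) (X.lie_mode m n c c')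
  rw [LieHom.map_lie, LieRing.of_associative_ring_bracket, map_add, map_zsmul] at h
  exact h

/-- The homomorphism from `U(𝓛)` to an algebra `R` defined by elements `γ n c` of `R` that satisfy
the relations of the elements `c(n)`. -/
def liftModes {R : Type*} [Ring R] [Algebra ℂ R] (γ : ℤ → A × B →ₗ[ℂ] R)
    (hd : ∀ n a, γ n (0, X.d a) = (-n : ℤ) • γ (n - 1) (a, 0))
    (hcomm : ∀ m n c c', γ m c * γ n c' - γ n c' * γ m c =
      γ (m + n) (X.prod0 c c') + m • γ (m + n - 1) (X.prod1 c c')) :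
    X.UL →ₐ[ℂ] R :=
  UniversalEnvelopingAlgebra.lift ℂ
    { (LinearMap.range X.dHat).liftQ (Finsupp.lsum ℂ γ) (by
        rintro _ ⟨f, rfl⟩
        rw [LinearMap.mem_ker]
        induction f using Finsupp.induction_linear with
        | zero => simp
        | add f g hf hg => rw [map_add, map_add, hf, hg, add_zero]
        | single n a =>
          rw [dHat_single, map_add, map_smul, Finsupp.lsum_single, Finsupp.lsum_single, hd,
            Int.cast_smul_eq_zsmul, neg_smul, neg_add_cancel]) with
      map_lie' := by
        intro x y
        obtain ⟨x, rfl⟩ := X.rho_surjective x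
        obtain ⟨y, rfl⟩ := X.rho_surjective y
        rw [lie_rho]
        change Finsupp.lsum ℂ γ (X.loopBr x y) = ⁅Finsupp.lsum ℂ γ x, Finsupp.lsum ℂ γ y⁆
        induction x using Finsupp.induction_linear with
        | zero => simp
        | add f g hf hg => simp only [map_add, LinearMap.add_apply, add_lie, hf, hg]
        | single m c =>
          induction y using Finsupp.induction_linear with
          | zero => simp
          | add f g hf hg => simp only [map_add, lie_add, hf, hg]
          | single n c' =>
            rw [loopBr_single, map_add, map_smul, Finsupp.lsum_single, Finsupp.lsum_single,
              Finsupp.lsum_single, Finsupp.lsum_single, LieRing.of_associative_ring_bracket, hcomm,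
              Int.cast_smul_eq_zsmul] }

theorem liftModes_modeU {R : Type*} [Ring R] [Algebra ℂ R]
    (γ : ℤ → A × B →ₗ[ℂ] R)
    (hd : ∀ n a, γ n (0, X.d a) = (-n : ℤ) • γ (n - 1) (a, 0))
    (hcomm : ∀ m n c c', γ m c * γ n c' - γ n c' * γ m c =
      γ (m + n) (X.prod0 c c') + m • γ (m + n - 1) (X.prod1 c c')) (n : ℤ) (c : A × B) :
    X.liftModes γ hd hcomm (X.modeU n c) = γ n c := by
  change UniversalEnvelopingAlgebra.lift ℂ _ (UniversalEnvelopingAlgebra.ι ℂ (X.mode n c)) = _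
  rw [UniversalEnvelopingAlgebra.lift_ι_apply]
  change Finsupp.lsum ℂ γ (Finsupp.single n c) = _
  rw [Finsupp.lsum_single]

/-! ### Restricted modules and the action of `V_𝓛` on them -/

section Restricted

variable (W : Type w) [AddCommGroup W] [Module ℂ W] [Module X.UL W]

/-- Restricted modules: `c(n) x = 0` for `n ≫ 0`. -/
class IsRestricted : Prop where
  trunc : ∀ (c : A × B) (x : W), ∃ N : ℤ, ∀ n, N ≤ n → X.modeU n c • x = 0

variable {W} [IsScalarTower ℂ X.UL W]

theorem smul_mem_of_mode {N : Submodule ℂ W} (h : ∀ n c, ∀ x ∈ N, X.modeU n c • x ∈ N) (y : X.UL)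
    {x : W} (hx : x ∈ N) : y • x ∈ N := by
  induction y using X.UL_induction generalizing x with
  | hℂ r => rw [algebraMap_smul]; exact N.smul_mem r hx
  | hmode n c => exact h n c x hx
  | hadd y z hy hz => rw [add_smul]; exact N.add_mem (hy hx) (hz hx)
  | hmul y z hy hz => rw [mul_smul]; exact hy (hz hx)

/-- An `𝓛`-stable subspace as a submodule. -/
def submoduleOfMode (N : Submodule ℂ W) (h : ∀ n c, ∀ x ∈ N, X.modeU n c • x ∈ N) :
    Submodule X.UL W :=
  { N with smul_mem' := fun y _ hx => X.smul_mem_of_mode h y hx }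

/-- The vectors eventually killed by every series `c(n)` form an 𝓛-submodule, because a commutator
`[c'(n), c(m)]` involves only modes of index `n + m` and `n + m - 1`. -/
theorem isRestricted_of_span {S : Set W} (hS : Submodule.span X.UL S = ⊤)
    (h : ∀ x ∈ S, ∀ c, ∃ N : ℤ, ∀ n, N ≤ n → X.modeU n c • x = 0) : X.IsRestricted W := by
  let N : Submodule ℂ W :=
    { carrier := {x | ∀ c, ∃ N : ℤ, ∀ n, N ≤ n → X.modeU n c • x = 0}
      add_mem' := by
        intro x y hx hy c
        obtain ⟨N, hN⟩ := hx c
        obtain ⟨N', hN'⟩ := hy c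
        exact ⟨max N N', fun n hn => by
          rw [smul_add, hN _ (le_of_max_le_left hn), hN' _ (le_of_max_le_right hn), add_zero]⟩
      zero_mem' := fun c => ⟨0, fun n _ => smul_zero _⟩
      smul_mem' := by
        intro r x hx c
        obtain ⟨N, hN⟩ := hx c
        exact ⟨N, fun n hn => by rw [smul_comm, hN n hn, smul_zero]⟩ }
  have hN : ∀ m c, ∀ x ∈ N, X.modeU m c • x ∈ N := by
    intro m c x hx c'
    obtain ⟨N1, h1⟩ := hx c'
    obtain ⟨N2, h2⟩ := hx (X.prod0 c' c)
    obtain ⟨N3, h3⟩ := hx (X.prod1 c' c)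
    -- The three bounds make `c'(n)`, `(c'₀c)(n+m)` and `(c'₁c)(n+m-1)` vanish on `x`.
    refine ⟨max N1 (max (N2 - m) (N3 - m + 1)), fun n hn => ?_⟩
    have e := congrArg (· • x) (X.modeU_comm n m c' c)
    simp only [sub_smul, add_smul, mul_smul] at e
    rw [smul_assoc, h1 n (by omega), h2 _ (by omega), h3 _ (by omega)] at e
    simpa using e
  have hle : Submodule.span X.UL S ≤ X.submoduleOfMode N hN := Submodule.span_le.2 h
  rw [hS] at hle
  exact ⟨fun c x => hle (Submodule.mem_top (x := x)) c⟩

variable [X.IsRestricted W]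

/-- The field given by `c ∈ A ⊕ B`. -/
def modeFld : A × B →ₗ[ℂ] Fld W where
  toFun c := ⟨fun n =>
    { toFun := fun x => X.modeU n c • x
      map_add' := smul_add _
      map_smul' := fun r x => smul_comm _ _ _ }, IsRestricted.trunc c⟩
  map_add' c c' := by
    ext n x
    change X.modeU n (c + c') • x = X.modeU n c • x + X.modeU n c' • x
    rw [map_add, add_smul]
  map_smul' r c := by
    ext n x
    change X.modeU n (r • c) • x = r • X.modeU n c • x
    rw [map_smul, smul_assoc]

theorem modeFld_apply (c : A × B) (n : ℤ) (x : W) :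
    (X.modeFld c : Fld W).1 n x = X.modeU n c • x := rfl

theorem modeFld_comm (c c' : A × B) (m n : ℤ) (x : W) :
    (X.modeFld c).1 m ((X.modeFld c').1 n x) - (X.modeFld c').1 n ((X.modeFld c).1 m x)
      = (X.modeFld (X.prod0 c c')).1 (m + n) x
        + m • (X.modeFld (X.prod1 c c')).1 (m + n - 1) x := by
  simp only [modeFld_apply]
  rw [← mul_smul, ← mul_smul, ← sub_smul, modeU_comm, add_smul, smul_assoc]

theorem modeFld_d (a : A) : (X.modeFld (0, X.d a) : Fld W) = Fld.der (X.modeFld (a, 0)) := by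
  ext n x
  rw [modeFld_apply, modeU_d, Fld.der_apply, modeFld_apply, smul_assoc]

variable (W) in
/-- The `𝓛`-module structure on the space of fields, where `c(n)` acts as the product `c_(n)`. -/
def fldRep : X.UL →ₐ[ℂ] Module.End ℂ (Fld W) :=
  X.liftModes (R := Module.End ℂ (Fld W))
    (fun n => (Fld.nprod n : Fld W →ₗ[ℂ] Module.End ℂ (Fld W)) ∘ₗ X.modeFld)
    (fun n a => by
      refine LinearMap.ext fun g => ?_
      rw [LinearMap.comp_apply, modeFld_d, Fld.nprod_der_left]
      rfl)
    (fun m n c c' => LinearMap.ext fun g => Fld.nprod_comm (X.modeFld_comm c c') m n g)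

theorem fldRep_modeU (n : ℤ) (c : A × B) : X.fldRep W (X.modeU n c) = Fld.nprod n (X.modeFld c) :=
  X.liftModes_modeU _ _ _ n c

-- The identity field behaves like a vacuum in the 𝓛-module of fields, so acting on it descends from
-- `U(𝓛)` to `V_𝓛`.
variable (W) in
theorem fldRep_vacIdeal {x : X.UL} (hx : x ∈ X.vacIdeal) : X.fldRep W x Fld.one = 0 := by
  induction hx using Submodule.span_induction with
  | mem x hx =>
    obtain ⟨n, c, hn, rfl⟩ := hx
    rw [fldRep_modeU]
    exact Fld.nprod_id n _ Fld.one_apply hn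
  | zero => simp
  | add x y _ _ hx hy => rw [map_add, LinearMap.add_apply, hx, hy, add_zero]
  | smul r x _ hx => rw [smul_eq_mul, map_mul, Module.End.mul_apply, hx, map_zero]

variable (W) in
/-- The action of `V_𝓛` on a restricted `𝓛`-module. -/
def YL : X.VL →ₗ[ℂ] Fld W :=
  (X.vacIdeal.restrictScalars ℂ).liftQ
      (LinearMap.applyₗ (Fld.one : Fld W) ∘ₗ (X.fldRep W).toLinearMap)
      (fun _ hx => X.fldRep_vacIdeal W hx) ∘ₗ
    (Submodule.Quotient.restrictScalarsEquiv ℂ X.vacIdeal).symm.toLinearMap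

theorem YL_toVL (x : X.UL) : X.YL W (X.toVL x) = X.fldRep W x Fld.one := rfl

theorem toVL_surjective : Function.Surjective X.toVL := Submodule.mkQ_surjective _

theorem YL_smul (x : X.UL) (y : X.VL) : X.YL W (x • y) = X.fldRep W x (X.YL W y) := by
  obtain ⟨y, rfl⟩ := X.toVL_surjective y
  rw [← map_smul, YL_toVL, YL_toVL, smul_eq_mul, map_mul, Module.End.mul_apply]

theorem YL_mode (n : ℤ) (c : A × B) (y : X.VL) :
    X.YL W (X.modeU n c • y) = Fld.nprod n (X.modeFld c) (X.YL W y) := by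
  rw [YL_smul, fldRep_modeU]

theorem YL_vacL : X.YL W X.vacL = Fld.one := by
  rw [vacL, YL_toVL, map_one]
  rfl

theorem modeU_vacL {n : ℤ} (hn : 0 ≤ n) (c : A × B) : X.modeU n c • X.vacL = 0 := by
  rw [vacL, ← map_smul, smul_eq_mul, mul_one]
  exact (Submodule.Quotient.mk_eq_zero _).2 (Submodule.subset_span ⟨n, c, hn, rfl⟩)

theorem VL_span : Submodule.span X.UL {X.vacL} = ⊤ := by
  refine eq_top_iff.2 fun x _ => ?_
  obtain ⟨x, rfl⟩ := X.toVL_surjective x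
  rw [← mul_one x, ← smul_eq_mul, map_smul]
  exact Submodule.smul_mem _ _ (Submodule.subset_span rfl)

/-- The induction principle for `V_𝓛`: a linear condition need only be checked at 𝟏 and under the
action of modes. -/
theorem VL_eq_top {N : Submodule ℂ X.VL} (h0 : X.vacL ∈ N)
    (h : ∀ n c, ∀ x ∈ N, X.modeU n c • x ∈ N) (x : X.VL) : x ∈ N := by
  have : Submodule.span X.UL {X.vacL} ≤ X.submoduleOfMode N h :=
    Submodule.span_le.2 (Set.singleton_subset_iff.2 h0)
  rw [VL_span] at this
  exact this (Submodule.mem_top (x := x))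

instance : X.IsRestricted X.VL := X.isRestricted_of_span X.VL_span (by
  rintro _ rfl c
  exact ⟨0, fun n hn => X.modeU_vacL hn c⟩)

theorem YL_emb (c : A × B) : X.YL W (X.modeU (-1) c • X.vacL) = X.modeFld c := by
  rw [YL_mode, YL_vacL, Fld.nprod_neg_one_id _ Fld.one_apply]

/-- Dong's lemma along the generation of `V_𝓛` from 𝟏. The step with a new mode of `c` needs
locality of `y` with `c` as well as with the field under test, hence the intersection over all `c`.
-/
theorem isLocal_modeFld_YL (c : A × B) (y : X.VL) : Fld.IsLocal (X.modeFld c) (X.YL W y) := by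
  have h := X.VL_eq_top (N := ⨅ c : A × B, (Fld.localTo (X.modeFld c)).comap (X.YL W)) ?_ ?_ y
  · rw [Submodule.mem_iInf] at h
    exact h c
  · rw [Submodule.mem_iInf]
    intro c
    rw [Submodule.mem_comap, YL_vacL]
    exact Fld.isLocal_one _
  · intro n c x hx
    rw [Submodule.mem_iInf] at hx ⊢
    intro c'
    rw [Submodule.mem_comap, YL_mode]
    exact (Fld.IsLocal.nprod_left (hx c) (Fld.isLocal_of_comm (X.modeFld_comm c c'))
      (hx c').symm n).symm

theorem isLocal_YL (x y : X.VL) : Fld.IsLocal (X.YL W x) (X.YL W y) := by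
  refine X.VL_eq_top (N := (Fld.localTo (X.YL W x)).comap (X.YL W)) ?_ ?_ y
  · rw [Submodule.mem_comap, YL_vacL]
    exact Fld.isLocal_one _
  · intro n c y hy
    rw [Submodule.mem_comap, YL_mode]
    exact (Fld.IsLocal.nprod_left (X.isLocal_modeFld_YL c y) (X.isLocal_modeFld_YL c x)
      (Fld.IsLocal.symm hy) n).symm

theorem YL_mem {N : Submodule ℂ W} (h : ∀ n c, ∀ x ∈ N, X.modeU n c • x ∈ N) (y : X.VL) (n : ℤ)
    {x : W} (hx : x ∈ N) : (X.YL W y).1 n x ∈ N := by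
  let P : Submodule ℂ X.VL :=
    { carrier := {y | ∀ n, ∀ x ∈ N, (X.YL W y).1 n x ∈ N}
      add_mem' := fun {y z} hy hz n x hx => by
        rw [map_add]
        exact N.add_mem (hy n x hx) (hz n x hx)
      zero_mem' := fun n x hx => by rw [map_zero]; exact N.zero_mem
      smul_mem' := fun r y hy n x hx => by
        rw [map_smul]
        exact N.smul_mem r (hy n x hx) }
  refine X.VL_eq_top (N := P) ?_ ?_ y n x hx
  · intro n x hx
    rw [YL_vacL, Fld.one_apply]
    split_ifs
    exacts [hx, N.zero_mem]
  · intro m c y hy n x hx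
    rw [YL_mode]
    exact Fld.nprod_mem (fun n x hx => h n c x hx) hy m n hx

theorem YL_map {W' : Type*} [AddCommGroup W'] [Module ℂ W'] [Module X.UL W']
    [IsScalarTower ℂ X.UL W'] [X.IsRestricted W'] (f : W →ₗ[ℂ] W')
    (hf : ∀ n c x, f (X.modeU n c • x) = X.modeU n c • f x) (y : X.VL) (n : ℤ) (x : W) :
    f ((X.YL W y).1 n x) = (X.YL W' y).1 n (f x) := by
  let P : Submodule ℂ X.VL :=
    { carrier := {y | ∀ n x, f ((X.YL W y).1 n x) = (X.YL W' y).1 n (f x)}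
      add_mem' := fun {y z} hy hz n x => by
        rw [map_add, map_add, Fld.add_apply, Fld.add_apply, map_add, hy, hz]
      zero_mem' := fun n x => by simp
      smul_mem' := fun r y hy n x => by
        rw [map_smul, map_smul, Fld.smul_apply, Fld.smul_apply, map_smul, hy] }
  refine X.VL_eq_top (N := P) ?_ ?_ y n x
  · intro n x
    rw [YL_vacL, YL_vacL, Fld.one_apply, Fld.one_apply]
    split_ifs <;> simp
  · intro m c y hy n x
    rw [YL_mode, YL_mode]
    exact Fld.nprod_map f (hf · c) hy m n x

/-- Both `𝒟` and `der` annihilate the vacuum and obey the same commutation rule with products by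
`c`, by `Fld.nprod_der` and integration by parts. -/
theorem YL_DV (y : X.VL) : X.YL W (X.DV y) = Fld.der (X.YL W y) := by
  have h := X.VL_eq_top (N := LinearMap.eqLocus (X.YL W ∘ₗ X.DV) (Fld.der ∘ₗ X.YL W)) ?_ ?_ y
  · exact h
  · simp [LinearMap.mem_eqLocus, DV_vacL, YL_vacL, Fld.der_one]
  · intro n c y hy
    rw [LinearMap.mem_eqLocus, LinearMap.comp_apply, LinearMap.comp_apply] at hy ⊢
    rw [DV_modeU, map_add, LinearMap.map_smul (X.YL W), YL_mode, YL_mode, YL_mode, Fld.nprod_der, hy,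
      Fld.nprod_der_left, add_comm]
    congr 1
    rw [← Int.cast_smul_eq_zsmul ℂ]
    push_cast
    rfl

/-- Translation covariance on `V_𝓛` itself: `ad` and `der` are derivations of all products, so the
relation `[𝒟, c(n)] = -n c(n-1)` on generators suffices. -/
theorem ad_DV (y : X.VL) : Fld.ad X.DV (X.YL X.VL y) = Fld.der (X.YL X.VL y) := by
  have h := X.VL_eq_top
    (N := LinearMap.eqLocus (Fld.ad X.DV ∘ₗ X.YL X.VL) (Fld.der ∘ₗ X.YL X.VL)) ?_ ?_ y
  · exact h
  · simp [LinearMap.mem_eqLocus, Fld.ad_one, YL_vacL, Fld.der_one]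
  · intro n c y hy
    rw [LinearMap.mem_eqLocus, LinearMap.comp_apply, LinearMap.comp_apply] at hy ⊢
    rw [YL_mode, Fld.nprod_der, Fld.ad_nprod, hy]
    congr 3
    ext n x
    rw [Fld.ad_apply, Fld.der_apply, modeFld_apply, modeFld_apply, DV_modeU, modeFld_apply,
      add_sub_cancel_left, ← Int.cast_smul_eq_zsmul ℂ]
    push_cast
    rfl

/-- The creation property. Since `c(i)𝟏 = 0` for `i ≥ 0`, the right half of the product with `c`
vanishes on 𝟏. In the left half, at mode `-1`, only the term `c(p) y` remains. -/
theorem YL_apply_vacL (y : X.VL) : (∀ n, 0 ≤ n → (X.YL X.VL y).1 n X.vacL = 0)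
    ∧ (X.YL X.VL y).1 (-1) X.vacL = y := by
  let P : Submodule ℂ X.VL :=
    { carrier := {y | (∀ n, 0 ≤ n → (X.YL X.VL y).1 n X.vacL = 0)
        ∧ (X.YL X.VL y).1 (-1) X.vacL = y}
      add_mem' := fun {y z} hy hz => by
        refine ⟨fun n hn => ?_, ?_⟩
        · rw [map_add, Fld.add_apply, hy.1 n hn, hz.1 n hn, add_zero]
        · rw [map_add, Fld.add_apply, hy.2, hz.2]
      zero_mem' := by simp
      smul_mem' := fun r y hy => by
        refine ⟨fun n hn => ?_, ?_⟩
        · rw [map_smul, Fld.smul_apply, hy.1 n hn, smul_zero]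
        · rw [map_smul, Fld.smul_apply, hy.2] }
  refine X.VL_eq_top (N := P) ?_ ?_ y
  · refine ⟨fun n hn => ?_, ?_⟩
    · rw [YL_vacL, Fld.one_apply, if_neg (by omega)]
    · rw [YL_vacL, Fld.one_apply, if_pos rfl]
  · intro p c y hy
    have hr : ∀ n, (Fld.rmul p (X.modeFld c) (X.YL X.VL y)).1 n X.vacL = 0 := fun n =>
      Fld.rmul_eq_zero p fun i j hi => by rw [modeFld_apply, modeU_vacL _ hi, map_zero]
    refine ⟨fun n hn => ?_, ?_⟩
    · rw [YL_mode, Fld.nprod_eq, Fld.sub_apply, hr, sub_zero]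
      exact Fld.lmul_eq_zero p _ hy.1 hn
    · rw [YL_mode, Fld.nprod_eq, Fld.sub_apply, hr, sub_zero, Fld.lmul_apply,
        binomShift_eq_sum (N := 0) (K := 1) (fun m n hn => by rw [hy.1 n hn, map_zero]) (by simp)]
      simp [hy.2, modeFld_apply]

theorem DV_YL_vacL (y : X.VL) (n : ℤ) : X.DV ((X.YL X.VL y).1 n X.vacL)
    = (-n : ℤ) • (X.YL X.VL y).1 (n - 1) X.vacL := by
  have h := congrArg (fun f : Fld X.VL => f.1 n X.vacL) (X.ad_DV y)
  simp only [Fld.ad_apply, Fld.der_apply, DV_vacL, map_zero, sub_zero] at h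
  exact h

/-- A sequence of maps that is local with the action of `𝓛` and kills the vacuum is zero. -/
theorem eq_zero_of_local {M : Type*} [AddCommGroup M] [Module ℂ M] {f : ℤ → X.VL →ₗ[ℂ] M}
    {γ : ℤ → A × B → M →ₗ[ℂ] M}
    (hf : ∀ c, ∃ N : ℕ, ∀ y, (diffOp ^ N)
      (fun m n => f m (X.modeU n c • y) - γ n c (f m y)) = 0)
    (hvac : ∀ n, f n X.vacL = 0) (n : ℤ) (y : X.VL) : f n y = 0 := by
  have h := X.VL_eq_top (N := ⨅ n, LinearMap.ker (f n)) ?_ ?_ y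
  · rw [Submodule.mem_iInf] at h
    exact h n
  · rw [Submodule.mem_iInf]
    exact hvac
  · intro n c y hy
    rw [Submodule.mem_iInf] at hy ⊢
    -- Once all `f m` kill `y`, locality says that a power of `x - y` kills the array `f m (c(n)
    -- y)`. This array is truncated in `n`, so it is zero.
    intro m
    obtain ⟨N, hN⟩ := hf c
    have e := hN y
    have e2 : (fun m n => f m (X.modeU n c • y) - γ n c (f m y))
        = fun m n => f m (X.modeU n c • y) := by
      funext m n
      rw [LinearMap.mem_ker.1 (hy m), map_zero, sub_zero]
    rw [e2] at e
    obtain ⟨K, hK⟩ := IsRestricted.trunc (X := X) c y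
    exact congrFun (congrFun (eq_zero_of_diffOp_pow
      ⟨K, fun m n hn => by rw [hK n hn, map_zero]⟩ e) m) n

/-- The case `y = 𝟏` of the iterate formula. For `n ≥ 0` both sides vanish. Below `-1` one descends
by `𝒟(y_n 𝟏) = -n y_{n-1} 𝟏`, whose coefficient is nonzero for `n < 0`. -/
theorem YL_YL_vacL (y : X.VL) (n : ℤ) :
    X.YL W ((X.YL X.VL y).1 n X.vacL) = Fld.nprod n (X.YL W y) Fld.one := by
  rcases le_or_gt 0 n with hn | hn
  · rw [(X.YL_apply_vacL y).1 n hn, map_zero, Fld.nprod_id n _ Fld.one_apply hn]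
  · obtain ⟨k, rfl⟩ : ∃ k : ℕ, n = -1 - k := ⟨(-1 - n).toNat, by omega⟩
    clear hn
    induction k with
    | zero =>
      rw [Nat.cast_zero, sub_zero, (X.YL_apply_vacL y).2, Fld.nprod_neg_one_id _ Fld.one_apply]
    | succ k ih =>
      have h := congrArg (X.YL W) (X.DV_YL_vacL y (-1 - k))
      rw [YL_DV, ih, Fld.nprod_der, Fld.der_one, map_zero, add_zero, Fld.nprod_der_left, map_zsmul,
        ← Int.cast_smul_eq_zsmul ℂ, ← Int.cast_smul_eq_zsmul ℂ] at h
      have h0 : ((-(-1 - (k : ℤ)) : ℤ) : ℂ) ≠ 0 := by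
        rw [Int.cast_ne_zero]
        omega
      have := smul_right_injective _ h0 h
      rw [show -1 - ((k + 1 : ℕ) : ℤ) = -1 - (k : ℤ) - 1 by push_cast; ring]
      exact this.symm

/-- As functions of `y`, both sides are local with the action of 𝓛: the left by locality on `V_𝓛`,
the right because locality passes to product operators (`Fld.comm_eq_diffOp_shift`). They agree at
𝟏, so their difference is zero. -/
theorem YL_YL (x y : X.VL) (n : ℤ) :
    X.YL W ((X.YL X.VL x).1 n y) = Fld.nprod n (X.YL W x) (X.YL W y) := by
  rw [← sub_eq_zero]
  refine X.eq_zero_of_local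
    (f := fun n => X.YL W ∘ₗ (X.YL X.VL x).1 n - Fld.nprod n (X.YL W x) ∘ₗ X.YL W)
    (γ := fun n c => Fld.nprod n (X.modeFld c)) ?_ ?_ n y
  · intro c
    obtain ⟨N, hN⟩ := (X.isLocal_modeFld_YL (W := X.VL) c x).symm
    obtain ⟨N', hN'⟩ := (X.isLocal_modeFld_YL (W := W) c x).symm
    refine ⟨max N N', fun y => ?_⟩
    have e1 := diffOp_pow_map (X.YL W ∘ₗ LinearMap.applyₗ y) (max N N')
      (Fld.comm (X.YL X.VL x) (X.modeFld c))
    rw [diffOp_pow_eq_zero_of_le hN (le_max_left _ _)] at e1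
    have e2 := diffOp_pow_map (LinearMap.applyₗ (X.YL W y)) (max N N')
      (fun m n => (Fld.nprod m (X.YL W x) * Fld.nprod n (X.modeFld c)
        - Fld.nprod n (X.modeFld c) * Fld.nprod m (X.YL W x) : Module.End ℂ (Fld W)))
    rw [diffOp_pow_eq_zero_of_le (Fld.comm_eq_diffOp_shift hN') (le_max_right _ _)] at e2
    have e3 : (fun m n => (X.YL W ∘ₗ (X.YL X.VL x).1 m - Fld.nprod m (X.YL W x) ∘ₗ X.YL W)
          (X.modeU n c • y) - Fld.nprod n (X.modeFld c)
          ((X.YL W ∘ₗ (X.YL X.VL x).1 m - Fld.nprod m (X.YL W x) ∘ₗ X.YL W) y))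
        = (fun m n => (X.YL W ∘ₗ LinearMap.applyₗ y) (Fld.comm (X.YL X.VL x) (X.modeFld c) m n))
          - (fun m n => (LinearMap.applyₗ (X.YL W y))
            (Fld.nprod m (X.YL W x) * Fld.nprod n (X.modeFld c)
              - Fld.nprod n (X.modeFld c) * Fld.nprod m (X.YL W x) : Module.End ℂ (Fld W))) := by
      funext m n
      simp only [Pi.sub_apply, LinearMap.sub_apply, LinearMap.comp_apply,
        LinearMap.applyₗ_apply_apply, Fld.comm, Module.End.mul_apply, modeFld_apply, map_sub,
        YL_mode]
      abel
    rw [e3, map_sub, e1, e2]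
    funext m n
    simp
  · intro n
    rw [LinearMap.sub_apply, LinearMap.comp_apply, LinearMap.comp_apply, YL_YL_vacL, YL_vacL,
      sub_self]

end Restricted

/-! ### The vertex algebra `V_B` and its action on admissible modules -/

theorem DV_smul (x : X.UL) (y : X.VL) : X.DV (x • y) = x • X.DV y + X.DU x • y := by
  obtain ⟨y, rfl⟩ := X.toVL_surjective y
  rw [← map_smul, DV_toVL, DV_toVL, smul_eq_mul, DU_mul, map_add, ← smul_eq_mul, ← smul_eq_mul,
    map_smul, map_smul]

theorem E_subset_IB {y : X.VL} (hy : y ∈ X.E) : y ∈ X.IB :=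
  Submodule.subset_span ⟨0, y, hy, rfl⟩

theorem DV_mem_IB {y : X.VL} (hy : y ∈ X.IB) : X.DV y ∈ X.IB := by
  induction hy using Submodule.span_induction with
  | mem y hy =>
    obtain ⟨k, y, hy, rfl⟩ := hy
    rw [← Module.End.mul_apply, ← pow_succ']
    exact Submodule.subset_span ⟨k + 1, y, hy, rfl⟩
  | zero => simp
  | add x y _ _ hx hy => rw [map_add]; exact add_mem hx hy
  | smul r x hx h =>
    rw [DV_smul]
    exact add_mem (X.IB.smul_mem _ h) (X.IB.smul_mem _ hx)

/-- The projection `V_𝓛 → V_B`. -/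
def toVB : X.VL →ₗ[X.UL] X.VB := X.IB.mkQ

theorem toVB_surjective : Function.Surjective X.toVB := X.IB.mkQ_surjective

theorem toVB_eq_zero {y : X.VL} : X.toVB y = 0 ↔ y ∈ X.IB := Submodule.Quotient.mk_eq_zero _

theorem toVB_vacL : X.toVB X.vacL = X.vac := rfl

instance : X.IsRestricted X.VB where
  trunc c x := by
    obtain ⟨x, rfl⟩ := X.toVB_surjective x
    obtain ⟨N, hN⟩ := IsRestricted.trunc (X := X) c x
    exact ⟨N, fun n hn => by rw [← map_smul, hN n hn, map_zero]⟩

section Admissible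

variable (W : Type w) [AddCommGroup W] [Module ℂ W] [Module X.UL W] [IsScalarTower ℂ X.UL W]
  [X.IsRestricted W]

/-- Restricted modules on which the generators of `I_B` act by zero. -/
class IsAdmissible : Prop where
  YL_E : ∀ y ∈ X.E, X.YL W y = 0

variable [X.IsAdmissible W]

/-- `YL` turns `𝒟` into the derivative and is 𝓛-linear, so vanishing on the generators spreads over
`I_B`. -/
theorem YL_IB {y : X.VL} (hy : y ∈ X.IB) : X.YL W y = 0 := by
  induction hy using Submodule.span_induction with
  | mem y hy =>
    obtain ⟨k, y, hy, rfl⟩ := hy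
    induction k with
    | zero => exact IsAdmissible.YL_E y hy
    | succ k ih => rw [pow_succ', Module.End.mul_apply, YL_DV, ih, map_zero]
  | zero => simp
  | add x y _ _ hx hy => rw [map_add, hx, hy, add_zero]
  | smul r x _ h => rw [YL_smul, h, map_zero]

/-- The action of `V_B` on an admissible module. -/
def YB : X.VB →ₗ[ℂ] Fld W :=
  (X.IB.restrictScalars ℂ).liftQ (X.YL W) (fun _ hx => X.YL_IB W hx) ∘ₗ
    (Submodule.Quotient.restrictScalarsEquiv ℂ X.IB).symm.toLinearMap

theorem YB_toVB (y : X.VL) : X.YB W (X.toVB y) = X.YL W y := rfl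

end Admissible

theorem YL_toVB (x y : X.VL) (n : ℤ) :
    X.toVB ((X.YL X.VL x).1 n y) = (X.YL X.VB x).1 n (X.toVB y) :=
  X.YL_map (X.toVB.restrictScalars ℂ) (fun _ _ _ => X.toVB.map_smul _ _) x n y

/-- In effect, the left submodule `I_B` is a two-sided ideal. For a generator `y` the maps `y_n :
V_𝓛 → V_B` are local with 𝓛, so they need only be tested at 𝟏. There `y_n 𝟏` is zero or a multiple
of some `𝒟^k y`, hence lies in `I_B`. -/
instance : X.IsAdmissible X.VB where
  YL_E y hy := by
    ext n x
    obtain ⟨x, rfl⟩ := X.toVB_surjective x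
    rw [← YL_toVB]
    refine X.eq_zero_of_local (f := fun n => X.toVB.restrictScalars ℂ ∘ₗ (X.YL X.VL y).1 n)
      (γ := fun n c => (X.modeFld c).1 n) ?_ ?_ n x
    · intro c
      obtain ⟨N, hN⟩ := (X.isLocal_modeFld_YL (W := X.VL) c y).symm
      refine ⟨N, fun x => ?_⟩
      have e1 := diffOp_pow_map (X.toVB.restrictScalars ℂ ∘ₗ LinearMap.applyₗ x) N
        (Fld.comm (X.YL X.VL y) (X.modeFld c))
      rw [hN] at e1
      have e2 : (fun m n => (X.toVB.restrictScalars ℂ ∘ₗ (X.YL X.VL y).1 m) (X.modeU n c • x)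
            - (X.modeFld c).1 n ((X.toVB.restrictScalars ℂ ∘ₗ (X.YL X.VL y).1 m) x))
          = fun m n => (X.toVB.restrictScalars ℂ ∘ₗ LinearMap.applyₗ x)
            (Fld.comm (X.YL X.VL y) (X.modeFld c) m n) := by
        funext m n
        simp only [LinearMap.comp_apply, LinearMap.applyₗ_apply_apply, Fld.comm,
          Module.End.mul_apply, modeFld_apply, map_sub,
          LinearMap.coe_restrictScalars, map_smul]
      rw [e2, e1]
      funext m n
      simp
    · intro n
      rw [LinearMap.comp_apply]
      refine X.toVB_eq_zero.2 ?_
      rcases le_or_gt 0 n with hn | hn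
      · rw [(X.YL_apply_vacL y).1 n hn]
        exact zero_mem _
      · obtain ⟨k, rfl⟩ : ∃ k : ℕ, n = -1 - k := ⟨(-1 - n).toNat, by omega⟩
        clear hn
        induction k with
        | zero =>
          rw [Nat.cast_zero, sub_zero, (X.YL_apply_vacL y).2]
          exact X.E_subset_IB hy
        | succ k ih =>
          have h := X.DV_mem_IB ih
          rw [X.DV_YL_vacL y (-1 - k), ← Int.cast_smul_eq_zsmul ℂ] at h
          have h0 : ((-(-1 - (k : ℤ)) : ℤ) : ℂ) ≠ 0 := by
            rw [Int.cast_ne_zero]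
            omega
          rw [show -1 - ((k + 1 : ℕ) : ℤ) = -1 - (k : ℤ) - 1 by push_cast; ring]
          have := (X.IB.restrictScalars ℂ).smul_mem ((-(-1 - (k : ℤ)) : ℤ) : ℂ)⁻¹ h
          rwa [smul_smul, inv_mul_cancel₀ h0, one_smul] at this

theorem VB_eq_top {N : Submodule ℂ X.VB} (h0 : X.vac ∈ N)
    (h : ∀ n c, ∀ x ∈ N, X.modeU n c • x ∈ N) (x : X.VB) : x ∈ N := by
  obtain ⟨x, rfl⟩ := X.toVB_surjective x
  refine X.VL_eq_top (N := N.comap (X.toVB.restrictScalars ℂ)) h0 (fun n c x hx => ?_) x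
  rw [Submodule.mem_comap, LinearMap.coe_restrictScalars, map_smul]
  exact h n c _ hx

section Admissible

variable {W : Type w} [AddCommGroup W] [Module ℂ W] [Module X.UL W] [IsScalarTower ℂ X.UL W]
  [X.IsRestricted W] [X.IsAdmissible W]

theorem YB_vac : X.YB W X.vac = Fld.one := X.YL_vacL

theorem YB_mode (n : ℤ) (c : A × B) (y : X.VB) :
    X.YB W (X.modeU n c • y) = Fld.nprod n (X.modeFld c) (X.YB W y) := by
  obtain ⟨y, rfl⟩ := X.toVB_surjective y
  rw [← map_smul, YB_toVB, YB_toVB, YL_mode]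

theorem YB_emb (c : A × B) : X.YB W (X.emb c) = X.modeFld c := by
  rw [emb, YB_mode, YB_vac, Fld.nprod_neg_one_id _ Fld.one_apply]

theorem YB_YB (x y : X.VB) (n : ℤ) :
    X.YB W ((X.YB X.VB x).1 n y) = Fld.nprod n (X.YB W x) (X.YB W y) := by
  obtain ⟨x, rfl⟩ := X.toVB_surjective x
  obtain ⟨y, rfl⟩ := X.toVB_surjective y
  rw [YB_toVB, YB_toVB, ← YL_toVB, YB_toVB, YL_YL, YB_toVB]

theorem isLocal_YB (x y : X.VB) : Fld.IsLocal (X.YB W x) (X.YB W y) := by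
  obtain ⟨x, rfl⟩ := X.toVB_surjective x
  obtain ⟨y, rfl⟩ := X.toVB_surjective y
  exact X.isLocal_YL x y

theorem jacobi_YB : JacobiIdentity ((Fld X.VB).subtype ∘ₗ X.YB X.VB)
    ((Fld W).subtype ∘ₗ X.YB W) := by
  intro a b x l m n
  have h := Fld.borcherds (X.isLocal_YB (W := W) a b) x l m n
  simp only [← YB_YB] at h
  exact h

end Admissible

/-- The vertex algebra structure of `V_B`. -/
def vertexAlgebra : VertexAlgebra X.VB where
  Y := (Fld X.VB).subtype ∘ₗ X.YB X.VB
  vac := X.vac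
  truncation a b := (X.YB X.VB a).2 b
  vacuum n b := by
    rw [LinearMap.comp_apply, YB_vac]
    exact Fld.one_apply n b
  creation_regular a n hn := by
    obtain ⟨a, rfl⟩ := X.toVB_surjective a
    refine (X.YL_toVB a X.vacL n).symm.trans ?_
    rw [(X.YL_apply_vacL a).1 n hn, map_zero]
  creation a := by
    obtain ⟨a, rfl⟩ := X.toVB_surjective a
    refine (X.YL_toVB a X.vacL (-1)).symm.trans ?_
    rw [(X.YL_apply_vacL a).2]
  jacobi := X.jacobi_YB

theorem vertexAlgebra_Y (a x : X.VB) (n : ℤ) :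
    X.vertexAlgebra.Y a n x = (X.YB X.VB a).1 n x := rfl

theorem isAssociated_vertexAlgebra : X.IsAssociated X.vertexAlgebra :=
  ⟨rfl, fun c n x => by rw [vertexAlgebra_Y, YB_emb, modeFld_apply]⟩

/-- The `V_B`-module structure of an admissible module. -/
def vModule (W : Type w) [AddCommGroup W] [Module ℂ W] [Module X.UL W] [IsScalarTower ℂ X.UL W]
    [X.IsRestricted W] [X.IsAdmissible W] : X.vertexAlgebra.VModule W where
  Y := (Fld W).subtype ∘ₗ X.YB W
  truncation a x := (X.YB W a).2 x
  vacuum n x := by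
    change (X.YB W X.vac).1 n x = _
    rw [YB_vac, Fld.one_apply]
  jacobi := X.jacobi_YB

theorem vModule_Y (W : Type w) [AddCommGroup W] [Module ℂ W] [Module X.UL W]
    [IsScalarTower ℂ X.UL W] [X.IsRestricted W] [X.IsAdmissible W] (a : X.VB) (n : ℤ) (x : W) :
    (X.vModule W).Y a n x = (X.YB W a).1 n x := rfl

/-! ### Uniqueness of module structures -/

theorem _root_.JacobiIdentity.iterate {V : Type u} {W : Type v} [AddCommGroup V] [Module ℂ V]
    [AddCommGroup W] [Module ℂ W] {Y : V →ₗ[ℂ] (ℤ → Module.End ℂ V)}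
    {YW : V →ₗ[ℂ] (ℤ → Module.End ℂ W)} (h : JacobiIdentity Y YW) (a b : V) (x : W) (l n : ℤ) :
    YW (Y a l b) n x = ∑ᶠ i : ℕ, ((-1) ^ i * Ring.choose l i : ℤ) •
        (YW a (l - i) (YW b (n + i) x)
          - ((Int.negOnePow l : ℤˣ) : ℤ) • YW b (l + n - i) (YW a i x)) := by
  have e := h a b x l 0 n
  rw [finsum_eq_single _ 0 (fun i hi => by
    rw [Ring.choose_zero_pos ℤ (Nat.pos_of_ne_zero hi), zero_smul])] at e
  simpa using e

theorem _root_.JacobiIdentity.commutator {V : Type u} {W : Type v} [AddCommGroup V] [Module ℂ V]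
    [AddCommGroup W] [Module ℂ W] {Y : V →ₗ[ℂ] (ℤ → Module.End ℂ V)}
    {YW : V →ₗ[ℂ] (ℤ → Module.End ℂ W)} (h : JacobiIdentity Y YW) (a b : V) (x : W) (m n : ℤ) :
    YW a m (YW b n x) - YW b n (YW a m x)
      = ∑ᶠ i : ℕ, (Ring.choose m i : ℤ) • YW (Y a i b) (m + n - i) x := by
  have e := h a b x 0 m n
  rw [finsum_eq_single (fun i : ℕ => ((-1) ^ i * Ring.choose 0 i : ℤ) • _) 0 (fun i hi => by
    rw [Ring.choose_zero_pos ℤ (Nat.pos_of_ne_zero hi), mul_zero, zero_smul])] at e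
  simpa using e.symm

/-- The vector `c(l) b` is the `l`-th mode of `c(-1)𝟏` at `b` in both vertex algebras, so the
iterate formula expresses its field through those of `c(-1)𝟏` and `b`. Induction over `V_B` starts
at 𝟏. -/
theorem eq_of_jacobi {𝒱 𝒱' : VertexAlgebra X.VB} (h𝒱 : X.IsAssociated 𝒱)
    (h𝒱' : X.IsAssociated 𝒱') {W : Type w} [AddCommGroup W] [Module ℂ W]
    {Y Y' : X.VB →ₗ[ℂ] (ℤ → Module.End ℂ W)}
    (hY : JacobiIdentity 𝒱.Y Y) (hY' : JacobiIdentity 𝒱'.Y Y')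
    (hvac : Y X.vac = Y' X.vac) (hemb : ∀ c, Y (X.emb c) = Y' (X.emb c)) : Y = Y' := by
  refine LinearMap.ext fun a => ?_
  refine X.VB_eq_top (N := LinearMap.eqLocus Y Y') hvac (fun l c b hb => ?_) a
  rw [LinearMap.mem_eqLocus] at hb ⊢
  funext n
  refine LinearMap.ext fun x => ?_
  rw [← h𝒱.2, hY.iterate, h𝒱.2, ← h𝒱'.2, hY'.iterate, hb, hemb]

theorem eq_vertexAlgebra {𝒱 : VertexAlgebra X.VB} (h : X.IsAssociated 𝒱) :
    𝒱 = X.vertexAlgebra := by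
  refine VertexAlgebra.ext ?_ h.1
  refine X.eq_of_jacobi h X.isAssociated_vertexAlgebra 𝒱.jacobi X.vertexAlgebra.jacobi ?_ ?_
  · funext n
    refine LinearMap.ext fun x => ?_
    have h1 := 𝒱.vacuum n x
    rw [h.1] at h1
    exact h1.trans (X.vertexAlgebra.vacuum n x).symm
  · intro c
    funext n
    refine LinearMap.ext fun x => ?_
    rw [h.2, X.isAssociated_vertexAlgebra.2]

/-! ### The admissible module given by a `V_B`-module -/

section OfVModule

variable {X} {W : Type w} [AddCommGroup W] [Module ℂ W] (𝒲 : X.vertexAlgebra.VModule W)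

/-- The field on `W` given by `a ∈ V_B`. -/
def fldOf : X.VB →ₗ[ℂ] Fld W where
  toFun a := ⟨𝒲.Y a, 𝒲.truncation a⟩
  map_add' a b := by ext n x; simp
  map_smul' r a := by ext n x; simp

theorem fldOf_apply (a : X.VB) (n : ℤ) (x : W) : (fldOf 𝒲 a).1 n x = 𝒲.Y a n x := rfl

theorem fldOf_vac : fldOf 𝒲 X.vac = Fld.one := by
  ext n x
  rw [Fld.one_apply]
  exact 𝒲.vacuum n x

theorem fldOf_mode (n : ℤ) (c : A × B) (b : X.VB) :
    fldOf 𝒲 (X.modeU n c • b) = Fld.nprod n (fldOf 𝒲 (X.emb c)) (fldOf 𝒲 b) := by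
  ext k x
  rw [Fld.nprod_apply, borcherdsSum_eq_finsum (Fld.isTrunc_left _ _ x) (Fld.isTrunc_left _ _ x),
    ← X.isAssociated_vertexAlgebra.2, fldOf_apply, 𝒲.jacobi.iterate]
  simp [fldOf_apply]

variable (X) in
theorem modeU_vac {n : ℤ} (hn : 0 ≤ n) (c : A × B) : X.modeU n c • X.vac = 0 := by
  rw [← toVB_vacL, ← map_smul, modeU_vacL _ hn, map_zero]

variable (X) in
/-- The vector `c(-1)𝟏`, linear in `c`. -/
def embLin : A × B →ₗ[ℂ] X.VB where
  toFun := X.emb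
  map_add' c c' := by rw [emb, map_add, add_smul]; rfl
  map_smul' r c := by rw [emb, map_smul, smul_assoc]; rfl

variable (X) in
theorem modeU_smul_emb (n : ℕ) (c c' : A × B) : X.modeU n c • X.emb c' =
    if n = 0 then X.emb (X.prod0 c c') else if n = 1 then X.emb (X.prod1 c c') else 0 := by
  have e := congrArg (· • X.vac) (X.modeU_comm n (-1) c c')
  simp only [sub_smul, add_smul, mul_smul] at e
  rw [X.modeU_vac (by omega : (0 : ℤ) ≤ n), smul_zero, sub_zero, smul_assoc] at e
  rw [emb, e]
  split_ifs with h0 h1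
  · subst h0
    simp [emb]
  · subst h1
    rw [X.modeU_vac (by norm_num)]
    simp [emb]
  · rw [X.modeU_vac (by omega), X.modeU_vac (by omega), smul_zero, add_zero]

/-- The action of `U(𝓛)` on a `V_B`-module, where `c(n)` acts as the `n`-th mode of `c(-1)𝟏`. -/
def repOfVModule : X.UL →ₐ[ℂ] Module.End ℂ W :=
  X.liftModes (fun n => LinearMap.proj n ∘ₗ 𝒲.Y ∘ₗ X.embLin)
    (fun n a => by
      -- The relation for `∂a` holds already in `V_B`: the vector of `∂a` is `a(-2)𝟏`, and the
      -- product with index `-2` by the identity field is the derivative.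
      have h : X.emb (0, X.d a) = X.modeU (-2) (a, 0) • X.vac := by
        rw [emb, modeU_d]
        norm_num
      have h2 := Fld.nprod_der_left (-1) (fldOf 𝒲 (X.emb (a, 0))) Fld.one
      rw [Fld.nprod_neg_one_id _ Fld.one_apply] at h2
      have h3 : fldOf 𝒲 (X.emb (0, X.d a)) = Fld.der (fldOf 𝒲 (X.emb (a, 0))) := by
        rw [h, fldOf_mode, fldOf_vac, h2]
        norm_num
      refine LinearMap.ext fun x => ?_
      exact congrArg (fun f : Fld W => f.1 n x) h3)
    (fun m n c c' => by
      refine LinearMap.ext fun x => ?_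
      -- In the commutator formula only the products with index `0` and `1` of two generators are
      -- nonzero, which gives the bracket of 𝓛.
      refine (𝒲.jacobi.commutator (X.emb c) (X.emb c') x m n).trans ?_
      simp only [X.isAssociated_vertexAlgebra.2, modeU_smul_emb]
      rw [finsum_eq_sum_range (K := 2)]
      · simp [Finset.sum_range_succ]
        rfl
      · intro i hi
        rw [if_neg (by omega), if_neg (by omega)]
        simp)

theorem repOfVModule_modeU (n : ℤ) (c : A × B) :
    repOfVModule 𝒲 (X.modeU n c) = 𝒲.Y (X.emb c) n :=
  X.liftModes_modeU _ _ _ n c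

/-- A `V_B`-module as an `𝓛`-module. -/
abbrev moduleOfVModule : Module X.UL W := Module.compHom W (repOfVModule 𝒲).toRingHom

theorem isScalarTower_ofVModule :
    letI := moduleOfVModule 𝒲
    IsScalarTower ℂ X.UL W :=
  let := moduleOfVModule 𝒲
  ⟨fun r x w => by
    change repOfVModule 𝒲 (r • x) w = r • repOfVModule 𝒲 x w
    rw [map_smul, LinearMap.smul_apply]⟩

theorem modeU_smul_ofVModule (n : ℤ) (c : A × B) (x : W) :
    letI := moduleOfVModule 𝒲
    X.modeU n c • x = 𝒲.Y (X.emb c) n x := by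
  change repOfVModule 𝒲 (X.modeU n c) x = _
  rw [repOfVModule_modeU]

theorem isRestricted_ofVModule :
    letI := moduleOfVModule 𝒲
    X.IsRestricted W :=
  let := moduleOfVModule 𝒲
  ⟨fun c x => by
    obtain ⟨N, hN⟩ := 𝒲.truncation (X.emb c) x
    exact ⟨N, fun n hn => by rw [modeU_smul_ofVModule, hN n hn]⟩⟩

/-- Both sides take 𝟏 to the identity field and a mode `c(n)` to the `n`-th product by the field of
`c`. As the right side factors through `V_B`, admissibility follows. -/
theorem YL_ofVModule (y : X.VL) :
    letI := moduleOfVModule 𝒲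
    haveI := isScalarTower_ofVModule 𝒲
    haveI := isRestricted_ofVModule 𝒲
    X.YL W y = fldOf 𝒲 (X.toVB y) := by
  let := moduleOfVModule 𝒲
  have := isScalarTower_ofVModule 𝒲
  have := isRestricted_ofVModule 𝒲
  refine X.VL_eq_top (N := LinearMap.eqLocus (X.YL W)
    (fldOf 𝒲 ∘ₗ X.toVB.restrictScalars ℂ)) ?_ ?_ y
  · rw [LinearMap.mem_eqLocus, YL_vacL]
    exact (fldOf_vac 𝒲).symm
  · intro n c y hy
    rw [LinearMap.mem_eqLocus, LinearMap.comp_apply, LinearMap.coe_restrictScalars] at hy ⊢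
    rw [YL_mode, map_smul, fldOf_mode, hy]
    congr 2
    ext k x
    rw [modeFld_apply, modeU_smul_ofVModule, fldOf_apply]

theorem isAdmissible_ofVModule :
    letI := moduleOfVModule 𝒲
    haveI := isScalarTower_ofVModule 𝒲
    haveI := isRestricted_ofVModule 𝒲
    X.IsAdmissible W := by
  let := moduleOfVModule 𝒲
  have := isScalarTower_ofVModule 𝒲
  have := isRestricted_ofVModule 𝒲
  exact ⟨fun y hy => by rw [YL_ofVModule, X.toVB_eq_zero.2 (X.E_subset_IB hy), map_zero]⟩

theorem vModule_ofVModule :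
    letI := moduleOfVModule 𝒲
    haveI := isScalarTower_ofVModule 𝒲
    haveI := isRestricted_ofVModule 𝒲
    haveI := isAdmissible_ofVModule 𝒲
    X.vModule W = 𝒲 := by
  let := moduleOfVModule 𝒲
  have := isScalarTower_ofVModule 𝒲
  have := isRestricted_ofVModule 𝒲
  have := isAdmissible_ofVModule 𝒲
  refine VertexAlgebra.VModule.ext (LinearMap.ext fun a => ?_)
  obtain ⟨a, rfl⟩ := X.toVB_surjective a
  exact congrArg Subtype.val (YL_ofVModule 𝒲 a)

end OfVModule

end VertexAlgebroid

/-! ### Gradings by eigenspaces -/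

section EigenGrading

variable {W : Type*} [AddCommGroup W] [Module ℂ W] {T : Module.End ℂ W}
  {gr : ℕ → Submodule ℂ W}

theorem isInternal_of_le_eigenspace (h : ∀ n : ℕ, gr n ≤ T.eigenspace (n : ℂ))
    (htop : ⨆ n, gr n = ⊤) : DirectSum.IsInternal gr := by
  refine DirectSum.isInternal_submodule_of_iSupIndep_of_iSup_eq_top ?_ htop
  exact (T.eigenspaces_iSupIndep.comp (Nat.cast_injective (R := ℂ))).mono h

theorem intDegree_natCast (gr : ℕ → Submodule ℂ W) (n : ℕ) : intDegree gr (n : ℤ) = gr n := by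
  simp [intDegree]

/-- Subspaces of independent eigenspaces that together span must fill them: apply the modular law
with the sum `K` of the other eigenspaces. Degree claims thus become eigenvalue computations,
negative degrees included. -/
theorem intDegree_eq_eigenspace (h : ∀ n : ℕ, gr n ≤ T.eigenspace (n : ℂ))
    (htop : ⨆ n, gr n = ⊤) (d : ℤ) : intDegree gr d = T.eigenspace (d : ℂ) := by
  have hle : intDegree gr d ≤ T.eigenspace (d : ℂ) := by
    rw [intDegree]
    split_ifs with hd
    · obtain ⟨n, rfl⟩ := Int.eq_ofNat_of_zero_le hd
      exact_mod_cast h n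
    · exact bot_le
  let K : Submodule ℂ W := ⨆ (ν : ℂ) (_ : ν ≠ d), T.eigenspace ν
  have htop' : intDegree gr d ⊔ K = ⊤ := by
    rw [eq_top_iff, ← htop]
    refine iSup_le fun n => ?_
    by_cases hn : (n : ℤ) = d
    · rw [← hn, intDegree_natCast]
      exact le_sup_left
    · refine le_trans ?_ le_sup_right
      refine (h n).trans (le_iSup₂_of_le (n : ℂ) (fun e => hn ?_) le_rfl)
      exact_mod_cast e
  have hdisj : T.eigenspace (d : ℂ) ⊓ K = ⊥ := (T.eigenspaces_iSupIndep (d : ℂ)).eq_bot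
  refine le_antisymm hle ?_
  calc T.eigenspace (d : ℂ) = (intDegree gr d ⊔ K) ⊓ T.eigenspace (d : ℂ) := by
        rw [htop', top_inf_eq]
    _ = intDegree gr d ⊔ K ⊓ T.eigenspace (d : ℂ) := sup_inf_assoc_of_le K hle
    _ ≤ intDegree gr d := by rw [inf_comm, hdisj, sup_bot_eq]

theorem eq_eigenspace (h : ∀ n : ℕ, gr n ≤ T.eigenspace (n : ℂ))
    (htop : ⨆ n, gr n = ⊤) (n : ℕ) : gr n = T.eigenspace (n : ℂ) := by
  rw [← intDegree_natCast gr, intDegree_eq_eigenspace h htop]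
  norm_cast

/-- Applying `T - k` removes the component of eigenvalue `k` and rescales the others by nonzero
factors. -/
theorem mem_of_sum_mem {N : Submodule ℂ W} (hN : ∀ x ∈ N, T x ∈ N) (s : Finset ℕ) :
    ∀ f : ℕ → W, (∀ n : ℕ, f n ∈ T.eigenspace (n : ℂ)) → ∑ n ∈ s, f n ∈ N → ∀ n ∈ s, f n ∈ N := by
  induction s using Finset.induction_on with
  | empty => simp
  | insert k s hk ih =>
    intro f hf hs n hn
    have h1 := N.sub_mem (hN _ hs) (N.smul_mem (k : ℂ) hs)
    rw [Finset.sum_insert hk, map_add, map_sum, smul_add, Finset.smul_sum,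
      Module.End.mem_eigenspace_iff.1 (hf k), add_sub_add_left_eq_sub,
      ← Finset.sum_sub_distrib] at h1
    have h2 : ∀ n ∈ s, f n ∈ N := by
      intro n hn
      have h3 := ih (fun n => T (f n) - (k : ℂ) • f n) (fun n => ?_) h1 n hn
      · simp only [Module.End.mem_eigenspace_iff.1 (hf n), ← sub_smul] at h3
        have h0 : (n : ℂ) - k ≠ 0 := by
          rw [sub_ne_zero]
          exact fun e => hk (Nat.cast_injective (R := ℂ) e ▸ hn)
        exact (N.smul_mem_iff h0).1 h3
      · rw [Module.End.mem_eigenspace_iff.1 (hf n), ← sub_smul]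
        exact Submodule.smul_mem _ _ (hf n)
    rcases Finset.mem_insert.1 hn with rfl | hn
    · rw [Finset.sum_insert hk] at hs
      exact (N.add_mem_iff_left (N.sum_mem h2)).1 hs
    · exact h2 n hn

/-- With `stable_of_eq_iSup_inf`, this identifies graded subspaces with `T`-stable ones. -/
theorem eq_iSup_inf_of_stable (h : ∀ n : ℕ, gr n ≤ T.eigenspace (n : ℂ))
    (htop : ⨆ n, gr n = ⊤) {N : Submodule ℂ W} (hN : ∀ x ∈ N, T x ∈ N) :
    N = ⨆ n, N ⊓ gr n := by
  refine le_antisymm (fun x hx => ?_) (iSup_le fun n => inf_le_left)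
  obtain ⟨f, hf, rfl⟩ := (Submodule.mem_iSup_iff_exists_finsupp gr x).1
    (htop ▸ Submodule.mem_top)
  refine Submodule.sum_mem _ fun n hn => ?_
  exact Submodule.mem_iSup_of_mem n
    ⟨mem_of_sum_mem hN f.support f (fun n : ℕ => h n (hf n)) hx n hn, hf n⟩

theorem stable_of_eq_iSup_inf (h : ∀ n : ℕ, gr n ≤ T.eigenspace (n : ℂ)) {N : Submodule ℂ W}
    (hN : N = ⨆ n, N ⊓ gr n) : ∀ x ∈ N, T x ∈ N := by
  suffices N ≤ N.comap T from this
  conv_lhs => rw [hN]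
  refine iSup_le fun n x hx => ?_
  rw [Submodule.mem_comap, Module.End.mem_eigenspace_iff.1 (h n hx.2)]
  exact N.smul_mem _ hx.1

/-- The operator that acts by `n` on the degree `n` part. -/
theorem exists_degree_operator (h : DirectSum.IsInternal gr) :
    ∃ T : Module.End ℂ W, ∀ n : ℕ, gr n ≤ T.eigenspace (n : ℂ) := by
  let D : (DirectSum ℕ fun n => gr n) →ₗ[ℂ] W :=
    DirectSum.toModule ℂ ℕ W fun n => (n : ℂ) • (gr n).subtype
  let e := LinearEquiv.ofBijective (DirectSum.coeLinearMap gr) h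
  refine ⟨D ∘ₗ e.symm.toLinearMap, fun n x hx => ?_⟩
  rw [Module.End.mem_eigenspace_iff, LinearMap.comp_apply]
  have : e.symm x = DirectSum.lof ℂ ℕ (fun n => gr n) n ⟨x, hx⟩ := by
    rw [LinearEquiv.symm_apply_eq]
    exact (DirectSum.coeLinearMap_lof gr n ⟨x, hx⟩).symm
  rw [LinearEquiv.coe_coe, this, DirectSum.toModule_lof]
  rfl

end EigenGrading

namespace VertexAlgebroid

attribute [local instance 100] LieRing.ofAssociativeRing

variable {A : Type u} {B : Type v} [CommRing A] [Algebra ℂ A] [AddCommGroup B] [Module ℂ B]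
  (X : VertexAlgebroid A B)

/-! ### Euler operators -/

variable (A B) in
/-- The derivation of degree operators: `c(n)` is sent to `(wt n c)(n)`. -/
def wt (n : ℤ) : A × B →ₗ[ℂ] A × B :=
  LinearMap.prodMap ((-n - 1 : ℂ) • LinearMap.id) ((-n : ℂ) • LinearMap.id)

@[simp] theorem wt_apply (n : ℤ) (c : A × B) : wt A B n c = ((-n - 1 : ℂ) • c.1, (-n : ℂ) • c.2) :=
  rfl

/-- The homomorphism `y ↦ y + ε L0U y` to the dual numbers over `U(𝓛)`. -/
def L0hom : X.UL →ₐ[ℂ] TrivSqZeroExt X.UL X.UL :=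
  X.liftModes (R := TrivSqZeroExt X.UL X.UL)
    (fun n =>
      { toFun := fun c => TrivSqZeroExt.inl (X.modeU n c)
          + TrivSqZeroExt.inr (X.modeU n (wt A B n c))
        map_add' := fun c c' => by ext <;> simp only [map_add,
          TrivSqZeroExt.fst_add, TrivSqZeroExt.snd_add, TrivSqZeroExt.fst_inl,
          TrivSqZeroExt.snd_inl, TrivSqZeroExt.fst_inr, TrivSqZeroExt.snd_inr, zero_add, add_zero]
        map_smul' := fun r c => by ext <;> simp only [map_smul, RingHom.id_apply,
          TrivSqZeroExt.fst_smul, TrivSqZeroExt.snd_smul,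
          TrivSqZeroExt.fst_add, TrivSqZeroExt.snd_add, TrivSqZeroExt.fst_inl,
          TrivSqZeroExt.snd_inl, TrivSqZeroExt.fst_inr, TrivSqZeroExt.snd_inr, zero_add, add_zero] })
    (fun n a => by
      ext
      · simp [modeU_d]
      · have h : wt A B n (0, X.d a) = (-n : ℂ) • (0, X.d a) := by ext <;> simp
        have h' : wt A B (n - 1) (a, 0) = (-n : ℂ) • (a, (0 : B)) := by
          ext <;> simp
        rw [TrivSqZeroExt.snd_smul]
        change 0 + X.modeU n (wt A B n (0, X.d a)) =
          (-n : ℤ) • (0 + X.modeU (n - 1) (wt A B (n - 1) (a, 0)))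
        rw [h, h', map_smul, map_smul, modeU_d, zero_add, zero_add, smul_comm])
    (fun m n c c' => by
      ext
      · simpa using X.modeU_comm m n c c'
      · have h1 := X.modeU_comm m n (wt A B m c) c'
        have h2 := X.modeU_comm m n c (wt A B n c')
        have e1 : wt A B (m + n) (X.prod0 c c') =
            X.prod0 (wt A B m c) c' + X.prod0 c (wt A B n c') := by
          ext
          · simp only [wt_apply, prod0_apply, Prod.fst_add, map_smul, LinearMap.smul_apply,
              Derivation.smul_apply, Derivation.map_smul]
            push_cast
            module
          · simp only [wt_apply, prod0_apply, Prod.snd_add, map_smul, LinearMap.smul_apply]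
            push_cast
            module
        have e2 : wt A B (m + n - 1) (X.prod1 c c') =
            X.prod1 (wt A B m c) c' + X.prod1 c (wt A B n c') := by
          ext
          · simp only [wt_apply, prod1_apply, Prod.fst_add, map_smul, LinearMap.smul_apply]
            push_cast
            module
          · simp
        simp only [LinearMap.coe_mk, AddHom.coe_mk, TrivSqZeroExt.snd_add,
          TrivSqZeroExt.snd_sub, TrivSqZeroExt.snd_mul, TrivSqZeroExt.fst_add,
          TrivSqZeroExt.snd_inl, TrivSqZeroExt.snd_inr, TrivSqZeroExt.fst_inl,
          TrivSqZeroExt.fst_inr, smul_eq_mul, MulOpposite.smul_eq_mul_unop,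
          MulOpposite.unop_op, zero_add, add_zero, TrivSqZeroExt.snd_smul, e1, e2, map_add,
          smul_add, smul_zero]
        rw [add_add_add_comm, ← h1, ← h2]
        abel)

/-- The derivation of `U(𝓛)` that acts by `d` on elements of degree `d`. -/
def L0U : X.UL →ₗ[ℂ] X.UL :=
  (TrivSqZeroExt.sndHom X.UL X.UL).restrictScalars ℂ ∘ₗ X.L0hom.toLinearMap

theorem fst_L0hom (x : X.UL) : (X.L0hom x).fst = x := by
  induction x using X.UL_induction with
  | hℂ r => rw [AlgHom.commutes]; rfl
  | hmode n c =>
    rw [L0hom, liftModes_modeU]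
    simp
  | hadd x y hx hy => rw [map_add, TrivSqZeroExt.fst_add, hx, hy]
  | hmul x y hx hy => rw [map_mul, TrivSqZeroExt.fst_mul, hx, hy]

theorem L0U_mul (x y : X.UL) : X.L0U (x * y) = x * X.L0U y + X.L0U x * y := by
  change (X.L0hom (x * y)).snd = _
  rw [map_mul, TrivSqZeroExt.snd_mul, fst_L0hom, fst_L0hom]
  rfl

theorem L0U_algebraMap (r : ℂ) : X.L0U (algebraMap ℂ X.UL r) = 0 := by
  change (X.L0hom _).snd = 0
  rw [AlgHom.commutes]
  rfl

theorem L0U_modeU (n : ℤ) (c : A × B) : X.L0U (X.modeU n c) = X.modeU n (wt A B n c) := by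
  change (X.L0hom _).snd = _
  rw [L0hom, liftModes_modeU]
  simp


theorem mode_mem_homog (n : ℤ) (a : A) : X.mode n (a, 0) ∈ X.homog (-n - 1) :=
  Submodule.mem_sup_left ⟨a, by
    rw [LinearMap.comp_apply, LinearMap.inl_apply, show -(-n - 1) - 1 = n by ring]⟩

theorem mode_mem_homog' (n : ℤ) (b : B) : X.mode n (0, b) ∈ X.homog (-n) :=
  Submodule.mem_sup_right ⟨b, by rw [LinearMap.comp_apply, LinearMap.inr_apply, neg_neg]⟩

theorem homog_le {d : ℤ} {N : Submodule ℂ X.L} (ha : ∀ a, X.mode (-d - 1) (a, 0) ∈ N)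
    (hb : ∀ b, X.mode (-d) (0, b) ∈ N) : X.homog d ≤ N := by
  refine sup_le ?_ ?_
  · rintro _ ⟨a, rfl⟩
    exact ha a
  · rintro _ ⟨b, rfl⟩
    exact hb b

theorem lie_mem_homog {d e : ℤ} {x y : X.L} (hx : x ∈ X.homog d) (hy : y ∈ X.homog e) :
    ⁅x, y⁆ ∈ X.homog (d + e) := by
  have key : ∀ c c' : A × B, ∀ m n : ℤ, X.mode (m + n) ((X.prod0 c c').1, 0) ∈ X.homog (d + e) →
      X.mode (m + n) (0, (X.prod0 c c').2) ∈ X.homog (d + e) →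
      X.mode (m + n - 1) (X.prod1 c c') ∈ X.homog (d + e) →
      ⁅X.mode m c, X.mode n c'⁆ ∈ X.homog (d + e) := by
    intro c c' m n h1 h2 h3
    rw [lie_mode]
    refine add_mem ?_ (zsmul_mem h3 _)
    have := add_mem h1 h2
    rwa [← map_add, Prod.mk_add_mk, zero_add, add_zero] at this
  have hz : ∀ n, X.mode n ((0, 0) : A × B) ∈ X.homog (d + e) := fun n => by
    rw [Prod.mk_zero_zero, map_zero]
    exact zero_mem _
  have hA : ∀ n a, n = -(d + e) - 1 → X.mode n (a, 0) ∈ X.homog (d + e) := by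
    rintro n a rfl
    convert X.mode_mem_homog _ a using 2
    ring
  have hB : ∀ n b, n = -(d + e) → X.mode n (0, b) ∈ X.homog (d + e) := by
    rintro n b rfl
    convert X.mode_mem_homog' _ b using 2
    ring
  have h1 : X.homog d ≤ (X.homog (d + e)).comap
      (X.brL.flip y) := by
    have h2 : ∀ x, X.homog e ≤ (X.homog (d + e)).comap (X.brL x) ↔
      ∀ y ∈ X.homog e, ⁅x, y⁆ ∈ X.homog (d + e) := fun x => Iff.rfl
    refine X.homog_le (fun a => ?_) (fun b => ?_)
    · refine (h2 (X.mode _ _)).1 (X.homog_le (fun a' => ?_) (fun b' => ?_)) y hy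
      · refine key _ _ _ _ ?_ ?_ ?_
        · simpa using hz _
        · simpa using hz _
        · simpa using hz _
      · refine key _ _ _ _ (hA _ _ (by ring)) ?_ ?_
        · simpa using hz _
        · simpa using hz _
    · refine (h2 (X.mode _ _)).1 (X.homog_le (fun a' => ?_) (fun b' => ?_)) y hy
      · refine key _ _ _ _ (hA _ _ (by ring)) ?_ ?_
        · simpa using hz _
        · simpa using hz _
      · refine key _ _ _ _ ?_ (hB _ _ (by ring)) (hA _ _ (by ring))
        simpa using hz _
  exact h1 hx

/-! ### Modules with an Euler operator -/

section Euler

variable {W : Type*} [AddCommGroup W] [Module ℂ W] [Module X.UL W]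

/-- Operators on an `𝓛`-module that satisfy `[T, x] = d x` for `x` of degree `d`. -/
def IsEuler (T : Module.End ℂ W) : Prop :=
  ∀ n c x, T (X.modeU n c • x) = X.modeU n c • T x + X.modeU n (wt A B n c) • x

variable [IsScalarTower ℂ X.UL W] {X} {T : Module.End ℂ W}

theorem IsEuler.smul (hT : X.IsEuler T) (y : X.UL) (x : W) :
    T (y • x) = y • T x + X.L0U y • x := by
  induction y using X.UL_induction generalizing x with
  | hℂ r =>
    rw [L0U_algebraMap, zero_smul, add_zero, algebraMap_smul, algebraMap_smul, map_smul]
  | hmode n c => rw [hT, L0U_modeU]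
  | hadd y z hy hz =>
    rw [add_smul, map_add, hy, hz, map_add, add_smul, add_smul]
    abel
  | hmul y z hy hz =>
    rw [mul_smul, hy, hz, L0U_mul, smul_add, add_smul, mul_smul, mul_smul, mul_smul]
    abel

theorem IsEuler.homog_smul (hT : X.IsEuler T) {d : ℤ} {μ : ℂ} {x : X.L} (hx : x ∈ X.homog d)
    {w : W} (hw : w ∈ T.eigenspace μ) :
    (UniversalEnvelopingAlgebra.ι ℂ x : X.UL) • w ∈ T.eigenspace (d + μ) := by
  let f : X.L →ₗ[ℂ] W := (LinearMap.toSpanSingleton X.UL W w).restrictScalars ℂ ∘ₗ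
    (UniversalEnvelopingAlgebra.ι ℂ : X.L →ₗ⁅ℂ⁆ X.UL).toLinearMap
  have h : X.homog d ≤ (T.eigenspace (d + μ)).comap f := by
    refine X.homog_le (fun a => ?_) (fun b => ?_)
    · change X.modeU (-d - 1) (a, 0) • w ∈ T.eigenspace (d + μ)
      have e : wt A B (-d - 1) (a, 0) = (d : ℂ) • (a, (0 : B)) := by ext <;> simp
      rw [Module.End.mem_eigenspace_iff, hT, e, map_smul, Module.End.mem_eigenspace_iff.1 hw,
        add_smul, smul_assoc, smul_comm, add_comm]
    · change X.modeU (-d) (0, b) • w ∈ T.eigenspace (d + μ)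
      have e : wt A B (-d) (0, b) = (d : ℂ) • ((0 : A), b) := by ext <;> simp
      rw [Module.End.mem_eigenspace_iff, hT, e, map_smul, Module.End.mem_eigenspace_iff.1 hw,
        add_smul, smul_assoc, smul_comm, add_comm]
  exact h hx

theorem IsEuler.ULdeg_smul (hT : X.IsEuler T) {d : ℤ} {μ : ℂ} {y : X.UL} (hy : y ∈ X.ULdeg d)
    {w : W} (hw : w ∈ T.eigenspace μ) : y • w ∈ T.eigenspace (d + μ) := by
  induction hy using Submodule.span_induction with
  | mem y hy =>
    obtain ⟨l, hl, rfl, rfl⟩ := hy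
    induction l with
    | nil => simpa using hw
    | cons p l ih =>
      simp only [List.map_cons, List.prod_cons, List.sum_cons, mul_smul]
      have := hT.homog_smul (hl p (by simp)) (ih fun q hq => hl q (by simp [hq]))
      rw [← add_assoc] at this
      exact_mod_cast this
  | zero => rw [zero_smul]; exact zero_mem _
  | add y z _ _ hy hz => rw [add_smul]; exact add_mem hy hz
  | smul r y _ hy => rw [smul_assoc]; exact Submodule.smul_mem _ _ hy

theorem IsEuler.exists_quotient (hT : X.IsEuler T) {N : Submodule X.UL W}
    (hN : ∀ x ∈ N, T x ∈ N) : ∃ T' : Module.End ℂ (W ⧸ N), X.IsEuler T' ∧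
      ∀ x, T' (N.mkQ x) = N.mkQ (T x) := by
  have h : ∀ x ∈ N.restrictScalars ℂ, (N.mkQ.restrictScalars ℂ ∘ₗ T) x = 0 := fun x hx =>
    (Submodule.Quotient.mk_eq_zero N).2 (hN x hx)
  let T' : Module.End ℂ (W ⧸ N) := (N.restrictScalars ℂ).liftQ (N.mkQ.restrictScalars ℂ ∘ₗ T) h ∘ₗ
    (Submodule.Quotient.restrictScalarsEquiv ℂ N).symm.toLinearMap
  have h' : ∀ x, T' (N.mkQ x) = N.mkQ (T x) := fun x => rfl
  refine ⟨T', fun n c x => ?_, h'⟩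
  obtain ⟨x, rfl⟩ := N.mkQ_surjective x
  rw [← map_smul, h', h', hT, map_add, map_smul, map_smul]

variable (X) in
theorem one_mem_ULdeg : (1 : X.UL) ∈ X.ULdeg 0 :=
  Submodule.subset_span ⟨[], by simp⟩

variable (X) in
theorem ι_mul_mem_ULdeg {d e : ℤ} {x : X.L} (hx : x ∈ X.homog d) {y : X.UL}
    (hy : y ∈ X.ULdeg e) : (UniversalEnvelopingAlgebra.ι ℂ x : X.UL) * y ∈ X.ULdeg (d + e) := by
  induction hy using Submodule.span_induction with
  | mem y hy =>
    obtain ⟨l, hl, rfl, rfl⟩ := hy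
    refine Submodule.subset_span ⟨(d, x) :: l, ?_, by simp, by simp⟩
    intro p hp
    rcases List.mem_cons.1 hp with rfl | hp
    exacts [hx, hl p hp]
  | zero => rw [mul_zero]; exact zero_mem _
  | add y z _ _ hy hz => rw [mul_add]; exact add_mem hy hz
  | smul r y _ hy => rw [mul_smul_comm]; exact Submodule.smul_mem _ _ hy

variable (X) in
theorem smul_mem_of_homog {N : Submodule ℂ W}
    (h : ∀ d, ∀ x ∈ X.homog d, ∀ w ∈ N, (UniversalEnvelopingAlgebra.ι ℂ x : X.UL) • w ∈ N)
    (n : ℤ) (c : A × B) {w : W} (hw : w ∈ N) : X.modeU n c • w ∈ N := by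
  have e : c = (c.1, 0) + (0, c.2) := by simp
  rw [e, map_add, add_smul]
  exact add_mem (h _ _ (X.mode_mem_homog n c.1) w hw) (h _ _ (X.mode_mem_homog' n c.2) w hw)

variable (X) in
/-- A module that is generated by a subspace stable under `𝓛_(≤0)` is generated by it under
`𝓛_(>0)`. -/
theorem eq_top_of_pos {S N : Submodule ℂ W} (hS : Submodule.span X.UL (S : Set W) = ⊤)
    (hle : ∀ d ≤ 0, ∀ x ∈ X.homog d, ∀ w ∈ S, (UniversalEnvelopingAlgebra.ι ℂ x : X.UL) • w ∈ S)
    (hSN : S ≤ N) (hpos : ∀ d, 1 ≤ d → ∀ x ∈ X.homog d, ∀ w ∈ N,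
      (UniversalEnvelopingAlgebra.ι ℂ x : X.UL) • w ∈ N) : N = ⊤ := by
  let Q : Submodule ℂ W → Prop := fun N => S ≤ N ∧ ∀ d, 1 ≤ d → ∀ x ∈ X.homog d, ∀ w ∈ N,
      (UniversalEnvelopingAlgebra.ι ℂ x : X.UL) • w ∈ N
  let K : Submodule ℂ W := sInf {N | Q N}
  have hK : Q K := by
    refine ⟨le_sInf fun N hN => hN.1, fun d hd x hx w hw => ?_⟩
    rw [Submodule.mem_sInf] at hw ⊢
    exact fun N hN => hN.2 d hd x hx w (hw N hN)
  -- `K` is the smallest admissible subspace, and `K'` is the part of it that 𝓛_(≤0) moves into `K`.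
  -- In `x y w = [x, y] w + y x w` the bracket has degree `e + d`, and either sign of this degree is
  -- under control. So `K'` is admissible too and equals `K`, which makes `K` an 𝓛-submodule.
  let K' : Submodule ℂ W :=
    { carrier := {w | w ∈ K ∧ ∀ d ≤ 0, ∀ x ∈ X.homog d,
        (UniversalEnvelopingAlgebra.ι ℂ x : X.UL) • w ∈ K}
      add_mem' := fun {w w'} hw hw' => ⟨K.add_mem hw.1 hw'.1, fun d hd x hx => by
        rw [smul_add]
        exact K.add_mem (hw.2 d hd x hx) (hw'.2 d hd x hx)⟩
      zero_mem' := ⟨K.zero_mem, fun d hd x hx => by rw [smul_zero]; exact K.zero_mem⟩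
      smul_mem' := fun r w hw => ⟨K.smul_mem r hw.1, fun d hd x hx => by
        rw [smul_comm]
        exact K.smul_mem r (hw.2 d hd x hx)⟩ }
  have hK' : Q K' := by
    refine ⟨fun s hs => ⟨hK.1 hs, fun d hd x hx => hK.1 (hle d hd x hx s hs)⟩,
      fun d hd y hy w hw => ⟨hK.2 d hd y hy w hw.1, fun e he x hx => ?_⟩⟩
    have e1 : (UniversalEnvelopingAlgebra.ι ℂ x : X.UL) • (UniversalEnvelopingAlgebra.ι ℂ y : X.UL) • w
        = (UniversalEnvelopingAlgebra.ι ℂ ⁅x, y⁆ : X.UL) • w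
          + (UniversalEnvelopingAlgebra.ι ℂ y : X.UL) • (UniversalEnvelopingAlgebra.ι ℂ x : X.UL) • w := by
      rw [LieHom.map_lie, LieRing.of_associative_ring_bracket, sub_smul, mul_smul, mul_smul]
      abel
    rw [e1]
    refine K.add_mem ?_ (hK.2 d hd y hy _ (hw.2 e he x hx))
    have hxy := X.lie_mem_homog hx hy
    rcases le_or_gt (e + d) 0 with h | h
    · exact hw.2 _ h _ hxy
    · exact hK.2 _ (by omega) _ hxy w hw.1
  have hall : ∀ d, ∀ x ∈ X.homog d, ∀ w ∈ K, (UniversalEnvelopingAlgebra.ι ℂ x : X.UL) • w ∈ K := by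
    intro d x hx w hw
    rcases le_or_gt d 0 with h | h
    · have hKK' : K ≤ K' := sInf_le hK'
      exact (hKK' hw).2 d h x hx
    · exact hK.2 d (by omega) x hx w hw
  have h1 : Submodule.span X.UL (S : Set W) ≤ X.submoduleOfMode K
      (fun n c w hw => X.smul_mem_of_homog hall n c hw) := Submodule.span_le.2 hK.1
  rw [hS] at h1
  have hKN : K ≤ N := sInf_le ⟨hSN, hpos⟩
  exact eq_top_iff.2 fun w _ => hKN (h1 (Submodule.mem_top (x := w)))

/-- Because `S` is stable under 𝓛_(≤0), positive degrees alone generate the module from it. No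
condition on how negative degrees act on the pieces is therefore needed. -/
theorem iSup_span_ULdeg_eq_top {S : Submodule ℂ W} (hS : Submodule.span X.UL (S : Set W) = ⊤)
    (hle : ∀ d ≤ 0, ∀ x ∈ X.homog d, ∀ w ∈ S, (UniversalEnvelopingAlgebra.ι ℂ x : X.UL) • w ∈ S)
    {gr : ℕ → Submodule ℂ W} (h0 : S ≤ gr 0)
    (hgr : ∀ d n : ℕ, ∀ x ∈ X.homog d, ∀ w ∈ gr n,
      (UniversalEnvelopingAlgebra.ι ℂ x : X.UL) • w ∈ gr (d + n)) : ⨆ n, gr n = ⊤ := by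
  refine X.eq_top_of_pos hS hle (h0.trans (le_iSup gr 0)) ?_
  intro d hd x hx w hw
  obtain ⟨d, rfl⟩ := Int.eq_ofNat_of_zero_le (by omega : 0 ≤ d)
  let f : W →ₗ[ℂ] W := DistribSMul.toLinearMap ℂ W (UniversalEnvelopingAlgebra.ι ℂ x : X.UL)
  have : ⨆ n, gr n ≤ (⨆ n, gr n).comap f := iSup_le fun n w hw =>
    Submodule.mem_iSup_of_mem (d + n) (hgr d n x hx w hw)
  exact this hw

/-- Positive degrees raise eigenvalues, so `S` together with the eigenspaces for `1, 2, …` already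
spans the module. Independence then leaves no room in eigenvalue `0` beyond `S`. -/
theorem IsEuler.eigenspace_zero (hT : X.IsEuler T) {S : Submodule ℂ W}
    (hS : Submodule.span X.UL (S : Set W) = ⊤)
    (hle : ∀ d ≤ 0, ∀ x ∈ X.homog d, ∀ w ∈ S, (UniversalEnvelopingAlgebra.ι ℂ x : X.UL) • w ∈ S)
    (h0 : S ≤ T.eigenspace 0) : T.eigenspace 0 = S := by
  let gr : ℕ → Submodule ℂ W := fun n => if n = 0 then S else T.eigenspace (n : ℂ)
  have h : ∀ n : ℕ, gr n ≤ T.eigenspace (n : ℂ) := by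
    intro n
    by_cases hn : n = 0
    · subst hn
      simpa [gr] using h0
    · simp [gr, hn]
  have htop : ⨆ n, gr n = ⊤ := by
    refine iSup_span_ULdeg_eq_top hS hle (by simp [gr]) ?_
    intro d n x hx w hw
    have h1 := hT.homog_smul hx (h n hw)
    by_cases hn : d + n = 0
    · obtain ⟨rfl, rfl⟩ : d = 0 ∧ n = 0 := by omega
      simp only [gr, if_pos, add_zero] at hw ⊢
      exact hle 0 le_rfl x hx w hw
    · simp only [gr, if_neg hn]
      push_cast at h1 ⊢
      exact h1
  simpa [gr] using (eq_eigenspace h htop 0).symm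

end Euler


/-! ### The grading of `V_B` -/

theorem wt_sub_one (n : ℤ) (c : A × B) : wt A B (n - 1) c = wt A B n c + c := by
  ext
  · simp only [wt_apply, Prod.fst_add]
    push_cast
    module
  · simp only [wt_apply, Prod.snd_add]
    push_cast
    module

theorem exists_isEuler_VL : ∃ T : Module.End ℂ X.VL, X.IsEuler T ∧ T X.vacL = 0 := by
  have h0 : X.IsEuler (W := X.UL) X.L0U := fun n c x => by
    rw [smul_eq_mul, L0U_mul, L0U_modeU]
    rfl
  obtain ⟨T, hT, h⟩ := h0.exists_quotient (N := X.vacIdeal) (fun x hx => by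
    induction hx using Submodule.span_induction with
    | mem x hx =>
      obtain ⟨n, c, hn, rfl⟩ := hx
      rw [L0U_modeU]
      exact Submodule.subset_span ⟨n, _, hn, rfl⟩
    | zero => simp
    | add x y _ _ hx hy => rw [map_add]; exact add_mem hx hy
    | smul r x hx h =>
      rw [smul_eq_mul, L0U_mul]
      exact add_mem (X.vacIdeal.smul_mem r h) (X.vacIdeal.smul_mem _ hx))
  refine ⟨T, hT, (h 1).trans ?_⟩
  rw [← map_one (algebraMap ℂ X.UL), L0U_algebraMap, map_zero]
  rfl

theorem IsEuler.DV {T : Module.End ℂ X.VL} (hT : X.IsEuler T) (h0 : T X.vacL = 0) (x : X.VL) :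
    T (X.DV x) = X.DV (T x) + X.DV x := by
  refine X.VL_eq_top (N := LinearMap.eqLocus (T ∘ₗ X.DV) (X.DV ∘ₗ T + X.DV)) ?_ ?_ x
  · simp [LinearMap.mem_eqLocus, DV_vacL, h0]
  · intro n c x hx
    rw [LinearMap.mem_eqLocus, LinearMap.add_apply, LinearMap.comp_apply, LinearMap.comp_apply]
      at hx ⊢
    simp only [DV_modeU, hT n, hT (n - 1), map_add, LinearMap.map_smul T, hx, wt_sub_one,
      add_smul, smul_add]
    abel

/-- The generators of `I_B` are homogeneous, of weight `0` or `1`, and `𝒟` raises weights by `1`. So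
the Euler operator of `V_𝓛` preserves `I_B`. -/
theorem exists_isEuler_VB : ∃ T : Module.End ℂ X.VB, X.IsEuler T ∧ T X.vac = 0 := by
  obtain ⟨T, hT, h0⟩ := X.exists_isEuler_VL
  have hD : ∀ (k : ℕ) (y : X.VL), T ((X.DV ^ k) y) = (X.DV ^ k) (T y) + k • (X.DV ^ k) y := by
    intro k y
    induction k with
    | zero => simp
    | succ k ih =>
      rw [pow_succ', Module.End.mul_apply, hT.DV X h0, ih, map_add, map_nsmul, succ_nsmul,
        Module.End.mul_apply, add_assoc]
  have hA : ∀ a x, T (X.modeU (-1) (a, 0) • x) = X.modeU (-1) (a, 0) • T x := fun a x => by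
    have e : wt A B (-1) (a, 0) = 0 := by ext <;> simp
    rw [hT, e, map_zero, zero_smul, add_zero]
  have hB : ∀ b x, T (X.modeU (-1) (0, b) • x)
      = X.modeU (-1) (0, b) • T x + X.modeU (-1) (0, b) • x := fun b x => by
    have e : wt A B (-1) (0, b) = (0, b) := by ext <;> simp
    rw [hT, e]
  have hE : ∀ y ∈ X.E, T y = 0 ∨ T y = y := by
    rintro y ((rfl | ⟨a, a', rfl⟩) | ⟨a, b, rfl⟩)
    · left
      rw [map_sub, hA, h0, smul_zero, sub_zero]
    · left
      rw [map_sub, hA, hA, hA, h0, smul_zero, smul_zero, smul_zero, sub_zero]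
    · right
      rw [map_sub, hA, hB, hB, h0, smul_zero, smul_zero, zero_add, zero_add]
  obtain ⟨T', hT', h⟩ := hT.exists_quotient (N := X.IB) (fun x hx => by
    induction hx using Submodule.span_induction with
    | mem x hx =>
      obtain ⟨k, y, hy, rfl⟩ := hx
      have hk : (X.DV ^ k) y ∈ X.IB := Submodule.subset_span ⟨k, y, hy, rfl⟩
      rw [hD]
      refine add_mem ?_ (nsmul_mem hk _)
      rcases hE y hy with h | h
      · rw [h, map_zero]
        exact zero_mem _
      · rwa [h]
    | zero => simp
    | add x y _ _ hx hy => rw [map_add]; exact add_mem hx hy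
    | smul r x hx h =>
      rw [hT.smul]
      exact add_mem (X.IB.smul_mem r h) (X.IB.smul_mem _ hx))
  refine ⟨T', hT', (h X.vacL).trans ?_⟩
  rw [h0, map_zero]
  rfl

theorem VB_mode_neg_one_mul (a a' : A) :
    X.modeU (-1) (a, 0) • X.emb (a', 0) = X.emb (a * a', 0) := by
  have h := X.toVB_eq_zero.2 (X.E_subset_IB (Or.inl (Or.inr ⟨a, a', rfl⟩)))
  rw [map_sub, map_smul, map_smul, map_smul, toVB_vacL, sub_eq_zero] at h
  exact h

theorem emb_one : X.emb (1, 0) = X.vac := by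
  have h := X.toVB_eq_zero.2 (X.E_subset_IB (Or.inl (Or.inl rfl)))
  rw [map_sub, map_smul, toVB_vacL, sub_eq_zero] at h
  exact h

theorem VB_span : Submodule.span X.UL {X.vac} = ⊤ := by
  refine eq_top_iff.2 fun x _ => ?_
  obtain ⟨x, rfl⟩ := X.toVB_surjective x
  obtain ⟨x, rfl⟩ := X.toVL_surjective x
  rw [← mul_one x, ← smul_eq_mul, map_smul, map_smul]
  exact Submodule.smul_mem _ _ (Submodule.subset_span rfl)

/-- The generating subspace is the image of `A`, since `a(-1)` has degree `0` and need not preserve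
`ℂ𝟏`. It contains `𝟏 = e`, and the relation `a(-1)a' = aa'` makes it stable under 𝓛_(≤0). -/
theorem iSup_VBdeg : ⨆ n, X.VBdeg n = ⊤ := by
  have hemb : ∀ c, X.embLin c = X.emb c := fun _ => rfl
  refine iSup_span_ULdeg_eq_top (X := X)
    (S := LinearMap.range (X.embLin ∘ₗ LinearMap.inl ℂ A B)) ?_ ?_ ?_ ?_
  · rw [eq_top_iff, ← VB_span, Submodule.span_le, Set.singleton_subset_iff]
    exact Submodule.subset_span ⟨1, X.emb_one⟩
  · rintro d hd x hx _ ⟨a', rfl⟩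
    let f : X.L →ₗ[ℂ] X.VB :=
      (LinearMap.toSpanSingleton X.UL X.VB (X.emb (a', 0))).restrictScalars ℂ ∘ₗ
        (UniversalEnvelopingAlgebra.ι ℂ : X.L →ₗ⁅ℂ⁆ X.UL).toLinearMap
    suffices h : X.homog d ≤ (LinearMap.range (X.embLin ∘ₗ LinearMap.inl ℂ A B)).comap f from h hx
    refine X.homog_le (fun a => ?_) (fun b => ?_)
    · change X.modeU (-d - 1) (a, 0) • X.emb (a', 0) ∈ LinearMap.range (X.embLin ∘ₗ LinearMap.inl ℂ A B)
      rcases hd.eq_or_lt with rfl | hd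
      · rw [neg_zero, zero_sub, VB_mode_neg_one_mul]
        exact ⟨a * a', rfl⟩
      · obtain ⟨n, hn⟩ := Int.eq_ofNat_of_zero_le (by omega : 0 ≤ -d - 1)
        rw [hn]
        erw [modeU_smul_emb]
        have h0 : X.emb (0, 0) = 0 := by rw [← hemb, Prod.mk_zero_zero, map_zero]
        simp [h0]
    · change X.modeU (-d) (0, b) • X.emb (a', 0) ∈ LinearMap.range (X.embLin ∘ₗ LinearMap.inl ℂ A B)
      obtain ⟨n, hn⟩ := Int.eq_ofNat_of_zero_le (by omega : 0 ≤ -d)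
      rw [hn]
      erw [modeU_smul_emb]
      split_ifs
      · exact ⟨X.anchor b a', by simp [hemb]⟩
      · simp [← hemb]
      · exact zero_mem _
  · rintro _ ⟨a, rfl⟩
    have h := X.ι_mul_mem_ULdeg (X.mode_mem_homog (-1) a) X.one_mem_ULdeg
    rw [mul_one] at h
    exact Submodule.subset_span ⟨_, h, rfl⟩
  · intro d n x hx w hw
    induction hw using Submodule.span_induction with
    | mem w hw =>
      obtain ⟨y, hy, rfl⟩ := hw
      rw [← mul_smul]
      exact Submodule.subset_span ⟨_, by simpa using X.ι_mul_mem_ULdeg hx hy, rfl⟩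
    | zero => rw [smul_zero]; exact zero_mem _
    | add y z _ _ hy hz => rw [smul_add]; exact add_mem hy hz
    | smul r y _ hy => rw [smul_comm]; exact Submodule.smul_mem _ _ hy

theorem VBdeg_le_eigenspace {T : Module.End ℂ X.VB} (hT : X.IsEuler T) (h0 : T X.vac = 0)
    (n : ℕ) : X.VBdeg n ≤ T.eigenspace (n : ℂ) := by
  refine Submodule.span_le.2 ?_
  rintro _ ⟨y, hy, rfl⟩
  have h := hT.ULdeg_smul hy (w := X.vac) (μ := 0) (by
    rw [Module.End.mem_eigenspace_iff, h0, zero_smul])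
  simpa using h

section IsNGraded

variable {W : Type w} [AddCommGroup W] [Module ℂ W] [Module X.UL W]
  [IsScalarTower ℂ X.UL W] [X.IsRestricted W] {X}

/-- The weight formula `Y(L₀y)_n = [T, Y(y)_n] + (n+1) Y(y)_n`. It holds for generators and passes
to products because `ad` is a derivation and `Fld.nprod_euler` accounts for the weight of the
product. -/
theorem IsEuler.YL {TV : Module.End ℂ X.VL} (hTV : X.IsEuler TV) (h0 : TV X.vacL = 0)
    {T : Module.End ℂ W} (hT : X.IsEuler T) (y : X.VL) :
    X.YL W (TV y) = Fld.ad T (X.YL W y) + Fld.euler (X.YL W y) := by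
  refine X.VL_eq_top (N := LinearMap.eqLocus (X.YL W ∘ₗ TV)
    (Fld.ad T ∘ₗ X.YL W + Fld.euler ∘ₗ X.YL W)) ?_ ?_ y
  · rw [LinearMap.mem_eqLocus, LinearMap.add_apply, LinearMap.comp_apply, LinearMap.comp_apply,
      LinearMap.comp_apply, h0, YL_vacL, Fld.ad_one, map_zero, zero_add]
    ext n x
    rw [Fld.euler_apply, Fld.one_apply, Fld.zero_apply]
    split_ifs with h
    · simp [h]
    · simp
  · intro n c y hy
    rw [LinearMap.mem_eqLocus, LinearMap.add_apply, LinearMap.comp_apply, LinearMap.comp_apply,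
      LinearMap.comp_apply] at hy ⊢
    have e : (X.modeFld (wt A B n c) : Fld W) = Fld.ad T (X.modeFld c)
        + Fld.euler (X.modeFld c) - (n + 1) • X.modeFld c := by
      ext k x
      rw [Fld.sub_apply, Fld.add_apply, Fld.ad_apply, Fld.euler_apply, Fld.zsmul_apply,
        modeFld_apply, modeFld_apply, modeFld_apply, hT, add_sub_cancel_left]
      -- The index `n` of the product differs from the index `k` of the mode at which fields are
      -- compared; weights at the two differ by `k - n`.
      have e2 : wt A B n c = wt A B k c + ((k - n : ℤ) : ℂ) • c := by
        ext
        · simp only [wt_apply, Prod.fst_add, Prod.smul_fst]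
          push_cast
          module
        · simp only [wt_apply, Prod.snd_add, Prod.smul_snd]
          push_cast
          module
      rw [e2, map_add, LinearMap.map_smul (X.modeU k), add_smul, smul_assoc,
        Int.cast_smul_eq_zsmul, sub_smul, add_smul, add_smul, one_smul]
      abel
    rw [hTV, map_add, YL_mode, YL_mode, YL_mode, hy, Fld.ad_nprod, Fld.nprod_euler, e]
    simp only [map_sub, map_add, map_zsmul, LinearMap.sub_apply, LinearMap.add_apply,
      LinearMap.smul_apply]
    abel

theorem IsEuler.YL_mem {TV : Module.End ℂ X.VL} (hTV : X.IsEuler TV) (h0 : TV X.vacL = 0)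
    {T : Module.End ℂ W} (hT : X.IsEuler T) {k j : ℂ} {a : X.VL} (ha : a ∈ TV.eigenspace k)
    {x : W} (hx : x ∈ T.eigenspace j) (m : ℤ) :
    (X.YL W a).1 m x ∈ T.eigenspace (k + j - m - 1) := by
  have h := congrArg (fun f : Fld W => f.1 m x) (hTV.YL h0 hT a)
  simp only [Module.End.mem_eigenspace_iff.1 ha, map_smul, Fld.smul_apply, Fld.add_apply,
    Fld.ad_apply, Fld.euler_apply, Module.End.mem_eigenspace_iff.1 hx] at h
  rw [← Int.cast_smul_eq_zsmul ℂ] at h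
  rw [Module.End.mem_eigenspace_iff]
  rw [sub_smul, sub_smul, add_smul, h]
  push_cast
  module

/-- Modules that are graded by an Euler operator. -/
theorem IsEuler.isNGraded [X.IsAdmissible W] {T : Module.End ℂ W} (hT : X.IsEuler T)
    {gr : ℕ → Submodule ℂ W}
    (h : ∀ n : ℕ, gr n ≤ T.eigenspace (n : ℂ)) (htop : ⨆ n, gr n = ⊤) :
    (X.vModule W).IsNGraded X.VBdeg gr := by
  obtain ⟨TV, hTV, h0⟩ := X.exists_isEuler_VL
  have hV : ∀ k : ℕ, X.VBdeg k ≤ (TV.eigenspace (k : ℂ)).map (X.toVB.restrictScalars ℂ) := by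
    intro k
    refine Submodule.span_le.2 ?_
    rintro _ ⟨y, hy, rfl⟩
    refine ⟨y • X.vacL, ?_, by simp [toVB_vacL]⟩
    have h := hTV.ULdeg_smul hy (w := X.vacL) (μ := 0) (by
      rw [Module.End.mem_eigenspace_iff, h0, zero_smul])
    simpa using h
  refine ⟨isInternal_of_le_eigenspace h htop, fun k n m a ha x hx => ?_⟩
  rw [intDegree_eq_eigenspace h htop]
  obtain ⟨y, hy, rfl⟩ := hV k ha
  have := hTV.YL_mem h0 hT hy (h n hx) m
  exact_mod_cast this

end IsNGraded

theorem isNGraded_vertexAlgebra : X.vertexAlgebra.IsNGraded X.VBdeg := by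
  obtain ⟨T, hT, h0⟩ := X.exists_isEuler_VB
  have h := hT.isNGraded (X.VBdeg_le_eigenspace hT h0) X.iSup_VBdeg
  refine ⟨h.internal, Submodule.subset_span ⟨1, X.one_mem_ULdeg, ?_⟩, h.mode_mem⟩
  rw [one_smul]
  rfl

end VertexAlgebroid

/-! ### Induced modules of a Lie algebra with a complement

Let `L` be a Lie algebra, `Q` a subalgebra, `pr` a projection onto `Q` whose kernel is a subalgebra,
and `U` a module for the kernel of `pr`. The space `U(Q) ⊗ U` is a module for `L`. -/

namespace LieInduced

attribute [local instance 100] LieRing.ofAssociativeRing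

theorem envelopingAlgebra_induction {k Q : Type*} [CommRing k] [LieRing Q] [LieAlgebra k Q]
    {p : UniversalEnvelopingAlgebra k Q → Prop}
    (hk : ∀ r : k, p (algebraMap k _ r)) (hι : ∀ x, p (UniversalEnvelopingAlgebra.ι k x))
    (hadd : ∀ x y, p x → p y → p (x + y)) (hmul : ∀ x y, p x → p y → p (x * y))
    (x : UniversalEnvelopingAlgebra k Q) : p x := by
  obtain ⟨t, rfl⟩ : ∃ t, UniversalEnvelopingAlgebra.mkAlgHom k Q t = x :=
    RingCon.mk'_surjective _ x
  induction t using TensorAlgebra.induction with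
  | algebraMap r => rw [AlgHom.commutes]; exact hk r
  | ι x => exact hι x
  | mul a b ha hb => rw [map_mul]; exact hmul _ _ ha hb
  | add a b ha hb => rw [map_add]; exact hadd _ _ ha hb

variable {k : Type*} {L : Type*} {U : Type*} [Field k] [LieRing L] [LieAlgebra k L]
  [AddCommGroup U] [Module k U] (Q : LieSubalgebra k L) (pr : L →ₗ[k] Q)
  (θ : L →ₗ[k] Module.End k U)

local notation "ιQ" => UniversalEnvelopingAlgebra.ι (L := Q) k

theorem tensor_eq_top {N : Submodule k (UniversalEnvelopingAlgebra k Q ⊗[k] U)}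
    (h1 : ∀ u : U, 1 ⊗ₜ[k] u ∈ N) (hq : ∀ q : Q, ∀ w ∈ N, ιQ q • w ∈ N)
    (w : UniversalEnvelopingAlgebra k Q ⊗[k] U) : w ∈ N := by
  have hN : ∀ (t : UniversalEnvelopingAlgebra k Q), ∀ w ∈ N, t • w ∈ N := by
    intro t
    induction t using envelopingAlgebra_induction with
    | hk r => intro w hw; rw [algebraMap_smul]; exact N.smul_mem r hw
    | hι q => exact hq q
    | hadd x y hx hy => intro w hw; rw [add_smul]; exact N.add_mem (hx w hw) (hy w hw)
    | hmul x y hx hy => intro w hw; rw [mul_smul]; exact hx _ (hy w hw)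
  induction w using TensorProduct.induction_on with
  | zero => exact N.zero_mem
  | add x y hx hy => exact N.add_mem hx hy
  | tmul t u =>
    have := hN t _ (h1 u)
    rwa [TensorProduct.smul_tmul', smul_eq_mul, mul_one] at this

variable (U) in
/-- The action of `Q` on maps from `L` to `U(Q) ⊗ U`. -/
def homAct : Q →ₗ⁅k⁆ Module.End k (L →ₗ[k] UniversalEnvelopingAlgebra k Q ⊗[k] U) where
  toFun q :=
    { toFun := fun φ =>
        { toFun := fun x => ιQ q • φ x - φ ⁅(q : L), x⁆
          map_add' := fun x y => by simp only [map_add, smul_add, lie_add]; abel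
          map_smul' := fun r x => by
            simp only [map_smul, lie_smul, RingHom.id_apply, smul_sub]
            rw [smul_comm] }
      map_add' := fun φ ψ => by
        ext x
        simp only [LinearMap.add_apply, LinearMap.coe_mk, AddHom.coe_mk, smul_add]
        abel
      map_smul' := fun r φ => by
        ext x
        simp only [LinearMap.smul_apply, LinearMap.coe_mk, AddHom.coe_mk, RingHom.id_apply,
          smul_sub]
        rw [smul_comm] }
  map_add' q q' := by
    refine LinearMap.ext fun φ => LinearMap.ext fun x => ?_
    have h : ((q + q' : Q) : L) = q + q' := rfl
    simp only [LinearMap.add_apply, LinearMap.coe_mk, AddHom.coe_mk, map_add, add_smul, h, add_lie]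
    abel
  map_smul' r q := by
    refine LinearMap.ext fun φ => LinearMap.ext fun x => ?_
    have h : ((r • q : Q) : L) = r • q := rfl
    simp only [LinearMap.smul_apply, LinearMap.coe_mk, AddHom.coe_mk, map_smul, smul_assoc, h,
      smul_lie, RingHom.id_apply, smul_sub]
  map_lie' := by
    intro q q'
    refine LinearMap.ext fun φ => LinearMap.ext fun x => ?_
    simp only [LieRing.of_associative_ring_bracket, LinearMap.sub_apply, Module.End.mul_apply,
      LinearMap.coe_mk, AddHom.coe_mk, LieHom.map_lie, sub_smul, mul_smul, smul_sub,
      LieSubalgebra.coe_bracket, lie_lie, map_sub]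
    abel

theorem homAct_apply (q : Q) (φ : L →ₗ[k] UniversalEnvelopingAlgebra k Q ⊗[k] U) (x : L) :
    homAct U Q q φ x = ιQ q • φ x - φ ⁅(q : L), x⁆ := rfl

/-- The action of `L` on generators. -/
def actGen : U →ₗ[k] L →ₗ[k] UniversalEnvelopingAlgebra k Q ⊗[k] U :=
  LinearMap.mk₂ k (fun u x => 1 ⊗ₜ[k] θ x u + ιQ (pr x) ⊗ₜ[k] u)
    (fun u u' x => by simp only [map_add, TensorProduct.tmul_add]; abel)
    (fun r u x => by simp only [map_smul, TensorProduct.tmul_smul, smul_add])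
    (fun u x y => by
      simp only [map_add, LinearMap.add_apply, TensorProduct.tmul_add, TensorProduct.add_tmul]
      abel)
    (fun r u x => by
      simp only [map_smul, LinearMap.smul_apply, TensorProduct.tmul_smul, smul_add,
        TensorProduct.smul_tmul'])

/-- The action of `L` on `U(Q) ⊗ U`, with the arguments in opposite order. -/
def actFlip : UniversalEnvelopingAlgebra k Q ⊗[k] U →ₗ[k]
    L →ₗ[k] UniversalEnvelopingAlgebra k Q ⊗[k] U :=
  TensorProduct.lift (LinearMap.mk₂ k
    (fun t u => UniversalEnvelopingAlgebra.lift k (homAct U Q) t (actGen Q pr θ u))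
    (fun t t' u => by rw [map_add, LinearMap.add_apply])
    (fun r t u => by rw [map_smul, LinearMap.smul_apply])
    (fun t u u' => by rw [map_add, map_add])
    (fun r t u => by rw [map_smul, map_smul]))

theorem actFlip_one (u : U) (x : L) :
    actFlip Q pr θ (1 ⊗ₜ[k] u) x = 1 ⊗ₜ[k] θ x u + ιQ (pr x) ⊗ₜ[k] u := by
  rw [actFlip, TensorProduct.lift.tmul, LinearMap.mk₂_apply, map_one]
  rfl

/-- The rule `x (q w) = q (x w) - [q, x] w`, required of any `L`-module, is built into the
definition: read as a rule for the map `x ↦ x w`, it is the action `homAct` of `Q`, which extends to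
`U(Q)`. -/
theorem actFlip_smul (q : Q) (w : UniversalEnvelopingAlgebra k Q ⊗[k] U) (x : L) :
    actFlip Q pr θ (ιQ q • w) x = ιQ q • actFlip Q pr θ w x - actFlip Q pr θ w ⁅(q : L), x⁆ := by
  rw [← homAct_apply]
  congr 1
  induction w using TensorProduct.induction_on with
  | zero => simp
  | add x y hx hy => rw [smul_add, map_add, map_add, map_add, hx, hy]
  | tmul t u =>
    rw [TensorProduct.smul_tmul', smul_eq_mul, actFlip, TensorProduct.lift.tmul,
      TensorProduct.lift.tmul, LinearMap.mk₂_apply, LinearMap.mk₂_apply, map_mul,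
      UniversalEnvelopingAlgebra.lift_ι_apply, Module.End.mul_apply]

variable {Q pr θ}

/-- On `1 ⊗ u` this is the definition, and the rule of `actFlip_smul` carries it from `w` to `q' w`.
So `Q` acts by left multiplication. -/
theorem actFlip_coe (hpr : ∀ q : Q, pr q = q) (hθ : ∀ q : Q, θ q = 0) (q : Q)
    (w : UniversalEnvelopingAlgebra k Q ⊗[k] U) : actFlip Q pr θ w q = ιQ q • w := by
  let N : Submodule k (UniversalEnvelopingAlgebra k Q ⊗[k] U) :=
    { carrier := {w | ∀ q : Q, actFlip Q pr θ w q = ιQ q • w}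
      add_mem' := fun {x y} hx hy q => by
        rw [map_add, LinearMap.add_apply, hx, hy, smul_add]
      zero_mem' := fun q => by simp
      smul_mem' := fun r x hx q => by
        rw [map_smul, LinearMap.smul_apply, hx, smul_comm] }
  refine tensor_eq_top Q (N := N) (fun u q => ?_) (fun q' w hw q => ?_) w q
  · rw [actFlip_one, hpr, hθ, LinearMap.zero_apply, TensorProduct.tmul_zero, zero_add,
      TensorProduct.smul_tmul', smul_eq_mul, mul_one]
  · rw [actFlip_smul, hw q, ← LieSubalgebra.coe_bracket, hw, LieHom.map_lie,
      LieRing.of_associative_ring_bracket, sub_smul, mul_smul, mul_smul, sub_sub_cancel]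

/-- If one argument lies in `Q`, the identity is `actFlip_smul`. On `1 ⊗ u`, splitting both
arguments along `pr` leaves only the case of two elements of the kernel, which is the hypothesis on
`θ`. The Jacobi identity in `L` then carries the claim from `w` to `q w`. -/
theorem actFlip_lie (hpr : ∀ q : Q, pr q = q) (hθ : ∀ q : Q, θ q = 0)
    (hker : ∀ x y, pr x = 0 → pr y = 0 → pr ⁅x, y⁆ = 0 ∧ θ ⁅x, y⁆ = ⁅θ x, θ y⁆) (x y : L)
    (w : UniversalEnvelopingAlgebra k Q ⊗[k] U) : actFlip Q pr θ w ⁅x, y⁆ =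
      actFlip Q pr θ (actFlip Q pr θ w y) x - actFlip Q pr θ (actFlip Q pr θ w x) y := by
  have hQ : ∀ (w : UniversalEnvelopingAlgebra k Q ⊗[k] U) (q : Q) (x : L),
      actFlip Q pr θ w ⁅(q : L), x⁆ =
        actFlip Q pr θ (actFlip Q pr θ w x) q - actFlip Q pr θ (actFlip Q pr θ w q) x := by
    intro w q x
    rw [actFlip_coe hpr hθ, actFlip_coe hpr hθ, actFlip_smul, sub_sub_cancel]
  let N : Submodule k (UniversalEnvelopingAlgebra k Q ⊗[k] U) :=
    { carrier := {w | ∀ x y, actFlip Q pr θ w ⁅x, y⁆ =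
      actFlip Q pr θ (actFlip Q pr θ w y) x - actFlip Q pr θ (actFlip Q pr θ w x) y}
      add_mem' := fun {w w'} hw hw' x y => by
        simp only [map_add, LinearMap.add_apply, hw x y, hw' x y]
        abel
      zero_mem' := fun q => by simp
      smul_mem' := fun r w hw x y => by
        simp only [map_smul, LinearMap.smul_apply, hw x y, smul_sub] }
  refine tensor_eq_top Q (N := N) (fun u x y => ?_) (fun q w hw x y => ?_) w x y
  · have hdec : ∀ x, ∃ (x' : L) (q : Q), pr x' = 0 ∧ x = x' + q := fun x =>
      ⟨x - pr x, pr x, by rw [map_sub, hpr, sub_self], (sub_add_cancel _ _).symm⟩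
    obtain ⟨x, q, hx, rfl⟩ := hdec x
    obtain ⟨y, r, hy, rfl⟩ := hdec y
    have h0 : actFlip Q pr θ (1 ⊗ₜ[k] u) ⁅x, y⁆ =
        actFlip Q pr θ (actFlip Q pr θ (1 ⊗ₜ[k] u) y) x
          - actFlip Q pr θ (actFlip Q pr θ (1 ⊗ₜ[k] u) x) y := by
      obtain ⟨h1, h2⟩ := hker x y hx hy
      simp only [actFlip_one, hx, hy, h1, h2, map_zero, TensorProduct.zero_tmul, add_zero,
        LieRing.of_associative_ring_bracket, LinearMap.sub_apply, Module.End.mul_apply,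
        TensorProduct.tmul_sub]
    rw [lie_add, add_lie, add_lie, ← lie_skew x (r : L), map_add, map_add, map_add, map_neg, h0,
      hQ _ q y, hQ _ r x, hQ _ q r]
    simp only [map_add, LinearMap.add_apply]
    abel
  · have h1 : ∀ x, actFlip Q pr θ (ιQ q • w) x =
        ιQ q • actFlip Q pr θ w x - actFlip Q pr θ w ⁅(q : L), x⁆ := actFlip_smul Q pr θ q w
    have h2 : ∀ x y, actFlip Q pr θ (ιQ q • actFlip Q pr θ w x) y =
        ιQ q • actFlip Q pr θ (actFlip Q pr θ w x) y
          - actFlip Q pr θ (actFlip Q pr θ w x) ⁅(q : L), y⁆ := fun x y => actFlip_smul Q pr θ q _ y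
    simp only [h1, map_sub, LinearMap.sub_apply, h2]
    rw [leibniz_lie, map_add, hw x y, hw ⁅(q : L), x⁆ y, hw x ⁅(q : L), y⁆, smul_sub]
    abel

/-- A module for the kernel of `pr` embeds into a module for `L`. -/
theorem exists_module (hpr : ∀ q : Q, pr q = q) (hθ : ∀ q : Q, θ q = 0)
    (hker : ∀ x y, pr x = 0 → pr y = 0 → pr ⁅x, y⁆ = 0 ∧ θ ⁅x, y⁆ = ⁅θ x, θ y⁆) :
    ∃ (ρ : L →ₗ⁅k⁆ Module.End k (UniversalEnvelopingAlgebra k Q ⊗[k] U))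
      (j : U →ₗ[k] UniversalEnvelopingAlgebra k Q ⊗[k] U), Function.Injective j ∧
      ∀ x, pr x = 0 → ∀ u, ρ x (j u) = j (θ x u) := by
  refine ⟨{ (actFlip Q pr θ).flip with
    map_lie' := fun {x y} => LinearMap.ext fun w => actFlip_lie hpr hθ hker x y w },
    TensorProduct.mk k _ U 1, ?_, fun x hx u => ?_⟩
  -- The augmentation of `U(Q)` provides a left inverse of `u ↦ 1 ⊗ u`.
  · let ε : UniversalEnvelopingAlgebra k Q →ₐ[k] k := UniversalEnvelopingAlgebra.lift k 0
    refine Function.LeftInverse.injective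
      (g := (TensorProduct.lid k U).toLinearMap ∘ₗ ε.toLinearMap.rTensor U) fun u => ?_
    simp
  · change actFlip Q pr θ (1 ⊗ₜ[k] u) x = 1 ⊗ₜ[k] θ x u
    rw [actFlip_one, hx, map_zero, TensorProduct.zero_tmul, add_zero]

end LieInduced

namespace VertexAlgebroid

attribute [local instance 100] LieRing.ofAssociativeRing

variable {A : Type u} {B : Type v} [CommRing A] [Algebra ℂ A] [AddCommGroup B] [Module ℂ B]
  (X : VertexAlgebroid A B)

/-! ### The embedding of `U` into `M(U)` -/

/-- The projection of `𝓛` onto the part of positive degree. -/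
def posProj : X.L →ₗ[ℂ] X.L :=
  (LinearMap.range X.dHat).liftQ
    (Finsupp.lsum ℂ fun n : ℤ =>
      LinearMap.coprod (if n ≤ -2 then X.mode n ∘ₗ LinearMap.inl ℂ A B else 0)
        (if n ≤ -1 then X.mode n ∘ₗ LinearMap.inr ℂ A B else 0)) (by
    rintro _ ⟨f, rfl⟩
    rw [LinearMap.mem_ker]
    induction f using Finsupp.induction_linear with
    | zero => simp
    | add f g hf hg => rw [map_add, map_add, hf, hg, add_zero]
    | single n a =>
      rw [dHat_single, map_add, map_smul, Finsupp.lsum_single, Finsupp.lsum_single,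
        LinearMap.coprod_apply, LinearMap.coprod_apply, map_zero, map_zero, zero_add, add_zero]
      by_cases hn : n ≤ -1
      · rw [if_pos hn, if_pos (by omega), LinearMap.comp_apply, LinearMap.comp_apply,
          LinearMap.inr_apply, LinearMap.inl_apply, mode_d, Int.cast_smul_eq_zsmul, neg_smul,
          neg_add_cancel]
      · rw [if_neg hn, if_neg (by omega)]
        simp)

theorem posProj_mode_left (n : ℤ) (a : A) :
    X.posProj (X.mode n (a, 0)) = if n ≤ -2 then X.mode n (a, 0) else 0 := by
  change Finsupp.lsum ℂ _ (Finsupp.single n _) = _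
  rw [Finsupp.lsum_single]
  split_ifs <;> simp [show ((0, 0) : A × B) = 0 from rfl]

theorem posProj_mode_right (n : ℤ) (b : B) :
    X.posProj (X.mode n (0, b)) = if n ≤ -1 then X.mode n (0, b) else 0 := by
  change Finsupp.lsum ℂ _ (Finsupp.single n _) = _
  rw [Finsupp.lsum_single]
  split_ifs <;> simp [show ((0, 0) : A × B) = 0 from rfl]

/-- The sum of the `𝓛_(d)` with `d ∈ s`. -/
def part (s : Set ℤ) : Submodule ℂ X.L := ⨆ d ∈ s, X.homog d

theorem homog_le_part {s : Set ℤ} {d : ℤ} (hd : d ∈ s) : X.homog d ≤ X.part s :=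
  le_iSup₂_of_le d hd le_rfl

theorem lie_mem_of_homog {s t : Set ℤ} {N : Submodule ℂ X.L}
    (h : ∀ d ∈ s, ∀ e ∈ t, ∀ x ∈ X.homog d, ∀ y ∈ X.homog e, ⁅x, y⁆ ∈ N) {x y : X.L}
    (hx : x ∈ X.part s) (hy : y ∈ X.part t) : ⁅x, y⁆ ∈ N := by
  have h1 : X.part s ≤ N.comap (X.brL.flip y) := iSup₂_le fun d hd x hx => by
    have h2 : X.part t ≤ N.comap (X.brL x) := iSup₂_le fun e he y hy => h d hd e he x hx y hy
    exact h2 hy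
  exact h1 hx

theorem posProj_mem (x : X.L) : X.posProj x ∈ X.part (Set.Ici 1) := by
  obtain ⟨f, rfl⟩ := X.rho_surjective x
  induction f using Finsupp.induction_linear with
  | zero => simp
  | add f g hf hg => rw [map_add, map_add]; exact add_mem hf hg
  | single n c =>
    have e : X.rho (Finsupp.single n c) = X.mode n (c.1, 0) + X.mode n (0, c.2) := by
      rw [← map_add]
      simp [mode]
    rw [e, map_add, posProj_mode_left, posProj_mode_right]
    refine add_mem ?_ ?_
    · split_ifs with h
      · exact X.homog_le_part (by rw [Set.mem_Ici]; omega) (X.mode_mem_homog n c.1)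
      · exact zero_mem _
    · split_ifs with h
      · exact X.homog_le_part (by rw [Set.mem_Ici]; omega) (X.mode_mem_homog' n c.2)
      · exact zero_mem _

theorem posProj_of_mem {x : X.L} (hx : x ∈ X.part (Set.Ici 1)) : X.posProj x = x := by
  have h : X.part (Set.Ici 1) ≤ LinearMap.eqLocus X.posProj LinearMap.id := by
    refine iSup₂_le fun d hd => ?_
    rw [Set.mem_Ici] at hd
    refine X.homog_le (fun a => ?_) (fun b => ?_)
    · rw [LinearMap.mem_eqLocus, posProj_mode_left, if_pos (by omega)]
      rfl
    · rw [LinearMap.mem_eqLocus, posProj_mode_right, if_pos (by omega)]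
      rfl
  exact h hx

theorem posProj_eq_zero {x : X.L} : X.posProj x = 0 ↔ x ∈ X.part (Set.Iic 0) := by
  constructor
  · intro hx
    suffices h : ∀ x, x - X.posProj x ∈ X.part (Set.Iic 0) by simpa [hx] using h x
    intro x
    obtain ⟨f, rfl⟩ := X.rho_surjective x
    induction f using Finsupp.induction_linear with
    | zero => simp
    | add f g hf hg => rw [map_add, map_add, add_sub_add_comm]; exact add_mem hf hg
    | single n c =>
      have e : X.rho (Finsupp.single n c) = X.mode n (c.1, 0) + X.mode n (0, c.2) := by
        rw [← map_add]
        simp [mode]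
      rw [e, map_add, add_sub_add_comm, posProj_mode_left, posProj_mode_right]
      refine add_mem ?_ ?_
      · split_ifs with h
        · rw [sub_self]
          exact zero_mem _
        · rw [sub_zero]
          exact X.homog_le_part (by rw [Set.mem_Iic]; omega) (X.mode_mem_homog n c.1)
      · split_ifs with h
        · rw [sub_self]
          exact zero_mem _
        · rw [sub_zero]
          exact X.homog_le_part (by rw [Set.mem_Iic]; omega) (X.mode_mem_homog' n c.2)
  · intro hx
    have h : X.part (Set.Iic 0) ≤ LinearMap.ker X.posProj := by
      refine iSup₂_le fun d hd => ?_
      rw [Set.mem_Iic] at hd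
      refine X.homog_le (fun a => ?_) (fun b => ?_)
      · rw [LinearMap.mem_ker, posProj_mode_left, if_neg (by omega)]
      · rw [LinearMap.mem_ker, posProj_mode_right, if_neg (by omega)]
    exact h hx

/-- The part of `𝓛` of positive degree. -/
def posPart : LieSubalgebra ℂ X.L :=
  { X.part (Set.Ici 1) with
    lie_mem' := fun hx hy => X.lie_mem_of_homog (fun d hd e he x hx y hy =>
      X.homog_le_part (by rw [Set.mem_Ici] at *; omega) (X.lie_mem_homog hx hy)) hx hy }

section Induced

variable (U : LieAlgebroidModule.{u, v, w} A X.G)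

/-- The action of `a ∈ A` on `U`. -/
def aAct : A →ₗ[ℂ] Module.End ℂ U.carrier :=
  (Algebra.lsmul ℂ ℂ U.carrier).toLinearMap

/-- The action of `b ∈ B` on `U`. -/
def bAct : B →ₗ[ℂ] Module.End ℂ U.carrier :=
  (LieModule.toEnd ℂ X.G U.carrier : X.G →ₗ[ℂ] Module.End ℂ U.carrier) ∘ₗ X.toG

theorem aAct_apply (a : A) (x : U.carrier) : X.aAct U a x = a • x := rfl

theorem bAct_apply (b : B) (x : U.carrier) : X.bAct U b x = ⁅X.toG b, x⁆ := rfl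

/-- The action on `U` of the elements of `𝓛` of degree `0`, extended by zero. -/
def zeroAct : X.L →ₗ[ℂ] Module.End ℂ U.carrier :=
  (LinearMap.range X.dHat).liftQ
    (Finsupp.lsum ℂ fun n : ℤ =>
      LinearMap.coprod (if n = -1 then X.aAct U else 0) (if n = 0 then X.bAct U else 0)) (by
    rintro _ ⟨f, rfl⟩
    rw [LinearMap.mem_ker]
    induction f using Finsupp.induction_linear with
    | zero => simp
    | add f g hf hg => rw [map_add, map_add, hf, hg, add_zero]
    | single n a =>
      rw [dHat_single, map_add, map_smul, Finsupp.lsum_single, Finsupp.lsum_single,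
        LinearMap.coprod_apply, LinearMap.coprod_apply, map_zero, map_zero, zero_add, add_zero]
      by_cases hn : n = 0
      · subst hn
        refine LinearMap.ext fun x => ?_
        simp [bAct_apply, X.toG_eq_zero.2 (X.d_mem a)]
      · rw [if_neg hn, if_neg (by omega)]
        simp)

theorem zeroAct_mode_left (n : ℤ) (a : A) :
    X.zeroAct U (X.mode n (a, 0)) = if n = -1 then X.aAct U a else 0 := by
  change Finsupp.lsum ℂ _ (Finsupp.single n _) = _
  rw [Finsupp.lsum_single]
  split_ifs <;> simp

theorem zeroAct_mode_right (n : ℤ) (b : B) :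
    X.zeroAct U (X.mode n (0, b)) = if n = 0 then X.bAct U b else 0 := by
  change Finsupp.lsum ℂ _ (Finsupp.single n _) = _
  rw [Finsupp.lsum_single]
  split_ifs <;> simp

theorem zeroAct_eq_zero {d : ℤ} (hd : d ≠ 0) {x : X.L} (hx : x ∈ X.homog d) :
    X.zeroAct U x = 0 := by
  have h : X.homog d ≤ LinearMap.ker (X.zeroAct U) := by
    refine X.homog_le (fun a => ?_) (fun b => ?_)
    · rw [LinearMap.mem_ker, zeroAct_mode_left, if_neg (by omega)]
    · rw [LinearMap.mem_ker, zeroAct_mode_right, if_neg (by omega)]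
  exact h hx

/-- The degree zero part is spanned by the `a(-1)` and `b(0)`. On these the claim is commutativity
of `A`, the rule `x(au) - a(xu) = (xa)u`, and the Lie module axiom. The bilinear map `F` below
measures the defect. -/
theorem zeroAct_lie_zero {x y : X.L} (hx : x ∈ X.homog 0) (hy : y ∈ X.homog 0) :
    X.zeroAct U ⁅x, y⁆ = ⁅X.zeroAct U x, X.zeroAct U y⁆ := by
  have hAB : ∀ a b, X.zeroAct U ⁅X.mode 0 (0, b), X.mode (-1) (a, 0)⁆ = ⁅X.bAct U b, X.aAct U a⁆ := by
    intro a b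
    have e : (X.prod0 (0, b) (a, 0)) = (X.anchor b a, 0) := by simp
    rw [lie_mode, e, zero_smul, add_zero, zero_add, zeroAct_mode_left, if_pos rfl]
    refine LinearMap.ext fun x => ?_
    rw [LieRing.of_associative_ring_bracket, LinearMap.sub_apply, Module.End.mul_apply,
      Module.End.mul_apply, aAct_apply, bAct_apply, aAct_apply, bAct_apply, aAct_apply,
      U.lie_smul', lie_toG_apply]
  let F : X.L →ₗ[ℂ] X.L →ₗ[ℂ] Module.End ℂ U.carrier :=
    X.brL.compr₂ (X.zeroAct U)
      - (LinearMap.mul ℂ (Module.End ℂ U.carrier)).compl₁₂ (X.zeroAct U) (X.zeroAct U)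
      + ((LinearMap.mul ℂ (Module.End ℂ U.carrier)).compl₁₂ (X.zeroAct U) (X.zeroAct U)).flip
  have hF : ∀ x y, F x y = 0 ↔ X.zeroAct U ⁅x, y⁆ = ⁅X.zeroAct U x, X.zeroAct U y⁆ := by
    intro x y
    rw [LieRing.of_associative_ring_bracket, ← sub_eq_zero (a := X.zeroAct U _), sub_sub_eq_add_sub,
      add_sub_right_comm]
    exact Iff.rfl
  have h1 : X.homog 0 ≤ LinearMap.ker (F.flip y) := by
    have h2 : ∀ x, X.homog 0 ≤ LinearMap.ker (F x) → x ∈ LinearMap.ker (F.flip y) :=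
      fun x h => h hy
    refine X.homog_le (fun a => ?_) (fun b => ?_)
    · refine h2 _ (X.homog_le (fun a' => ?_) (fun b' => ?_))
      · rw [LinearMap.mem_ker, hF, lie_mode, neg_zero, zero_sub]
        have e : X.prod0 (a, 0) (a', 0) = 0 := by simp
        have e' : X.prod1 (a, 0) (a', 0) = 0 := by simp
        rw [e, e', map_zero, map_zero, smul_zero, add_zero, map_zero, zeroAct_mode_left,
          zeroAct_mode_left, if_pos rfl, if_pos rfl]
        refine LinearMap.ext fun x => ?_
        rw [LieRing.of_associative_ring_bracket, LinearMap.sub_apply, Module.End.mul_apply,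
          Module.End.mul_apply, aAct_apply, aAct_apply, aAct_apply, aAct_apply, smul_comm, sub_self]
        rfl
      · rw [LinearMap.mem_ker, hF, neg_zero, zero_sub, ← lie_skew, map_neg, hAB,
          zeroAct_mode_left, zeroAct_mode_right, if_pos rfl, if_pos rfl, lie_skew]
    · refine h2 _ (X.homog_le (fun a' => ?_) (fun b' => ?_))
      · rw [LinearMap.mem_ker, hF, neg_zero, zero_sub, hAB,
          zeroAct_mode_left, zeroAct_mode_right, if_pos rfl, if_pos rfl]
      · rw [LinearMap.mem_ker, hF, lie_mode, neg_zero]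
        have e : X.prod0 (0, b) (0, b') = (0, X.br b b') := by simp
        rw [e, zero_smul, add_zero, add_zero, zeroAct_mode_right, zeroAct_mode_right,
          zeroAct_mode_right, if_pos rfl, if_pos rfl, if_pos rfl]
        refine LinearMap.ext fun x => ?_
        rw [LieRing.of_associative_ring_bracket, LinearMap.sub_apply, Module.End.mul_apply,
          Module.End.mul_apply, bAct_apply, bAct_apply, bAct_apply, bAct_apply, bAct_apply,
          ← lie_toG, lie_lie]
  exact (hF x y).1 (h1 hx)

/-- Within degrees at most `0`, a bracket with a factor of negative degree has negative degree, so
extension by zero respects brackets. -/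
theorem zeroAct_lie {x y : X.L} (hx : X.posProj x = 0) (hy : X.posProj y = 0) :
    X.zeroAct U ⁅x, y⁆ = ⁅X.zeroAct U x, X.zeroAct U y⁆ := by
  rw [posProj_eq_zero] at hx hy
  let N : Submodule ℂ X.L :=
    { carrier := {x | ∀ y ∈ X.part (Set.Iic 0),
        X.zeroAct U ⁅x, y⁆ = ⁅X.zeroAct U x, X.zeroAct U y⁆}
      add_mem' := fun {x x'} hx hx' y hy => by
        rw [add_lie, map_add, map_add, hx y hy, hx' y hy, add_lie]
      zero_mem' := fun y hy => by simp
      smul_mem' := fun r x hx y hy => by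
        rw [smul_lie, map_smul, map_smul, hx y hy, smul_lie] }
  have h1 : X.part (Set.Iic 0) ≤ N := iSup₂_le fun d hd x hx => by
    let N' : Submodule ℂ X.L :=
      { carrier := {y | X.zeroAct U ⁅x, y⁆ = ⁅X.zeroAct U x, X.zeroAct U y⁆}
        add_mem' := fun {y y'} hy hy' => by
          rw [Set.mem_ofPred_eq] at hy hy' ⊢
          rw [lie_add, map_add, map_add, hy, hy', lie_add]
        zero_mem' := by simp
        smul_mem' := fun r y hy => by
          rw [Set.mem_ofPred_eq] at hy ⊢
          rw [lie_smul, map_smul, map_smul, hy, lie_smul] }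
    have h2 : X.part (Set.Iic 0) ≤ N' := iSup₂_le fun e he y hy => by
      rw [Set.mem_Iic] at hd he
      change X.zeroAct U ⁅x, y⁆ = ⁅X.zeroAct U x, X.zeroAct U y⁆
      by_cases hd0 : d = 0
      · by_cases he0 : e = 0
        · subst hd0 he0
          exact X.zeroAct_lie_zero U hx hy
        · rw [X.zeroAct_eq_zero U he0 hy, lie_zero,
            X.zeroAct_eq_zero U (by omega) (X.lie_mem_homog hx hy)]
      · rw [X.zeroAct_eq_zero U hd0 hx, zero_lie,
          X.zeroAct_eq_zero U (by omega) (X.lie_mem_homog hx hy)]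
    exact fun y hy => h2 hy
  exact h1 hx y hy

/-- The module on `U(𝓛_(>0)) ⊗ U` contains `U` with the prescribed action of 𝓛_(≤0). The map into it
from `U(𝓛) ⊗ U` therefore kills the defining relations of `M(U)` and is injective on `1 ⊗ U`. -/
theorem toM_injective : Function.Injective (X.toM U) := by
  obtain ⟨ρ, j, hj, h⟩ := LieInduced.exists_module (Q := X.posPart)
    (pr := X.posProj.codRestrict X.posPart.toSubmodule X.posProj_mem) (θ := X.zeroAct U)
    (fun q => Subtype.ext (X.posProj_of_mem q.2))
    (fun q => by
      have : X.part (Set.Ici 1) ≤ LinearMap.ker (X.zeroAct U) := iSup₂_le fun d hd x hx =>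
        X.zeroAct_eq_zero U (by rw [Set.mem_Ici] at hd; omega) hx
      exact this q.2)
    (fun x y hx hy => by
      have hx' : X.posProj x = 0 := congrArg Subtype.val hx
      have hy' : X.posProj y = 0 := congrArg Subtype.val hy
      refine ⟨Subtype.ext ?_, X.zeroAct_lie U hx' hy'⟩
      change X.posProj ⁅x, y⁆ = 0
      rw [posProj_eq_zero] at hx' hy' ⊢
      exact X.lie_mem_of_homog (fun d hd e he x hx y hy =>
        X.homog_le_part (by rw [Set.mem_Iic] at *; omega) (X.lie_mem_homog hx hy)) hx' hy')
  have hρ : ∀ x, X.posProj x = 0 → ∀ u, ρ x (j u) = j (X.zeroAct U x u) := fun x hx u =>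
    h x (Subtype.ext hx) u
  let Ψ := TensorProduct.lift ((UniversalEnvelopingAlgebra.lift ℂ ρ).toLinearMap.compl₂ j)
  have hΨ : ∀ (y : X.UL) z, Ψ (y • z) = UniversalEnvelopingAlgebra.lift ℂ ρ y (Ψ z) := by
    intro y z
    induction z using TensorProduct.induction_on with
    | zero => simp
    | add z z' hz hz' => rw [smul_add, map_add, map_add, map_add, hz, hz']
    | tmul t u =>
      rw [TensorProduct.smul_tmul', smul_eq_mul]
      simp [Ψ]
  have hΨ1 : ∀ n c u, Ψ (X.modeU n c ⊗ₜ u) = ρ (X.mode n c) (j u) := fun n c u => by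
    change UniversalEnvelopingAlgebra.lift ℂ ρ (UniversalEnvelopingAlgebra.ι ℂ _) (j u) = _
    rw [UniversalEnvelopingAlgebra.lift_ι_apply]
  have hΨ2 : ∀ u, Ψ (1 ⊗ₜ u) = j u := fun u => by simp [Ψ]
  have hker : ∀ z ∈ X.indRel U, Ψ z = 0 := by
    intro z hz
    induction hz using Submodule.span_induction with
    | mem z hz =>
      rcases hz with ⟨n, a, y, hn, rfl⟩ | ⟨n, b, y, hn, rfl⟩
      · rw [map_sub, hΨ1, hΨ2, hρ _ (by rw [posProj_mode_left, if_neg (by omega)]),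
          zeroAct_mode_left]
        by_cases h0 : n = 0
        · rw [if_pos (by omega), if_pos h0, aAct_apply, sub_self]
        · rw [if_neg (by omega), if_neg h0, LinearMap.zero_apply, sub_self]
      · rw [map_sub, hΨ1, hΨ2, hρ _ (by rw [posProj_mode_right, if_neg (by omega)]),
          zeroAct_mode_right]
        by_cases h0 : n = 0
        · rw [if_pos (by omega), if_pos h0, bAct_apply, sub_self]
        · rw [if_neg (by omega), if_neg h0, LinearMap.zero_apply, sub_self]
    | zero => simp
    | add x y _ _ hx hy => rw [map_add, hx, hy, add_zero]
    | smul r x _ hx => rw [hΨ, hx, map_zero]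
  rw [injective_iff_map_eq_zero]
  intro u hu
  have h1 : (1 : X.UL) ⊗ₜ u ∈ X.indRel U := (Submodule.Quotient.mk_eq_zero _).1 hu
  have h2 := hker _ h1
  rw [hΨ2] at h2
  exact (injective_iff_map_eq_zero j).1 hj u h2

end Induced

section Induced

variable (U : LieAlgebroidModule.{u, v, w} A X.G)

/-! ### The module `M(U)` -/

/-- The projection `U(𝓛) ⊗ U → M(U)`. -/
def tensorToM : X.UL ⊗[ℂ] U.carrier →ₗ[X.UL] X.M U := (X.indRel U).mkQ

theorem tensorToM_surjective : Function.Surjective (X.tensorToM U) := (X.indRel U).mkQ_surjective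

theorem tensorToM_eq_zero {x : X.UL ⊗[ℂ] U.carrier} (hx : x ∈ X.indRel U) : X.tensorToM U x = 0 :=
  (Submodule.Quotient.mk_eq_zero _).2 hx

theorem smul_toM (y : X.UL) (u : U.carrier) :
    y • X.toM U u = X.tensorToM U (y ⊗ₜ[ℂ] u) := by
  change y • X.tensorToM U (1 ⊗ₜ[ℂ] u) = _
  rw [← map_smul, TensorProduct.smul_tmul', smul_eq_mul, mul_one]

theorem modeU_left_toM {n : ℤ} (hn : -1 ≤ n) (a : A) (u : U.carrier) :
    X.modeU n (a, 0) • X.toM U u = if n = -1 then X.toM U (a • u) else 0 := by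
  have h : X.modeU (n + 1 - 1) (a, 0) ⊗ₜ[ℂ] u - 1 ⊗ₜ[ℂ] (if n + 1 = 0 then a • u else 0)
      ∈ X.indRel U := Submodule.subset_span (Or.inl ⟨n + 1, a, u, by omega, rfl⟩)
  replace h := X.tensorToM_eq_zero U h
  rw [add_sub_cancel_right, map_sub, ← smul_toM, ← smul_toM, one_smul, sub_eq_zero] at h
  rw [h]
  by_cases h0 : n = -1
  · rw [if_pos (by omega), if_pos h0]
  · rw [if_neg (by omega), if_neg h0, map_zero]

theorem modeU_right_toM {n : ℤ} (hn : 0 ≤ n) (b : B) (u : U.carrier) :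
    X.modeU n (0, b) • X.toM U u = if n = 0 then X.toM U ⁅X.toG b, u⁆ else 0 := by
  have h : X.modeU n (0, b) ⊗ₜ[ℂ] u - 1 ⊗ₜ[ℂ] (if n = 0 then ⁅X.toG b, u⁆ else 0)
      ∈ X.indRel U := Submodule.subset_span (Or.inr ⟨n, b, u, hn, rfl⟩)
  replace h := X.tensorToM_eq_zero U h
  rw [map_sub, ← smul_toM, ← smul_toM, one_smul, sub_eq_zero] at h
  rw [h]
  split_ifs
  · rfl
  · rw [map_zero]

theorem modeU_toM {n : ℤ} (hn : 0 < n) (c : A × B) (u : U.carrier) :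
    X.modeU n c • X.toM U u = 0 := by
  have e : c = (c.1, 0) + (0, c.2) := by simp
  rw [e, map_add, add_smul, modeU_left_toM _ _ (by omega), modeU_right_toM _ _ (by omega),
    if_neg (by omega), if_neg (by omega), add_zero]

theorem M_span : Submodule.span X.UL (LinearMap.range (X.toM U) : Set (X.M U)) = ⊤ := by
  refine Submodule.eq_top_iff'.2 fun x => ?_
  obtain ⟨x, rfl⟩ := X.tensorToM_surjective U x
  induction x using TensorProduct.induction_on with
  | zero => rw [map_zero]; exact zero_mem _
  | add x y hx hy => rw [map_add]; exact add_mem hx hy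
  | tmul y u =>
    rw [← smul_toM]
    exact Submodule.smul_mem _ _ (Submodule.subset_span ⟨u, rfl⟩)

instance : X.IsRestricted (X.M U) := X.isRestricted_of_span (X.M_span U) (by
  rintro _ ⟨u, rfl⟩ c
  exact ⟨1, fun n hn => X.modeU_toM U (by omega) c u⟩)

theorem exists_isEuler_M :
    ∃ T : Module.End ℂ (X.M U), X.IsEuler T ∧ ∀ u, T (X.toM U u) = 0 := by
  let T0 : Module.End ℂ (X.UL ⊗[ℂ] U.carrier) := X.L0U.rTensor U.carrier
  have hT0 : X.IsEuler T0 := by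
    intro n c x
    induction x using TensorProduct.induction_on with
    | zero => simp
    | add x y hx hy =>
      simp only [smul_add, map_add, hx, hy]
      abel
    | tmul y u =>
      simp only [T0, TensorProduct.smul_tmul', smul_eq_mul, LinearMap.rTensor_tmul, L0U_mul,
        L0U_modeU, TensorProduct.add_tmul]
  have hone : X.L0U 1 = 0 := by rw [← map_one (algebraMap ℂ X.UL), L0U_algebraMap]
  obtain ⟨T, hT, h⟩ := hT0.exists_quotient (N := X.indRel U) (fun x hx => by
    induction hx using Submodule.span_induction with
    | mem x hx =>
      rcases hx with ⟨n, a, y, hn, rfl⟩ | ⟨n, b, y, hn, rfl⟩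
      · have e : wt A B (n - 1) (a, 0) = (-n : ℂ) • (a, (0 : B)) := by ext <;> simp
        rw [map_sub]
        simp only [T0, LinearMap.rTensor_tmul, hone, L0U_modeU, e, TensorProduct.zero_tmul,
          sub_zero]
        rw [map_smul, ← TensorProduct.smul_tmul']
        by_cases h0 : n = 0
        · subst h0
          simp
        · refine Submodule.smul_of_tower_mem _ _ (Submodule.subset_span (Or.inl ⟨n, a, y, hn, ?_⟩))
          rw [if_neg h0, TensorProduct.tmul_zero, sub_zero]
      · have e : wt A B n (0, b) = (-n : ℂ) • ((0 : A), b) := by ext <;> simp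
        rw [map_sub]
        simp only [T0, LinearMap.rTensor_tmul, hone, L0U_modeU, e, TensorProduct.zero_tmul,
          sub_zero]
        rw [map_smul, ← TensorProduct.smul_tmul']
        by_cases h0 : n = 0
        · subst h0
          simp
        · refine Submodule.smul_of_tower_mem _ _ (Submodule.subset_span (Or.inr ⟨n, b, y, hn, ?_⟩))
          rw [if_neg h0, TensorProduct.tmul_zero, sub_zero]
    | zero => simp
    | add x y _ _ hx hy => rw [map_add]; exact add_mem hx hy
    | smul r x hx h =>
      rw [hT0.smul]
      exact add_mem ((X.indRel U).smul_mem r h) ((X.indRel U).smul_mem _ hx))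
  refine ⟨T, hT, fun u => (h (1 ⊗ₜ u)).trans ?_⟩
  simp only [T0, LinearMap.rTensor_tmul, hone, TensorProduct.zero_tmul, map_zero]
  rfl

theorem homog_smul_toM {d : ℤ} (hd : d ≤ 0) {x : X.L} (hx : x ∈ X.homog d) {w : X.M U}
    (hw : w ∈ LinearMap.range (X.toM U)) :
    (UniversalEnvelopingAlgebra.ι ℂ x : X.UL) • w ∈ LinearMap.range (X.toM U) := by
  obtain ⟨u, rfl⟩ := hw
  let f : X.L →ₗ[ℂ] X.M U :=
    (LinearMap.toSpanSingleton X.UL (X.M U) (X.toM U u)).restrictScalars ℂ ∘ₗ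
      (UniversalEnvelopingAlgebra.ι ℂ : X.L →ₗ⁅ℂ⁆ X.UL).toLinearMap
  suffices h : X.homog d ≤ (LinearMap.range (X.toM U)).comap f from h hx
  refine X.homog_le (fun a => ?_) (fun b => ?_)
  · change X.modeU (-d - 1) (a, 0) • X.toM U u ∈ LinearMap.range (X.toM U)
    rw [modeU_left_toM _ _ (by omega)]
    split_ifs
    exacts [⟨_, rfl⟩, zero_mem _]
  · change X.modeU (-d) (0, b) • X.toM U u ∈ LinearMap.range (X.toM U)
    rw [modeU_right_toM _ _ (by omega)]
    split_ifs
    exacts [⟨_, rfl⟩, zero_mem _]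

theorem toM_mem_Mdeg (u : U.carrier) : X.toM U u ∈ X.Mdeg U 0 :=
  Submodule.subset_span ⟨1, X.one_mem_ULdeg, u, (one_smul _ _).symm⟩

theorem iSup_Mdeg : ⨆ n, X.Mdeg U n = ⊤ := by
  refine iSup_span_ULdeg_eq_top (X := X) (X.M_span U)
    (fun d hd x hx w hw => X.homog_smul_toM U hd hx hw) ?_ ?_
  · rintro _ ⟨u, rfl⟩
    exact X.toM_mem_Mdeg U u
  · intro d n x hx w hw
    induction hw using Submodule.span_induction with
    | mem w hw =>
      obtain ⟨y, hy, z, rfl⟩ := hw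
      rw [← mul_smul]
      exact Submodule.subset_span ⟨_, by simpa using X.ι_mul_mem_ULdeg hx hy, z, rfl⟩
    | zero => rw [smul_zero]; exact zero_mem _
    | add y z _ _ hy hz => rw [smul_add]; exact add_mem hy hz
    | smul r y _ hy => rw [smul_comm]; exact Submodule.smul_mem _ _ hy

variable {U}

theorem Mdeg_le_eigenspace {T : Module.End ℂ (X.M U)} (hT : X.IsEuler T)
    (h0 : ∀ u, T (X.toM U u) = 0) (n : ℕ) : X.Mdeg U n ≤ T.eigenspace (n : ℂ) := by
  refine Submodule.span_le.2 ?_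
  rintro _ ⟨y, hy, u, rfl⟩
  have h := hT.ULdeg_smul hy (w := X.toM U u) (μ := 0) (by
    rw [Module.End.mem_eigenspace_iff, h0, zero_smul])
  simpa using h

variable (U)

/-- A product in `U(𝓛)` of total degree zero may use factors of both signs, so this is not
immediate; it follows by comparing both sides with the zero eigenspace of an Euler operator. -/
theorem Mdeg_zero : X.Mdeg U 0 = LinearMap.range (X.toM U) := by
  obtain ⟨T, hT, h0⟩ := X.exists_isEuler_M U
  rw [eq_eigenspace (X.Mdeg_le_eigenspace hT h0) (X.iSup_Mdeg U), Nat.cast_zero]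
  refine hT.eigenspace_zero (X.M_span U) (fun d hd x hx w hw => X.homog_smul_toM U hd hx hw) ?_
  rintro _ ⟨u, rfl⟩
  rw [Module.End.mem_eigenspace_iff, h0, zero_smul]

/-- The part of `M(U)` of positive degree. -/
def Mpos : Submodule ℂ (X.M U) := ⨆ n, X.Mdeg U (n + 1)

theorem eigenspace_le_Mpos {T : Module.End ℂ (X.M U)} (hT : X.IsEuler T)
    (h0 : ∀ u, T (X.toM U u) = 0) {d : ℤ} (hd : d ≠ 0) :
    T.eigenspace (d : ℂ) ≤ X.Mpos U := by
  rw [← intDegree_eq_eigenspace (X.Mdeg_le_eigenspace hT h0) (X.iSup_Mdeg U), intDegree]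
  split_ifs with h
  · obtain ⟨n, hn⟩ : ∃ n : ℕ, d.toNat = n + 1 := ⟨d.toNat - 1, by omega⟩
    rw [hn]
    exact le_iSup (fun n => X.Mdeg U (n + 1)) n
  · exact bot_le

theorem Mpos_inf_range : X.Mpos U ⊓ LinearMap.range (X.toM U) = ⊥ := by
  obtain ⟨T, hT, h0⟩ := X.exists_isEuler_M U
  have h := (isInternal_of_le_eigenspace (X.Mdeg_le_eigenspace hT h0)
    (X.iSup_Mdeg U)).submodule_iSupIndep 0
  rw [← Mdeg_zero, inf_comm, ← le_bot_iff, ← h.eq_bot]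
  exact inf_le_inf_left _ (iSup_le fun n => le_iSup₂_of_le (n + 1) (by omega) le_rfl)

theorem Mpos_stable {T : Module.End ℂ (X.M U)} (hT : X.IsEuler T)
    (h0 : ∀ u, T (X.toM U u) = 0) : ∀ x ∈ X.Mpos U, T x ∈ X.Mpos U := by
  suffices X.Mpos U ≤ (X.Mpos U).comap T from this
  refine iSup_le fun n x hx => ?_
  rw [Submodule.mem_comap, Module.End.mem_eigenspace_iff.1 (X.Mdeg_le_eigenspace hT h0 _ hx)]
  exact Submodule.smul_mem _ _ (Submodule.mem_iSup_of_mem n hx)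

theorem homog_smul_Mpos {d : ℤ} (hd : 0 ≤ d) {x : X.L} (hx : x ∈ X.homog d) {w : X.M U}
    (hw : w ∈ X.Mpos U) : (UniversalEnvelopingAlgebra.ι ℂ x : X.UL) • w ∈ X.Mpos U := by
  obtain ⟨T, hT, h0⟩ := X.exists_isEuler_M U
  have : X.Mpos U ≤ (X.Mpos U).comap
      (DistribSMul.toLinearMap ℂ (X.M U) (UniversalEnvelopingAlgebra.ι ℂ x : X.UL)) := by
    refine iSup_le fun n w hw => ?_
    have h := hT.homog_smul hx (X.Mdeg_le_eigenspace hT h0 _ hw)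
    refine X.eigenspace_le_Mpos U hT h0 (d := d + (n + 1 : ℕ)) (by omega) ?_
    exact_mod_cast h
  exact this hw

/-! ### The submodule `J(U)` -/

/-- The vectors with orbit in positive degrees form a graded submodule `K` that meets `U` trivially,
so `K` is one of the summands of `J(U)`. Any other summand has no degree zero part, hence lies in
positive degrees and in `K`. -/
theorem mem_J {w : X.M U} : w ∈ X.J U ↔ ∀ y : X.UL, y • w ∈ X.Mpos U := by
  obtain ⟨T, hT, h0⟩ := X.exists_isEuler_M U
  have hdeg := X.Mdeg_le_eigenspace hT h0
  let K : Submodule X.UL (X.M U) :=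
    { carrier := {w | ∀ y : X.UL, y • w ∈ X.Mpos U}
      add_mem' := fun {w w'} hw hw' y => by rw [smul_add]; exact add_mem (hw y) (hw' y)
      zero_mem' := fun y => by rw [smul_zero]; exact zero_mem _
      smul_mem' := fun z w hw y => by rw [← mul_smul]; exact hw _ }
  have hKpos : ∀ w ∈ K, w ∈ X.Mpos U := fun w hw => by simpa using hw 1
  suffices h : X.J U = K by
    rw [h]
    exact Iff.rfl
  refine le_antisymm (sSup_le ?_) (le_sSup ⟨?_, ?_⟩)
  · rintro N ⟨hN, hN0⟩ w hw y
    have h1 : N.restrictScalars ℂ ≤ X.Mpos U := by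
      rw [hN]
      refine iSup_le fun n => ?_
      rcases n with _ | n
      · rw [Mdeg_zero, hN0]
        exact bot_le
      · exact inf_le_right.trans (le_iSup (fun n => X.Mdeg U (n + 1)) n)
    exact h1 (N.smul_mem y hw)
  · refine eq_iSup_inf_of_stable hdeg (X.iSup_Mdeg U) fun w hw y => ?_
    have e : y • T w = T (y • w) - X.L0U y • w := by rw [hT.smul, add_sub_cancel_right]
    rw [e]
    exact sub_mem (X.Mpos_stable U hT h0 _ (hw y)) (hw _)
  · rw [← le_bot_iff, ← X.Mpos_inf_range U]
    exact inf_le_inf_right _ hKpos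

theorem J_stable {T : Module.End ℂ (X.M U)} (hT : X.IsEuler T)
    (h0 : ∀ u, T (X.toM U u) = 0) : ∀ x ∈ X.J U, T x ∈ X.J U := by
  intro w hw
  rw [mem_J] at hw ⊢
  intro y
  have e : y • T w = T (y • w) - X.L0U y • w := by rw [hT.smul, add_sub_cancel_right]
  rw [e]
  exact sub_mem (X.Mpos_stable U hT h0 _ (hw y)) (hw _)

theorem toM_mem_J {u : U.carrier} (hu : X.toM U u ∈ X.J U) : u = 0 := by
  have h := (X.mem_J U).1 hu 1
  rw [one_smul] at h
  have h2 : X.toM U u ∈ X.Mpos U ⊓ LinearMap.range (X.toM U) := ⟨h, u, rfl⟩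
  rw [Mpos_inf_range, Submodule.mem_bot] at h2
  exact (injective_iff_map_eq_zero _).1 (X.toM_injective U) u h2

end Induced

/-! ### The generators of `I_B` -/

section Generators

/-- The generator `a(-1)a' - aa'`. -/
def relA (a a' : A) : X.VL := X.modeU (-1) (a, 0) • X.modeU (-1) (a', 0) • X.vacL
  - X.modeU (-1) (a * a', 0) • X.vacL

/-- The generator `a(-1)b - ab`. -/
def relB (a : A) (b : B) : X.VL := X.modeU (-1) (a, 0) • X.modeU (-1) (0, b) • X.vacL
  - X.modeU (-1) (0, X.act a b) • X.vacL

theorem relA_mem (a a' : A) : X.relA a a' ∈ Submodule.span ℂ X.E :=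
  Submodule.subset_span (Or.inl (Or.inr ⟨a, a', rfl⟩))

theorem relB_mem (a : A) (b : B) : X.relB a b ∈ Submodule.span ℂ X.E :=
  Submodule.subset_span (Or.inr ⟨a, b, rfl⟩)

variable {W : Type*} [AddCommGroup W] [Module ℂ W] [Module X.UL W] [IsScalarTower ℂ X.UL W]

theorem modeU_comm_smul (m n : ℤ) (c c' : A × B) (x : W) :
    X.modeU m c • X.modeU n c' • x = X.modeU n c' • X.modeU m c • x
      + X.modeU (m + n) (X.prod0 c c') • x + m • X.modeU (m + n - 1) (X.prod1 c c') • x := by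
  have e := congrArg (· • x) (X.modeU_comm m n c c')
  simp only [sub_smul, add_smul, mul_smul] at e
  rw [sub_eq_iff_eq_add] at e
  rw [e, smul_assoc]
  abel

theorem modeU_AA (m n : ℤ) (a a' : A) (x : W) :
    X.modeU m (a, 0) • X.modeU n (a', 0) • x = X.modeU n (a', 0) • X.modeU m (a, 0) • x := by
  have e : X.prod0 (a, 0) (a', (0 : B)) = 0 := by simp
  have e' : X.prod1 (a, 0) (a', (0 : B)) = 0 := by simp
  rw [modeU_comm_smul, e, e', map_zero, map_zero, zero_smul, smul_zero, add_zero, add_zero]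

theorem modeU_BA (m n : ℤ) (b : B) (a : A) (x : W) :
    X.modeU m (0, b) • X.modeU n (a, 0) • x = X.modeU n (a, 0) • X.modeU m (0, b) • x
      + X.modeU (m + n) (X.anchor b a, 0) • x := by
  have e : X.prod0 (0, b) (a, 0) = (X.anchor b a, 0) := by simp
  have e' : X.prod1 (0, b) (a, 0) = 0 := by simp
  rw [modeU_comm_smul, e, e', map_zero, zero_smul, smul_zero, add_zero]

theorem modeU_AB (m n : ℤ) (b : B) (a : A) (x : W) :
    X.modeU m (a, 0) • X.modeU n (0, b) • x = X.modeU n (0, b) • X.modeU m (a, 0) • x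
      - X.modeU (m + n) (X.anchor b a, 0) • x := by
  rw [modeU_BA, add_comm n m, add_sub_cancel_right]

theorem modeU_BB (m n : ℤ) (b b' : B) (x : W) :
    X.modeU m (0, b) • X.modeU n (0, b') • x = X.modeU n (0, b') • X.modeU m (0, b) • x
      + X.modeU (m + n) (0, X.br b b') • x + m • X.modeU (m + n - 1) (X.pair b b', 0) • x := by
  have e : X.prod0 (0, b) (0, b') = (0, X.br b b') := by simp
  rw [modeU_comm_smul, e]
  rfl

/-- The only case with a nonzero result is `a(0)` on `a₁(-1)b - a₁b`. By `π(a₁b) = a₁π(b)` it gives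
a generator of the type `a(-1)a' - aa'` up to sign. -/
theorem modeU_A_E {n : ℤ} (hn : 0 ≤ n) (a : A) {y : X.VL} (hy : y ∈ X.E) :
    X.modeU n (a, 0) • y ∈ Submodule.span ℂ X.E := by
  have h0 : ∀ (m : ℤ) c, 0 ≤ m → X.modeU m c • X.vacL = 0 := fun m c hm => X.modeU_vacL hm c
  rcases hy with (rfl | ⟨a1, a2, rfl⟩) | ⟨a1, b, rfl⟩
  · rw [smul_sub, modeU_AA, h0 n _ hn, smul_zero, sub_zero]
    exact zero_mem _
  · rw [smul_sub, X.modeU_AA n _ _ a1, X.modeU_AA n _ _ a2, X.modeU_AA n, h0 n _ hn, smul_zero,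
      smul_zero, smul_zero, sub_zero]
    exact zero_mem _
  · rw [smul_sub, X.modeU_AA n, X.modeU_AB n, X.modeU_AB n, h0 n _ hn, smul_zero, smul_zero,
      zero_sub, zero_sub]
    rcases hn.eq_or_lt with rfl | hn
    · have e : X.anchor (X.act a1 b) a = a1 * X.anchor b a := by rw [X.anchor_act]; rfl
      rw [zero_add, e, smul_neg, ← neg_add', ← sub_eq_add_neg]
      exact neg_mem (X.relA_mem a1 (X.anchor b a))
    · rw [h0 _ _ (by omega), h0 _ _ (by omega), neg_zero, smul_zero, sub_zero]
      exact zero_mem _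

/-- `b(0)` acts through the Leibniz rules of `π(b)` and `[b, ·]`. `b(1)` matters only on `a₁(-1)b' -
a₁b'`, where the correction `π(b')π(b)(a₁)` from commuting `b'(-1)` with `(π(b)a₁)(0)` is the one in
the axiom for `⟨a₁b', b⟩`. Higher modes give zero. -/
theorem modeU_B_E {n : ℤ} (hn : 0 ≤ n) (b : B) {y : X.VL} (hy : y ∈ X.E) :
    X.modeU n (0, b) • y ∈ Submodule.span ℂ X.E := by
  have h0 : ∀ (m : ℤ) c, 0 ≤ m → X.modeU m c • X.vacL = 0 := fun m c hm => X.modeU_vacL hm c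
  rcases hy with (rfl | ⟨a1, a2, rfl⟩) | ⟨a1, b', rfl⟩
  · have e : X.modeU (n + -1) (X.anchor b 1, 0) = 0 := by
      rw [Derivation.map_one_eq_zero, Prod.mk_zero_zero, map_zero]
    rw [smul_sub, modeU_BA, h0 n _ hn, smul_zero, e, zero_smul, add_zero, sub_zero]
    exact zero_mem _
  · rw [smul_sub, X.modeU_BA n _ _ a1, X.modeU_BA n _ _ a2, X.modeU_BA n, h0 n _ hn, smul_zero, smul_zero,
      zero_add, zero_add]
    rcases hn.eq_or_lt with rfl | hn
    · have e : (X.anchor b (a1 * a2), (0 : B)) =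
          (a1 * X.anchor b a2, 0) + (X.anchor b a1 * a2, 0) := by
        simp [Derivation.leibniz, mul_comm]
      rw [zero_add, e, map_add, add_smul, add_sub_add_comm]
      exact add_mem (X.relA_mem _ _) (X.relA_mem _ _)
    · rw [X.modeU_AA (n + -1), h0 (n + -1) _ (by omega), h0 (n + -1) _ (by omega),
        h0 (n + -1) _ (by omega), smul_zero, smul_zero, add_zero, sub_zero]
      exact zero_mem _
  · rw [smul_sub, X.modeU_BA n, X.modeU_BB n, X.modeU_BB n, h0 n _ hn, smul_zero, smul_zero,
      zero_add, zero_add]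
    rcases hn.eq_or_lt with rfl | hn
    · have e : ((0 : A), X.br b (X.act a1 b')) =
          (0, X.act (X.anchor b a1) b') + (0, X.act a1 (X.br b b')) := by
        simp [X.br_act]
      rw [zero_add, e, map_add, add_smul, zero_smul, zero_smul, add_zero, add_zero, add_comm,
        add_sub_add_comm]
      exact add_mem (X.relB_mem _ _) (X.relB_mem _ _)
    · rw [h0 (n + -1) (0, X.br b b') (by omega), h0 (n + -1) (0, X.br b (X.act a1 b')) (by omega),
        zero_add, zero_add, X.modeU_AB (n + -1), h0 (n + -1) _ (by omega), smul_zero, zero_sub]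
      by_cases h1 : n = 1
      · subst h1
        have e : (X.pair b (X.act a1 b'), (0 : B)) =
            (a1 * X.pair b b', 0) - (X.anchor b' (X.anchor b a1), 0) := by
          rw [X.pair_symm, X.pair_act, X.pair_symm b']
          simp
        have e1 : (1 : ℤ) + -1 + -1 = -1 := by norm_num
        have e2 : (1 : ℤ) + -1 - 1 = -1 := by norm_num
        rw [e1, e2, e, map_sub, sub_smul, one_smul, one_smul]
        have := X.relA_mem a1 (X.pair b b')
        rw [relA] at this
        convert this using 1
        abel
      · rw [h0 (n + -1 - 1) _ (by omega), h0 (n + -1 - 1) _ (by omega),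
          h0 (n + -1 + -1) _ (by omega), smul_zero, smul_zero, neg_zero, add_zero, sub_zero]
        exact zero_mem _

theorem modeU_span_E {n : ℤ} (hn : 0 ≤ n) (c : A × B) {y : X.VL}
    (hy : y ∈ Submodule.span ℂ X.E) : X.modeU n c • y ∈ Submodule.span ℂ X.E := by
  have e : c = (c.1, 0) + (0, c.2) := by simp
  induction hy using Submodule.span_induction with
  | mem y hy =>
    rw [e, map_add, add_smul]
    exact add_mem (X.modeU_A_E hn _ hy) (X.modeU_B_E hn _ hy)
  | zero => rw [smul_zero]; exact zero_mem _
  | add x y _ _ hx hy => rw [smul_add]; exact add_mem hx hy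
  | smul r x _ hx => rw [smul_comm]; exact Submodule.smul_mem _ _ hx

end Generators


/-! ### Commutators of 𝓛 with the fields of `V_𝓛` -/

theorem jacobi_YL {W : Type*} [AddCommGroup W] [Module ℂ W] [Module X.UL W]
    [IsScalarTower ℂ X.UL W] [X.IsRestricted W] :
    JacobiIdentity ((Fld X.VL).subtype ∘ₗ X.YL X.VL) ((Fld W).subtype ∘ₗ X.YL W) := by
  intro a b x l m n
  have h := Fld.borcherds (X.isLocal_YL (W := W) a b) x l m n
  simp only [← YL_YL] at h
  exact h

theorem modeU_YL_comm {W : Type*} [AddCommGroup W] [Module ℂ W] [Module X.UL W]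
    [IsScalarTower ℂ X.UL W] [X.IsRestricted W] (c : A × B) (y : X.VL) (m n : ℤ) (x : W) :
    X.modeU m c • (X.YL W y).1 n x - (X.YL W y).1 n (X.modeU m c • x)
      = ∑ᶠ i : ℕ, (Ring.choose m i : ℤ) • (X.YL W (X.modeU (i : ℤ) c • y)).1 (m + n - i) x := by
  have h := (X.jacobi_YL (W := W)).commutator (X.modeU (-1) c • X.vacL) y x m n
  simp only [LinearMap.comp_apply, YL_emb] at h
  exact h

theorem modeU_YL_comm_mem {W : Type*} [AddCommGroup W] [Module ℂ W] [Module X.UL W]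
    [IsScalarTower ℂ X.UL W] [X.IsRestricted W] {N : Submodule ℂ W} {c : A × B} {y : X.VL} {x : W}
    (h : ∀ (i : ℕ) n, (X.YL W (X.modeU (i : ℤ) c • y)).1 n x ∈ N) (m n : ℤ) :
    X.modeU m c • (X.YL W y).1 n x - (X.YL W y).1 n (X.modeU m c • x) ∈ N := by
  rw [modeU_YL_comm]
  exact finsum_induction (· ∈ N) N.zero_mem (fun _ _ => N.add_mem) fun i => zsmul_mem (h i _) _

/-- In the normally ordered product the right half needs a nonnegative mode of `c` on `x`, and the
left half needs modes of `c'` from `n` on. The hypotheses leave a single term. -/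
theorem YL_neg_one_mode {W : Type*} [AddCommGroup W] [Module ℂ W] [Module X.UL W]
    [IsScalarTower ℂ X.UL W] [X.IsRestricted W] {c c' : A × B} {n : ℤ} {x : W}
    (h : ∀ i, 0 ≤ i → X.modeU i c • x = 0) (h' : ∀ i, n + 1 ≤ i → X.modeU i c' • x = 0) :
    (X.YL W (X.modeU (-1) c • X.modeU (-1) c' • X.vacL)).1 n x
      = X.modeU (-1) c • X.modeU n c' • x := by
  have hr : (Fld.rmul (-1) (X.modeFld c) (X.modeFld c' : Fld W)).1 n x = 0 :=
    Fld.rmul_eq_zero (-1) fun i j hi => by rw [modeFld_apply, modeFld_apply, h i hi, smul_zero]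
  rw [YL_mode, YL_emb, Fld.nprod_eq, Fld.sub_apply, hr, sub_zero, Fld.lmul_apply,
    binomShift_eq_sum (N := n + 1) (K := 1) (fun m n hn => by
      rw [modeFld_apply, modeFld_apply, h' _ hn, smul_zero]) (by simp)]
  simp [modeFld_apply]

section Induced

variable (U : LieAlgebroidModule.{u, v, w} A X.G)

/-! ### The `V_B`-module `L(U)` -/

/-- A vector of weight `k` sends `U` into degree `k - n - 1`, so only the mode `n = k - 1` could
lead back to `U`. There the three types of generators give `eu - u`, `a(a'u) - (aa')u` and `a(bu) -
(ab)u`, all zero in a Lie algebroid module. -/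
theorem YL_E_toM {y : X.VL} (hy : y ∈ X.E) (n : ℤ) (u : U.carrier) :
    (X.YL (X.M U) y).1 n (X.toM U u) ∈ X.Mpos U := by
  obtain ⟨TV, hTV, hV0⟩ := X.exists_isEuler_VL
  obtain ⟨T, hT, h0⟩ := X.exists_isEuler_M U
  have hu : X.toM U u ∈ T.eigenspace 0 := by
    rw [Module.End.mem_eigenspace_iff, h0, zero_smul]
  have key : ∀ (k : ℤ) y, TV y = (k : ℂ) • y →
      (X.YL (X.M U) y).1 (k - 1) (X.toM U u) = 0 →
      (X.YL (X.M U) y).1 n (X.toM U u) ∈ X.Mpos U := by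
    intro k y hk hzero
    have h := hTV.YL_mem hV0 hT (Module.End.mem_eigenspace_iff.2 hk) hu n
    rw [add_zero] at h
    by_cases hn : k - n - 1 = 0
    · rw [show n = k - 1 by omega, hzero]
      exact zero_mem _
    · refine X.eigenspace_le_Mpos U hT h0 hn ?_
      exact_mod_cast h
  have hA : ∀ a x, TV (X.modeU (-1) (a, 0) • x) = X.modeU (-1) (a, 0) • TV x := fun a x => by
    have e : wt A B (-1) (a, 0) = 0 := by ext <;> simp
    rw [hTV, e, map_zero, zero_smul, add_zero]
  have hB : ∀ b x, TV (X.modeU (-1) (0, b) • x)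
      = X.modeU (-1) (0, b) • TV x + X.modeU (-1) (0, b) • x := fun b x => by
    have e : wt A B (-1) (0, b) = (0, b) := by ext <;> simp
    rw [hTV, e]
  have hl : ∀ (a : A) i, 0 ≤ i → X.modeU i (a, 0) • X.toM U u = 0 := fun a i hi => by
    rw [modeU_left_toM _ _ (by omega), if_neg (by omega)]
  rcases hy with (rfl | ⟨a, a', rfl⟩) | ⟨a, b, rfl⟩
  · refine key 0 _ ?_ ?_
    · rw [map_sub, hA, hV0, smul_zero, sub_zero, Int.cast_zero, zero_smul]
    · rw [map_sub, YL_emb, YL_vacL, Fld.sub_apply, modeFld_apply, Fld.one_apply,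
        modeU_left_toM _ _ (by norm_num), if_pos (by norm_num), if_pos (by norm_num), one_smul,
        sub_self]
  · refine key 0 _ ?_ ?_
    · rw [map_sub, hA, hA, hA, hV0, smul_zero, smul_zero, smul_zero, sub_zero, Int.cast_zero,
        zero_smul]
    · rw [map_sub, YL_emb, Fld.sub_apply, modeFld_apply, zero_sub,
        X.YL_neg_one_mode (hl a) (fun i hi => hl a' i (by omega)),
        modeU_left_toM _ _ (by norm_num), if_pos rfl,
        modeU_left_toM _ _ (by norm_num), if_pos rfl,
        modeU_left_toM _ _ (by norm_num), if_pos rfl, mul_smul, sub_self]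
  · refine key 1 _ ?_ ?_
    · rw [map_sub, hA, hB, hB, hV0, smul_zero, smul_zero, zero_add, zero_add, Int.cast_one,
        one_smul]
    · rw [map_sub, YL_emb, Fld.sub_apply, modeFld_apply, sub_self,
        X.YL_neg_one_mode (hl a) (fun i hi => X.modeU_toM U (by omega) _ u),
        modeU_right_toM _ _ le_rfl, if_pos rfl,
        modeU_left_toM _ _ (by norm_num), if_pos rfl,
        modeU_right_toM _ _ le_rfl, if_pos rfl, U.smul_lie', smul_toG, sub_self]

/-- Let `N` be the set of vectors sent into positive degrees by all these fields. It contains `U`.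
It is stable under positive degrees, since commutators with `c(m)` produce fields of `c(i)y` with `i
≥ 0`, again from the span of the generators. Elements of negative degree need not preserve `Mpos`,
and for this reason generation from `U` under 𝓛_(>0) is used. -/
theorem YL_E_Mpos {y : X.VL} (hy : y ∈ Submodule.span ℂ X.E) (n : ℤ) (x : X.M U) :
    (X.YL (X.M U) y).1 n x ∈ X.Mpos U := by
  let N : Submodule ℂ (X.M U) :=
    { carrier := {x | ∀ y ∈ Submodule.span ℂ X.E, ∀ n, (X.YL (X.M U) y).1 n x ∈ X.Mpos U}
      add_mem' := fun {x x'} hx hx' y hy n => by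
        rw [map_add]
        exact add_mem (hx y hy n) (hx' y hy n)
      zero_mem' := fun y hy n => by rw [map_zero]; exact zero_mem _
      smul_mem' := fun r x hx y hy n => by
        rw [map_smul]
        exact Submodule.smul_mem _ _ (hx y hy n) }
  have hN : N = ⊤ := by
    refine X.eq_top_of_pos (X.M_span U) (fun d hd x hx w hw => X.homog_smul_toM U hd hx hw) ?_ ?_
    · rintro _ ⟨u, rfl⟩ y hy n
      induction hy using Submodule.span_induction with
      | mem y hy => exact X.YL_E_toM U hy n u
      | zero => simp
      | add y z _ _ hy hz => rw [map_add, Fld.add_apply]; exact add_mem hy hz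
      | smul r y _ hy => rw [map_smul, Fld.smul_apply]; exact Submodule.smul_mem _ _ hy
    · intro d hd x hx w hw
      have hmode : ∀ m c, X.mode m c ∈ X.homog d → X.modeU m c • w ∈ N := by
        intro m c hc y hy n
        have h1 := X.modeU_YL_comm_mem (N := X.Mpos U) (c := c) (y := y) (x := w)
          (fun i n => hw _ (X.modeU_span_E (Int.natCast_nonneg i) c hy) n) m n
        have h2 : X.modeU m c • (X.YL (X.M U) y).1 n w ∈ X.Mpos U :=
          X.homog_smul_Mpos U (by omega) hc (hw y hy n)
        have := sub_mem h2 h1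
        rwa [sub_sub_cancel] at this
      let f : X.L →ₗ[ℂ] X.M U :=
        (LinearMap.toSpanSingleton X.UL (X.M U) w).restrictScalars ℂ ∘ₗ
          (UniversalEnvelopingAlgebra.ι ℂ : X.L →ₗ⁅ℂ⁆ X.UL).toLinearMap
      suffices h : X.homog d ≤ N.comap f from h hx
      refine X.homog_le (fun a => hmode _ _ ?_) (fun b => hmode _ _ ?_)
      · exact Submodule.mem_sup_left ⟨a, rfl⟩
      · exact Submodule.mem_sup_right ⟨b, rfl⟩
  have hx : x ∈ N := hN ▸ Submodule.mem_top
  exact hx y hy n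

/-- By the same commutator formula, all values of these fields together span an 𝓛-submodule. It lies
in positive degrees, hence in `J(U)`. -/
theorem YL_E_J {y : X.VL} (hy : y ∈ X.E) (n : ℤ) (x : X.M U) :
    (X.YL (X.M U) y).1 n x ∈ X.J U := by
  let Z : Submodule ℂ (X.M U) := Submodule.span ℂ
    {z | ∃ y ∈ Submodule.span ℂ X.E, ∃ n x, z = (X.YL (X.M U) y).1 n x}
  have hZ : ∀ m c, ∀ z ∈ Z, X.modeU m c • z ∈ Z := by
    intro m c z hz
    induction hz using Submodule.span_induction with
    | mem z hz =>
      obtain ⟨y, hy, n, x, rfl⟩ := hz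
      have h1 := X.modeU_YL_comm_mem (N := Z) (c := c) (y := y) (x := x)
        (fun i n => Submodule.subset_span
          ⟨_, X.modeU_span_E (Int.natCast_nonneg i) c hy, n, x, rfl⟩) m n
      have h2 : (X.YL (X.M U) y).1 n (X.modeU m c • x) ∈ Z :=
        Submodule.subset_span ⟨y, hy, n, _, rfl⟩
      have := add_mem h1 h2
      rwa [sub_add_cancel] at this
    | zero => rw [smul_zero]; exact zero_mem _
    | add x y _ _ hx hy => rw [smul_add]; exact add_mem hx hy
    | smul r x _ hx => rw [smul_comm]; exact Submodule.smul_mem _ _ hx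
  have hle : Z ≤ X.Mpos U := by
    refine Submodule.span_le.2 ?_
    rintro _ ⟨y, hy, n, x, rfl⟩
    exact X.YL_E_Mpos U hy n x
  rw [mem_J]
  intro z
  exact hle (X.smul_mem_of_mode hZ z
    (Submodule.subset_span ⟨y, Submodule.subset_span hy, n, x, rfl⟩))

/-- The projection `M(U) → L(U)`. -/
def toLU : X.M U →ₗ[X.UL] X.LU U := (X.J U).mkQ

theorem toLU_surjective : Function.Surjective (X.toLU U) := (X.J U).mkQ_surjective

theorem toLU_eq_zero {x : X.M U} : X.toLU U x = 0 ↔ x ∈ X.J U := Submodule.Quotient.mk_eq_zero _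

instance : X.IsRestricted (X.LU U) where
  trunc c x := by
    obtain ⟨x, rfl⟩ := X.toLU_surjective U x
    obtain ⟨N, hN⟩ := IsRestricted.trunc (X := X) c x
    exact ⟨N, fun n hn => by rw [← map_smul, hN n hn, map_zero]⟩

instance : X.IsAdmissible (X.LU U) where
  YL_E y hy := by
    ext n x
    obtain ⟨x, rfl⟩ := X.toLU_surjective U x
    have h := X.YL_map ((X.toLU U).restrictScalars ℂ) (fun _ _ _ => (X.toLU U).map_smul _ _) y n x
    exact h.symm.trans ((X.toLU_eq_zero U).2 (X.YL_E_J U hy n x))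

theorem exists_isEuler_LU : ∃ T : Module.End ℂ (X.LU U), X.IsEuler T ∧
    ∀ n : ℕ, X.LUdeg U n ≤ T.eigenspace (n : ℂ) := by
  obtain ⟨T, hT, h0⟩ := X.exists_isEuler_M U
  obtain ⟨T', hT', h⟩ := hT.exists_quotient (X.J_stable U hT h0)
  refine ⟨T', hT', ?_⟩
  rintro n _ ⟨x, hx, rfl⟩
  refine Module.End.mem_eigenspace_iff.2 ((h x).trans ?_)
  rw [Module.End.mem_eigenspace_iff.1 (X.Mdeg_le_eigenspace hT h0 n hx)]
  exact map_smul ((X.J U).mkQ.restrictScalars ℂ) _ _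

theorem iSup_LUdeg : ⨆ n, X.LUdeg U n = ⊤ := by
  have h : ⨆ n, X.LUdeg U n =
      (⨆ n, X.Mdeg U n).map ((X.J U).mkQ.restrictScalars ℂ : X.M U →ₗ[ℂ] X.LU U) :=
    (Submodule.map_iSup _ _).symm
  rw [h, iSup_Mdeg]
  refine Submodule.eq_top_iff'.2 fun x => ?_
  obtain ⟨x, rfl⟩ := X.toLU_surjective U x
  exact ⟨x, trivial, rfl⟩

theorem isNGraded_LU : (X.vModule (X.LU U)).IsNGraded X.VBdeg (X.LUdeg U) := by
  obtain ⟨T, hT, h⟩ := X.exists_isEuler_LU U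
  exact hT.isNGraded h (X.iSup_LUdeg U)

theorem isAssociatedModule_LU : X.IsAssociatedModule U (X.vModule (X.LU U)) := fun c n x => by
  rw [vModule_Y, YB_emb, modeFld_apply]

theorem eq_vModule_LU {𝒲 : X.vertexAlgebra.VModule (X.LU U)} (h : X.IsAssociatedModule U 𝒲) :
    𝒲 = X.vModule (X.LU U) := by
  refine VertexAlgebra.VModule.ext ?_
  refine X.eq_of_jacobi X.isAssociated_vertexAlgebra X.isAssociated_vertexAlgebra 𝒲.jacobi
    (X.vModule (X.LU U)).jacobi ?_ ?_
  · funext n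
    refine LinearMap.ext fun x => ?_
    exact (𝒲.vacuum n x).trans ((X.vModule (X.LU U)).vacuum n x).symm
  · intro c
    funext n
    refine LinearMap.ext fun x => ?_
    rw [h, X.isAssociatedModule_LU U]

end Induced

/-! ### Graded modules and their degree zero part -/

section Graded

variable {W : Type w} [AddCommGroup W] [Module ℂ W] [Module X.UL W] [IsScalarTower ℂ X.UL W]

/-- `T` is an Euler operator on the module `W = ⨁ gr n` and acts by `n` on `gr n`. -/
structure IsDegree (T : Module.End ℂ W) (gr : ℕ → Submodule ℂ W) : Prop where
  euler : X.IsEuler T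
  le : ∀ n : ℕ, gr n ≤ T.eigenspace (n : ℂ)
  iSup : ⨆ n, gr n = ⊤

variable {X} {T : Module.End ℂ W} {gr : ℕ → Submodule ℂ W}

theorem IsDegree.zero (h : X.IsDegree T gr) : gr 0 = T.eigenspace 0 := by
  rw [eq_eigenspace h.le h.iSup, Nat.cast_zero]

theorem IsDegree.homog_smul (h : X.IsDegree T gr) {d : ℤ} {x : X.L} (hx : x ∈ X.homog d) {s : W}
    (hs : s ∈ gr 0) : (UniversalEnvelopingAlgebra.ι ℂ x : X.UL) • s ∈ intDegree gr d := by
  rw [intDegree_eq_eigenspace h.le h.iSup]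
  rw [h.zero] at hs
  simpa using h.euler.homog_smul hx hs

theorem IsDegree.modeU_left (h : X.IsDegree T gr) {s : W} (hs : s ∈ gr 0) (a : A) {n : ℤ}
    (hn : 0 ≤ n) : X.modeU n (a, 0) • s = 0 := by
  have h1 := h.homog_smul (X.mode_mem_homog n a) hs
  rw [intDegree, if_neg (by omega), Submodule.mem_bot] at h1
  exact h1

theorem IsDegree.modeU_right (h : X.IsDegree T gr) {s : W} (hs : s ∈ gr 0) (b : B) {n : ℤ}
    (hn : 0 < n) : X.modeU n (0, b) • s = 0 := by
  have h1 := h.homog_smul (X.mode_mem_homog' n b) hs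
  rw [intDegree, if_neg (by omega), Submodule.mem_bot] at h1
  exact h1

theorem IsDegree.modeU_left_mem (h : X.IsDegree T gr) {s : W} (hs : s ∈ gr 0) (a : A) :
    X.modeU (-1) (a, 0) • s ∈ gr 0 := by
  have h1 := h.homog_smul (X.mode_mem_homog (-1) a) hs
  rw [show (- -1 - 1 : ℤ) = 0 by norm_num] at h1
  exact h1

theorem IsDegree.modeU_right_mem (h : X.IsDegree T gr) {s : W} (hs : s ∈ gr 0) (b : B) :
    X.modeU 0 (0, b) • s ∈ gr 0 :=
  h.homog_smul (X.mode_mem_homog' 0 b) hs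

theorem IsDegree.homog_smul_mem (h : X.IsDegree T gr) {S : Submodule ℂ W} (hS : S ≤ gr 0)
    (hA : ∀ a, ∀ s ∈ S, X.modeU (-1) (a, 0) • s ∈ S)
    (hB : ∀ b, ∀ s ∈ S, X.modeU 0 (0, b) • s ∈ S) (d : ℤ) (hd : d ≤ 0) :
    ∀ x ∈ X.homog d, ∀ s ∈ S, (UniversalEnvelopingAlgebra.ι ℂ x : X.UL) • s ∈ S := by
  intro x hx s hs
  let f : X.L →ₗ[ℂ] W :=
    (LinearMap.toSpanSingleton X.UL W s).restrictScalars ℂ ∘ₗ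
      (UniversalEnvelopingAlgebra.ι ℂ : X.L →ₗ⁅ℂ⁆ X.UL).toLinearMap
  suffices h : X.homog d ≤ S.comap f from h hx
  refine X.homog_le (fun a => ?_) (fun b => ?_)
  · change X.modeU (-d - 1) (a, 0) • s ∈ S
    rcases hd.eq_or_lt with rfl | hd
    · exact hA a s hs
    · rw [h.modeU_left (hS hs) a (by omega)]
      exact zero_mem _
  · change X.modeU (-d) (0, b) • s ∈ S
    rcases hd.eq_or_lt with rfl | hd
    · exact hB b s hs
    · rw [h.modeU_right (hS hs) b (by omega)]
      exact zero_mem _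

/-- A submodule generated in degree zero is graded, because `T` kills the generators. -/
theorem IsDegree.stable_span (h : X.IsDegree T gr) {S : Set W} (hS : S ⊆ gr 0) :
    ∀ x ∈ Submodule.span X.UL S, T x ∈ Submodule.span X.UL S := by
  intro x hx
  induction hx using Submodule.span_induction with
  | mem x hx =>
    have hs : x ∈ T.eigenspace 0 := h.zero ▸ hS hx
    rw [Module.End.mem_eigenspace_iff, zero_smul] at hs
    rw [hs]
    exact zero_mem _
  | zero => simp
  | add x y _ _ hx hy => rw [map_add]; exact add_mem hx hy
  | smul r x hx hx' =>
    rw [h.euler.smul]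
    exact add_mem (Submodule.smul_mem _ _ hx') (Submodule.smul_mem _ _ hx)

theorem IsEuler.map_comm {W' : Type*} [AddCommGroup W'] [Module ℂ W'] [Module X.UL W']
    [IsScalarTower ℂ X.UL W'] {T' : Module.End ℂ W'} (hT : X.IsEuler T) (hT' : X.IsEuler T')
    (F : W →ₗ[X.UL] W') {S : Set W} (hS : Submodule.span X.UL S = ⊤)
    (h : ∀ x ∈ S, F (T x) = T' (F x)) (x : W) : F (T x) = T' (F x) := by
  have hx : x ∈ Submodule.span X.UL S := hS ▸ Submodule.mem_top
  induction hx using Submodule.span_induction with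
  | mem x hx => exact h x hx
  | zero => simp
  | add x y _ _ hx hy => rw [map_add, map_add, map_add, map_add, hx, hy]
  | smul r x _ hx =>
    rw [hT.smul, map_add, map_smul, map_smul, map_smul, hT'.smul, hx]

theorem IsDegree.apply_eq_zero (h : X.IsDegree T gr) {s : W} (hs : s ∈ gr 0) : T s = 0 := by
  rwa [h.zero, Module.End.mem_eigenspace_iff, zero_smul] at hs

/-! ### The degree zero part as a module for the Lie algebroid -/

section Top

variable [X.IsRestricted W] [X.IsAdmissible W]

variable (X) in
theorem modeU_one_smul (s : W) : X.modeU (-1) (1, 0) • s = s := by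
  have e := IsAdmissible.YL_E (X := X) (W := W) _ (Or.inl (Or.inl rfl))
  have e2 := congrArg (fun f : Fld W => f.1 (-1) s) e
  simp only [map_sub, YL_emb, YL_vacL, Fld.sub_apply, modeFld_apply, Fld.one_apply, if_pos,
    Fld.zero_apply, sub_eq_zero] at e2
  exact e2

/-- The vanishing of the field of a generator of `I_B`, read off at the mode that preserves degree
zero, where the normally ordered product is a plain composition. -/
theorem IsDegree.modeU_mul (h : X.IsDegree T gr) {s : W} (hs : s ∈ gr 0) (a a' : A) :
    X.modeU (-1) (a, 0) • X.modeU (-1) (a', 0) • s = X.modeU (-1) (a * a', 0) • s := by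
  have e := IsAdmissible.YL_E (X := X) (W := W) _ (Or.inl (Or.inr ⟨a, a', rfl⟩))
  have e2 := congrArg (fun f : Fld W => f.1 (-1) s) e
  simp only [map_sub, YL_emb, Fld.sub_apply, modeFld_apply, Fld.zero_apply, sub_eq_zero] at e2
  rwa [X.YL_neg_one_mode (fun i hi => h.modeU_left hs a hi)
    (fun i hi => h.modeU_left hs a' (by omega))] at e2

theorem IsDegree.modeU_act (h : X.IsDegree T gr) {s : W} (hs : s ∈ gr 0) (a : A) (b : B) :
    X.modeU (-1) (a, 0) • X.modeU 0 (0, b) • s = X.modeU 0 (0, X.act a b) • s := by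
  have e := IsAdmissible.YL_E (X := X) (W := W) _ (Or.inr ⟨a, b, rfl⟩)
  have e2 := congrArg (fun f : Fld W => f.1 0 s) e
  simp only [map_sub, YL_emb, Fld.sub_apply, modeFld_apply, Fld.zero_apply, sub_eq_zero] at e2
  rwa [X.YL_neg_one_mode (fun i hi => h.modeU_left hs a hi)
    (fun i hi => h.modeU_right hs b (by omega))] at e2

/-- The action of `A` on the degree zero part. -/
def IsDegree.topA (h : X.IsDegree T gr) : A →ₗ[ℂ] Module.End ℂ (gr 0) :=
  LinearMap.mk₂ ℂ (fun a s => ⟨X.modeU (-1) (a, 0) • s, h.modeU_left_mem s.2 a⟩)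
    (fun a a' s => Subtype.ext (by
      have e : ((a + a', 0) : A × B) = (a, 0) + (a', 0) := by simp
      simp only [e, map_add, add_smul, Submodule.coe_add]))
    (fun r a s => Subtype.ext (by
      have e : ((r • a, 0) : A × B) = r • (a, 0) := by simp
      simp only [e, map_smul, smul_assoc, Submodule.coe_smul]))
    (fun a s s' => Subtype.ext (by simp only [Submodule.coe_add, smul_add]))
    (fun r a s => Subtype.ext (by simp only [Submodule.coe_smul]; rw [smul_comm]))

/-- The action of `B` on the degree zero part. -/
def IsDegree.topB (h : X.IsDegree T gr) : B →ₗ[ℂ] Module.End ℂ (gr 0) :=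
  LinearMap.mk₂ ℂ (fun b s => ⟨X.modeU 0 (0, b) • s, h.modeU_right_mem s.2 b⟩)
    (fun b b' s => Subtype.ext (by
      have e : ((0, b + b') : A × B) = (0, b) + (0, b') := by simp
      simp only [e, map_add, add_smul, Submodule.coe_add]))
    (fun r b s => Subtype.ext (by
      have e : ((0, r • b) : A × B) = r • (0, b) := by simp
      simp only [e, map_smul, smul_assoc, Submodule.coe_smul]))
    (fun a s s' => Subtype.ext (by simp only [Submodule.coe_add, smul_add]))
    (fun r a s => Subtype.ext (by simp only [Submodule.coe_smul]; rw [smul_comm]))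

theorem IsDegree.coe_topB (h : X.IsDegree T gr) (b : B) (s : gr 0) :
    (h.topB b s : W) = X.modeU 0 (0, b) • (s : W) := rfl

/-- The action of `B / A∂A` on the degree zero part. -/
def IsDegree.topG (h : X.IsDegree T gr) : X.G →ₗ[ℂ] Module.End ℂ (gr 0) :=
  X.AdA.liftQ h.topB (by
    refine Submodule.span_le.2 ?_
    rintro _ ⟨a, a', rfl⟩
    refine LinearMap.mem_ker.2 (LinearMap.ext fun s => Subtype.ext ?_)
    -- `(a∂a')(0)` acts as `a(-1)(∂a')(0)`, and `(∂a')(0) = 0` in 𝓛.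
    rw [coe_topB, ← h.modeU_act s.2, modeU_d, neg_zero, zero_smul, zero_smul, smul_zero]
    rfl)

/-- The degree zero part as a module for `B / A∂A`. -/
def IsDegree.top (h : X.IsDegree T gr) : LieAlgebroidModule.{u, v, w} A X.G :=
  letI instA : Module A (gr 0) :=
    { smul := fun a s => h.topA a s
      one_smul := fun s => Subtype.ext (X.modeU_one_smul (s : W))
      mul_smul := fun a a' s => Subtype.ext (h.modeU_mul s.2 a a').symm
      smul_zero := fun a => map_zero (h.topA a)
      smul_add := fun a => map_add (h.topA a)
      add_smul := fun a a' s => by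
        change h.topA (a + a') s = h.topA a s + h.topA a' s
        rw [map_add, LinearMap.add_apply]
      zero_smul := fun s => by
        change h.topA 0 s = 0
        rw [map_zero, LinearMap.zero_apply] }
  letI instG : LieRingModule X.G (gr 0) :=
    { bracket := fun g s => h.topG g s
      add_lie := fun g g' s => by
        change h.topG (g + g') s = h.topG g s + h.topG g' s
        rw [map_add, LinearMap.add_apply]
      lie_add := fun g => map_add (h.topG g)
      leibniz_lie := fun g g' s => by
        obtain ⟨b, rfl⟩ := X.toG_surjective g
        obtain ⟨b', rfl⟩ := X.toG_surjective g'
        refine Subtype.ext ?_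
        change X.modeU 0 (0, b) • X.modeU 0 (0, b') • (s : W) =
          X.modeU 0 (0, X.br b b') • (s : W) + X.modeU 0 (0, b') • X.modeU 0 (0, b) • (s : W)
        rw [modeU_BB, zero_smul, add_zero, add_zero, add_comm] }
  { carrier := gr 0
    isScalarTower := ⟨fun r a s => by
      change h.topA (r • a) s = r • h.topA a s
      rw [map_smul, LinearMap.smul_apply]⟩
    lieModule :=
      { smul_lie := fun r g s => by
          change h.topG (r • g) s = r • h.topG g s
          rw [map_smul, LinearMap.smul_apply]
        lie_smul := fun r g s => (h.topG g).map_smul r s }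
    lie_smul' := fun g a s => by
      obtain ⟨b, rfl⟩ := X.toG_surjective g
      refine Subtype.ext ?_
      change X.modeU 0 (0, b) • X.modeU (-1) (a, 0) • (s : W)
        - X.modeU (-1) (a, 0) • X.modeU 0 (0, b) • (s : W) = X.modeU (-1) (X.anchor b a, 0) • (s : W)
      rw [modeU_BA, zero_add, add_sub_cancel_left]
    smul_lie' := fun a g s => by
      obtain ⟨b, rfl⟩ := X.toG_surjective g
      exact Subtype.ext (h.modeU_act s.2 a b) }

theorem IsDegree.coe_smul_top (h : X.IsDegree T gr) (a : A) (s : h.top.carrier) :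
    ((a • s : h.top.carrier) : gr 0).1 = X.modeU (-1) (a, 0) • (s : gr 0).1 := rfl

theorem IsDegree.coe_lie_top (h : X.IsDegree T gr) (b : B) (s : h.top.carrier) :
    ((⁅X.toG b, s⁆ : h.top.carrier) : gr 0).1 = X.modeU 0 (0, b) • (s : gr 0).1 := rfl

/-! ### Simple modules -/

/-- Graded simplicity in terms of the operator `T`. -/
structure IsDegree.IsSimple (_ : X.IsDegree T gr) : Prop where
  ne_bot : gr 0 ≠ ⊥
  eq_bot_or_eq_top : ∀ N : Submodule X.UL W, (∀ x ∈ N, T x ∈ N) → N = ⊥ ∨ N = ⊤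

/-- A submodule `N` of the degree zero part generates a graded submodule of `W`. If this is all of
`W`, then `eigenspace_zero` shows that its degree zero part is no larger than `N`. -/
theorem IsDegree.IsSimple.top {h : X.IsDegree T gr} (hs : h.IsSimple) : h.top.IsSimple := by
  refine ⟨(Submodule.nontrivial_iff_ne_bot (p := gr 0)).2 hs.ne_bot, fun N hN => ?_⟩
  let S : Submodule ℂ W := (N.restrictScalars ℂ).map (gr 0).subtype
  have hS : S ≤ gr 0 := by
    rintro _ ⟨s, _, rfl⟩
    exact s.2
  rcases hs.eq_bot_or_eq_top (Submodule.span X.UL S) (h.stable_span hS) with h1 | h1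
  · left
    rw [Submodule.span_eq_bot] at h1
    refine (Submodule.eq_bot_iff N).2 fun s hsN => Subtype.ext ?_
    exact h1 _ ⟨s, hsN, rfl⟩
  · right
    have h2 := h.euler.eigenspace_zero h1 (h.homog_smul_mem hS ?_ ?_) (h.zero ▸ hS)
    · refine Submodule.eq_top_iff'.2 fun s => ?_
      have h3 : (s : gr 0).1 ∈ S := by
        rw [← h2, ← h.zero]
        exact (s : gr 0).2
      obtain ⟨s', hs', e⟩ := h3
      rwa [← (Subtype.ext e : (s' : gr 0) = s)]
    · rintro a _ ⟨s, hsN, rfl⟩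
      exact ⟨_, N.smul_mem a hsN, h.coe_smul_top a s⟩
    · rintro b _ ⟨s, hsN, rfl⟩
      exact ⟨_, hN (X.toG b) s hsN, h.coe_lie_top b s⟩

/-- The homomorphism `M(U) → W` given by a homomorphism from `U` to the degree zero part. -/
theorem IsDegree.exists_hom (h : X.IsDegree T gr) {U : LieAlgebroidModule.{u, v, w} A X.G}
    (φ : U.carrier →ₗ[ℂ] gr 0) (hA : ∀ (a : A) x, (φ (a • x) : W) = X.modeU (-1) (a, 0) • (φ x : W))
    (hB : ∀ b x, (φ ⁅X.toG b, x⁆ : W) = X.modeU 0 (0, b) • (φ x : W)) :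
    ∃ F : X.M U →ₗ[X.UL] W, ∀ x, F (X.toM U x) = φ x := by
  let F0 : X.UL ⊗[ℂ] U.carrier →ₗ[ℂ] W :=
    TensorProduct.lift (LinearMap.mk₂ ℂ (fun (y : X.UL) x => y • (φ x : W))
      (fun y y' x => add_smul _ _ _) (fun r y x => smul_assoc _ _ _)
      (fun y x x' => by rw [map_add, Submodule.coe_add, smul_add])
      (fun r y x => by rw [map_smul, Submodule.coe_smul, smul_comm]))
  let F1 : X.UL ⊗[ℂ] U.carrier →ₗ[X.UL] W :=
    { F0 with
      map_smul' := fun y z => by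
        change F0 (y • z) = y • F0 z
        induction z using TensorProduct.induction_on with
        | zero => simp
        | add z z' hz hz' => rw [smul_add, map_add, map_add, smul_add, hz, hz']
        | tmul t x => simp [F0, TensorProduct.smul_tmul', mul_smul] }
  have hF1 : ∀ y x, F1 (y ⊗ₜ x) = y • (φ x : W) := fun y x => by
    change F0 _ = _
    simp [F0]
  have hker : X.indRel U ≤ LinearMap.ker F1 := by
    refine Submodule.span_le.2 ?_
    rintro z (⟨n, a, x, hn, rfl⟩ | ⟨n, b, x, hn, rfl⟩)
    · rw [SetLike.mem_coe, LinearMap.mem_ker, map_sub, hF1, hF1, one_smul]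
      split_ifs with h0
      · rw [hA, h0, zero_sub, sub_self]
      · rw [h.modeU_left (φ x).2 a (by omega), map_zero, Submodule.coe_zero, sub_zero]
    · rw [SetLike.mem_coe, LinearMap.mem_ker, map_sub, hF1, hF1, one_smul]
      split_ifs with h0
      · rw [hB, h0, sub_self]
      · rw [h.modeU_right (φ x).2 b (by omega), map_zero, Submodule.coe_zero, sub_zero]
  refine ⟨(X.indRel U).liftQ F1 hker, fun x => ?_⟩
  exact (hF1 1 x).trans (one_smul _ _)

/-- The induced map `F : M(U) → W` is onto, its image being a nonzero graded submodule. Its kernel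
is graded and meets `U` trivially, hence lies in `J(U)`. Conversely, `F` maps `J(U)` to a graded
submodule in positive degrees, which cannot be `W` and so is zero. -/
theorem IsDegree.IsSimple.exists_equiv {h : X.IsDegree T gr} (hs : h.IsSimple)
    {U : LieAlgebroidModule.{u, v, w} A X.G} (φ : U.carrier ≃ₗ[ℂ] gr 0)
    (hA : ∀ (a : A) x, (φ (a • x) : W) = X.modeU (-1) (a, 0) • (φ x : W))
    (hB : ∀ b x, (φ ⁅X.toG b, x⁆ : W) = X.modeU 0 (0, b) • (φ x : W)) :
    ∃ e : X.LU U ≃ₗ[X.UL] W, ∀ n, (X.LUdeg U n).map (e.toLinearMap.restrictScalars ℂ) = gr n := by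
  obtain ⟨F, hF⟩ := h.exists_hom φ.toLinearMap hA hB
  obtain ⟨TM, hTM, hM0⟩ := X.exists_isEuler_M U
  have hMdeg := X.Mdeg_le_eigenspace hTM hM0
  have hφ : ∀ x, T (φ x : W) = 0 := fun x => h.apply_eq_zero (φ x).2
  have hFT : ∀ x, F (TM x) = T (F x) := hTM.map_comm h.euler F (X.M_span U) (by
    rintro _ ⟨x, rfl⟩
    rw [hM0, map_zero, hF]
    exact (hφ x).symm)
  have hFdeg : ∀ n, (X.Mdeg U n).map (F.restrictScalars ℂ) ≤ T.eigenspace (n : ℂ) := by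
    rintro n _ ⟨x, hx, rfl⟩
    rw [Module.End.mem_eigenspace_iff, LinearMap.coe_restrictScalars, ← hFT,
      Module.End.mem_eigenspace_iff.1 (hMdeg n hx)]
    exact (F.restrictScalars ℂ).map_smul _ _
  obtain ⟨s, hs0, hs1⟩ := (Submodule.ne_bot_iff _).1 hs.ne_bot
  have hsurj : LinearMap.range F = ⊤ := by
    have hst : ∀ x ∈ LinearMap.range F, T x ∈ LinearMap.range F := by
      rintro _ ⟨x, rfl⟩
      exact ⟨TM x, hFT x⟩
    rcases hs.eq_bot_or_eq_top (LinearMap.range F) hst with h1 | h1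
    · exfalso
      have h2 : F (X.toM U (φ.symm ⟨s, hs0⟩)) ∈ LinearMap.range F := ⟨_, rfl⟩
      rw [h1, Submodule.mem_bot, hF] at h2
      refine hs1 ?_
      simpa using h2
    · exact h1
  have hker : LinearMap.ker F = X.J U := by
    refine le_antisymm (le_sSup ⟨?_, ?_⟩) ?_
    · refine eq_iSup_inf_of_stable hMdeg (X.iSup_Mdeg U) fun x hx => ?_
      exact (hFT x).trans ((congrArg T (LinearMap.mem_ker.1 hx)).trans (map_zero T))
    · refine (Submodule.eq_bot_iff _).2 ?_
      rintro _ ⟨hx, ⟨x, rfl⟩⟩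
      have h1 : F (X.toM U x) = 0 := hx
      rw [hF] at h1
      have h2 : φ x = 0 := Subtype.ext h1
      rw [φ.map_eq_zero_iff.1 h2, map_zero]
    · have hst : ∀ x ∈ (X.J U).map F, T x ∈ (X.J U).map F := by
        rintro _ ⟨x, hx, rfl⟩
        exact ⟨TM x, X.J_stable U hTM hM0 x hx, hFT x⟩
      rcases hs.eq_bot_or_eq_top ((X.J U).map F) hst with h1 | h1
      · exact fun x hx => (Submodule.eq_bot_iff _).1 h1 _ ⟨x, hx, rfl⟩
      · exfalso
        have h2 : s ∈ (X.J U).map F := h1 ▸ Submodule.mem_top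
        obtain ⟨x, hx, hxs⟩ := h2
        have h3 : x ∈ X.Mpos U := by simpa using (X.mem_J U).1 hx 1
        have h4 : s ∈ ⨆ n, T.eigenspace ((n + 1 : ℕ) : ℂ) := by
          have : X.Mpos U ≤ (⨆ n, T.eigenspace ((n + 1 : ℕ) : ℂ)).comap (F.restrictScalars ℂ) :=
            iSup_le fun n x hx => Submodule.mem_iSup_of_mem n (hFdeg _ ⟨x, hx, rfl⟩)
          rw [← hxs]
          exact this h3
        have h5 := (T.eigenspaces_iSupIndep 0).le_bot ⟨h.zero ▸ hs0,
          (iSup_le fun n => le_iSup₂_of_le ((n + 1 : ℕ) : ℂ) (by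
            rw [Nat.cast_ne_zero]
            omega) le_rfl : (⨆ n, T.eigenspace ((n + 1 : ℕ) : ℂ)) ≤ _) h4⟩
        exact hs1 (by simpa using h5)
  let e : X.LU U ≃ₗ[X.UL] W := (Submodule.quotEquivOfEq _ _ hker.symm).trans
    (F.quotKerEquivOfSurjective (LinearMap.range_eq_top.1 hsurj))
  have he : ∀ x, e (X.toLU U x) = F x := fun x => rfl
  have hmap : ∀ n, (X.LUdeg U n).map (e.toLinearMap.restrictScalars ℂ) =
      (X.Mdeg U n).map (F.restrictScalars ℂ) := fun n => (Submodule.map_comp _ _ _).symm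
  refine ⟨e, fun n => ?_⟩
  rw [hmap, eq_eigenspace h.le h.iSup]
  refine eq_eigenspace hFdeg ?_ n
  rw [← Submodule.map_iSup, iSup_Mdeg, Submodule.map_top]
  refine Submodule.eq_top_iff'.2 fun x => ?_
  obtain ⟨y, hy⟩ := LinearMap.range_eq_top.1 hsurj x
  exact ⟨y, hy⟩

end Top

end Graded

/-! ### Simplicity and the degree zero part of `L(U)` -/

section Induced

variable {X} (U : LieAlgebroidModule.{u, v, w} A X.G)

theorem exists_isDegree_LU : ∃ T : Module.End ℂ (X.LU U), X.IsDegree T (X.LUdeg U) := by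
  obtain ⟨T, hT, h⟩ := X.exists_isEuler_LU U
  exact ⟨T, hT, h, X.iSup_LUdeg U⟩

theorem LUdeg_zero : X.LUdeg U 0 =
    LinearMap.range ((X.toLU U).restrictScalars ℂ ∘ₗ X.toM U) := by
  rw [LUdeg, Mdeg_zero, LinearMap.range_comp]
  rfl

theorem toLU_toM_injective :
    Function.Injective ((X.toLU U).restrictScalars ℂ ∘ₗ X.toM U) := by
  rw [injective_iff_map_eq_zero]
  exact fun x hx => X.toM_mem_J U ((X.toLU_eq_zero U).1 hx)

variable {U}

/-- A graded submodule `N` meets `U` in a Lie algebroid submodule. If that is zero, the preimage of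
`N` in `M(U)` is among the summands of `J(U)`, so `N = 0`. If it is `U`, then `N` contains
generators of `L(U)`. -/
theorem IsDegree.isSimple_LU (hU : U.IsSimple) {T : Module.End ℂ (X.LU U)}
    (h : X.IsDegree T (X.LUdeg U)) : h.IsSimple := by
  obtain ⟨TM, hTM, hM0⟩ := X.exists_isEuler_M U
  have hMdeg := X.Mdeg_le_eigenspace hTM hM0
  have hmem : ∀ x, X.toLU U (X.toM U x) ∈ X.LUdeg U 0 := fun x => by
    rw [LUdeg_zero]
    exact ⟨x, rfl⟩
  have hcomm : ∀ x, X.toLU U (TM x) = T (X.toLU U x) := hTM.map_comm h.euler _ (X.M_span U) (by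
    rintro _ ⟨x, rfl⟩
    rw [hM0, h.apply_eq_zero (hmem x), map_zero])
  refine ⟨?_, fun N hN => ?_⟩
  · rw [LUdeg_zero]
    obtain ⟨x, hx⟩ := @exists_ne _ hU.1 (0 : U.carrier)
    intro h0
    have h1 : ((X.toLU U).restrictScalars ℂ ∘ₗ X.toM U) x ∈ (⊥ : Submodule ℂ (X.LU U)) :=
      h0 ▸ ⟨x, rfl⟩
    exact hx ((injective_iff_map_eq_zero _).1 (toLU_toM_injective U) x ((Submodule.mem_bot ℂ).1 h1))
  · have hl : ∀ (a : A) x, X.toLU U (X.toM U (a • x)) =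
        X.modeU (-1) (a, 0) • X.toLU U (X.toM U x) := fun a x => by
      rw [← map_smul, modeU_left_toM _ _ le_rfl, if_pos rfl]
    let NU : Submodule A U.carrier :=
      { carrier := {x | X.toLU U (X.toM U x) ∈ N}
        add_mem' := fun {x y} hx hy => by
          change X.toLU U (X.toM U (x + y)) ∈ N
          rw [map_add, map_add]
          exact add_mem hx hy
        zero_mem' := by
          change X.toLU U (X.toM U 0) ∈ N
          rw [map_zero, map_zero]
          exact zero_mem _
        smul_mem' := fun a x hx => by
          change X.toLU U (X.toM U (a • x)) ∈ N
          rw [hl]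
          exact N.smul_mem _ hx }
    have hNU : ∀ (g : X.G), ∀ x ∈ NU, ⁅g, x⁆ ∈ NU := by
      intro g x hx
      obtain ⟨b, rfl⟩ := X.toG_surjective g
      change X.toLU U (X.toM U ⁅X.toG b, x⁆) ∈ N
      have : X.toM U ⁅X.toG b, x⁆ = X.modeU 0 (0, b) • X.toM U x := by
        rw [modeU_right_toM _ _ le_rfl, if_pos rfl]
      rw [this, map_smul]
      exact N.smul_mem _ hx
    rcases hU.2 NU hNU with h1 | h1
    · left
      have h2 : N.comap (X.toLU U) ≤ X.J U := by
        refine le_sSup ⟨eq_iSup_inf_of_stable hMdeg (X.iSup_Mdeg U) fun x hx => ?_, ?_⟩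
        · change X.toLU U (TM x) ∈ N
          rw [hcomm]
          exact hN _ hx
        · refine (Submodule.eq_bot_iff _).2 ?_
          rintro _ ⟨hx, ⟨x, rfl⟩⟩
          have h3 : x ∈ NU := hx
          rw [h1, Submodule.mem_bot] at h3
          rw [h3, map_zero]
      refine (Submodule.eq_bot_iff _).2 fun y hy => ?_
      obtain ⟨x, rfl⟩ := X.toLU_surjective U y
      exact (X.toLU_eq_zero U).2 (h2 hy)
    · right
      have h2 : N.comap (X.toLU U) = ⊤ := by
        rw [eq_top_iff, ← X.M_span U, Submodule.span_le]
        rintro _ ⟨x, rfl⟩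
        have h3 : x ∈ NU := h1 ▸ Submodule.mem_top
        exact h3
      refine Submodule.eq_top_iff'.2 fun y => ?_
      obtain ⟨x, rfl⟩ := X.toLU_surjective U y
      have : x ∈ N.comap (X.toLU U) := h2 ▸ Submodule.mem_top
      exact this

/-- The degree zero part of `L(U)` is isomorphic to `U`. -/
theorem IsDegree.top_isomorphic {W : Type w} [AddCommGroup W] [Module ℂ W] [Module X.UL W]
    [IsScalarTower ℂ X.UL W] [X.IsRestricted W] [X.IsAdmissible W] {T : Module.End ℂ W}
    {gr : ℕ → Submodule ℂ W} (h : X.IsDegree T gr)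
    {U : LieAlgebroidModule.{u, v, w} A X.G} (e : W ≃ₗ[ℂ] X.LU U)
    (he : ∀ n c x, e (X.modeU n c • x) = X.modeU n c • e x)
    (he0 : (gr 0).map (e : W →ₗ[ℂ] X.LU U) = X.LUdeg U 0) : h.top.Isomorphic U := by
  let ψ : U.carrier →ₗ[ℂ] X.LU U := (X.toLU U).restrictScalars ℂ ∘ₗ X.toM U
  have hmem : ∀ x, e.symm (ψ x) ∈ gr 0 := fun x => by
    have h1 : ψ x ∈ (gr 0).map (e : W →ₗ[ℂ] X.LU U) := by
      rw [he0, LUdeg_zero]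
      exact ⟨x, rfl⟩
    obtain ⟨w, hw, hwx⟩ := h1
    rw [← hwx]
    simpa using hw
  have he' : ∀ n c x, e.symm (X.modeU n c • x) = X.modeU n c • e.symm x := fun n c x => by
    rw [LinearEquiv.symm_apply_eq, he, e.apply_symm_apply]
  have hl : ∀ (a : A) x, ψ (a • x) = X.modeU (-1) (a, 0) • ψ x := fun a x => by
    change X.toLU U (X.toM U (a • x)) = X.modeU (-1) (a, 0) • X.toLU U (X.toM U x)
    rw [← map_smul, modeU_left_toM _ _ le_rfl, if_pos rfl]
  have hr : ∀ b x, ψ ⁅X.toG b, x⁆ = X.modeU 0 (0, b) • ψ x := fun b x => by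
    change X.toLU U (X.toM U ⁅X.toG b, x⁆) = X.modeU 0 (0, b) • X.toLU U (X.toM U x)
    rw [← map_smul, modeU_right_toM _ _ le_rfl, if_pos rfl]
  let Φ : U.carrier →ₗ[A] h.top.carrier :=
    { toFun := fun x => (⟨e.symm (ψ x), hmem x⟩ : gr 0)
      map_add' := fun x y => Subtype.ext (by
        change e.symm (ψ (x + y)) = e.symm (ψ x) + e.symm (ψ y)
        rw [map_add, map_add])
      map_smul' := fun a x => Subtype.ext (by
        change e.symm (ψ (a • x)) = X.modeU (-1) (a, 0) • e.symm (ψ x)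
        rw [hl, he']) }
  have hΦ : Function.Bijective Φ := by
    constructor
    · intro x y hxy
      have h1 : e.symm (ψ x) = e.symm (ψ y) := congrArg Subtype.val hxy
      exact toLU_toM_injective U (e.symm.injective h1)
    · rintro ⟨w, hw⟩
      have h1 : e w ∈ X.LUdeg U 0 := he0 ▸ ⟨w, hw, rfl⟩
      rw [LUdeg_zero] at h1
      obtain ⟨x, hx⟩ := h1
      refine ⟨x, Subtype.ext ?_⟩
      change e.symm (ψ x) = w
      rw [LinearEquiv.symm_apply_eq]
      exact hx
  let E := LinearEquiv.ofBijective Φ hΦ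
  have hE : ∀ (g : X.G) x, Φ ⁅g, x⁆ = ⁅g, Φ x⁆ := by
    intro g x
    obtain ⟨b, rfl⟩ := X.toG_surjective g
    refine Subtype.ext ?_
    change e.symm (ψ ⁅X.toG b, x⁆) = X.modeU 0 (0, b) • e.symm (ψ x)
    rw [hr, he']
  refine ⟨E.symm, fun g x => ?_⟩
  rw [LinearEquiv.symm_apply_eq]
  change _ = Φ _
  rw [hE]
  change _ = ⁅g, E (E.symm x)⁆
  rw [LinearEquiv.apply_symm_apply]

end Induced

/-! ### From graded `V_B`-modules to 𝓛-modules with an Euler operator -/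

section GradedModule

open VertexAlgebra

variable {X} {W : GradedModule.{max u v, w} X.vertexAlgebra X.VBdeg}

/-- The operator acting by `n` in degree `n` is an Euler operator: a mode `c(n)` shifts degrees by
`k - n - 1`, where `k = 0` for `c ∈ A` and `k = 1` for `c ∈ B`. -/
theorem exists_isDegree_ofVModule :
    letI := moduleOfVModule W.str
    haveI := isScalarTower_ofVModule W.str
    ∃ T, X.IsDegree T W.grading := by
  let := moduleOfVModule W.str
  have := isScalarTower_ofVModule W.str
  obtain ⟨T, hT⟩ := exists_degree_operator W.isNGraded.internal
  have htop := W.isNGraded.internal.submodule_iSup_eq_top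
  have key : ∀ (k : ℕ) (c : A × B), X.emb c ∈ X.VBdeg k → ∀ n x,
      T (X.modeU n c • x) = X.modeU n c • T x + ((k : ℂ) - n - 1) • X.modeU n c • x := by
    intro k c hc n x
    let F : Module.End ℂ W.carrier := W.str.Y (X.emb c) n
    have hF : ∀ y, X.modeU n c • y = F y := fun y => modeU_smul_ofVModule W.str n c y
    have h : ⨆ j, W.grading j ≤
        LinearMap.eqLocus (T ∘ₗ F) (F ∘ₗ T + ((k : ℂ) - n - 1) • F) := by
      refine iSup_le fun j y hy => ?_
      have h1 := W.isNGraded.mode_mem k j n _ hc y hy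
      rw [intDegree_eq_eigenspace hT htop, Module.End.mem_eigenspace_iff] at h1
      rw [LinearMap.mem_eqLocus, LinearMap.add_apply, LinearMap.comp_apply, LinearMap.comp_apply,
        LinearMap.smul_apply, h1, Module.End.mem_eigenspace_iff.1 (hT j hy), map_smul, ← add_smul]
      push_cast
      congr 1
      ring
    rw [htop] at h
    simp only [hF]
    exact h (x := x) Submodule.mem_top
  have hA : ∀ a : A, X.emb (a, 0) ∈ X.VBdeg 0 := fun a => by
    have h := X.ι_mul_mem_ULdeg (X.mode_mem_homog (-1) a) X.one_mem_ULdeg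
    rw [mul_one] at h
    exact Submodule.subset_span ⟨_, h, rfl⟩
  have hB : ∀ b : B, X.emb (0, b) ∈ X.VBdeg 1 := fun b => by
    have h := X.ι_mul_mem_ULdeg (X.mode_mem_homog' (-1) b) X.one_mem_ULdeg
    rw [mul_one] at h
    exact Submodule.subset_span ⟨_, h, rfl⟩
  refine ⟨T, ?_, hT, htop⟩
  rintro n ⟨a, b⟩ x
  have h1 := key 0 _ (hA a) n x
  have h2 := key 1 _ (hB b) n x
  have hc : (a, b) = (a, 0) + (0, b) := by simp
  have hw : wt A B n (a, b) = (-n - 1 : ℂ) • (a, 0) + (-n : ℂ) • (0, b) := by simp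
  rw [hw, hc]
  simp only [map_add, add_smul, LinearMap.map_smul, smul_assoc, h1, h2]
  push_cast
  rw [show (0 - n - 1 : ℂ) = -n - 1 by ring, show (1 - n - 1 : ℂ) = -n by ring]
  abel

variable [Module X.UL W.carrier] [IsScalarTower ℂ X.UL W.carrier] [X.IsRestricted W.carrier]
  [X.IsAdmissible W.carrier] {T : Module.End ℂ W.carrier}

/-- Stability under 𝓛 is the same as stability under all of `V_B`, whose modes are built from those
of 𝓛 by products of fields. Being graded is the same as being `T`-stable. -/
theorem IsDegree.isSimple_iff (hW : X.vModule W.carrier = W.str) (h : X.IsDegree T W.grading) :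
    h.IsSimple ↔ W.IsSimple := by
  constructor
  · refine fun hs => ⟨hs.ne_bot, fun N hN hN' => ?_⟩
    have hN1 : ∀ n c, ∀ x ∈ N, X.modeU n c • x ∈ N := fun n c x hx => by
      have h1 := hN (X.emb c) n x hx
      rwa [← hW, vModule_Y, YB_emb, modeFld_apply] at h1
    rcases hs.eq_bot_or_eq_top (X.submoduleOfMode N hN1) (stable_of_eq_iSup_inf h.le hN')
      with h1 | h1
    · exact Or.inl (SetLike.ext fun x => SetLike.ext_iff.1 h1 x)
    · exact Or.inr (SetLike.ext fun x => SetLike.ext_iff.1 h1 x)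
  · refine fun hs => ⟨hs.1, fun N hN => ?_⟩
    have hN1 : ∀ (a : X.VB) (n : ℤ), ∀ x ∈ N.restrictScalars ℂ,
        W.str.Y a n x ∈ N.restrictScalars ℂ := fun a n x hx => by
      obtain ⟨a, rfl⟩ := X.toVB_surjective a
      rw [← hW, vModule_Y, YB_toVB]
      exact X.YL_mem (fun _ _ _ hx => N.smul_mem _ hx) a n hx
    rcases hs.2 (N.restrictScalars ℂ) hN1 (eq_iSup_inf_of_stable h.le h.iSup hN) with h1 | h1
    · exact Or.inl (SetLike.ext fun x => SetLike.ext_iff.1 h1 x)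
    · exact Or.inr (SetLike.ext fun x => SetLike.ext_iff.1 h1 x)

/-- The graded module `L(U)`. -/
abbrev gradedLU (U : LieAlgebroidModule.{u, v, w} A X.G) :
    GradedModule.{max u v, max u v w} X.vertexAlgebra X.VBdeg :=
  ⟨X.LU U, X.vModule (X.LU U), X.LUdeg U, X.isNGraded_LU U⟩

end GradedModule

/-! ### Classification by the degree zero part -/

section Classification

open VertexAlgebra

variable {X} {W : GradedModule.{max u v, max u v w} X.vertexAlgebra X.VBdeg}
  [Module X.UL W.carrier] [IsScalarTower ℂ X.UL W.carrier] [X.IsRestricted W.carrier]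
  [X.IsAdmissible W.carrier] {T : Module.End ℂ W.carrier}

/-- An isomorphism restricts to degree zero. Conversely, an isomorphism in degree zero extends,
because a graded simple module is the simple quotient of the module induced from its degree zero
part. -/
theorem IsDegree.isomorphic_gradedLU_iff (hW : X.vModule W.carrier = W.str)
    {h : X.IsDegree T W.grading} (hs : h.IsSimple)
    (U : LieAlgebroidModule.{u, v, max u v w} A X.G) :
    W.Isomorphic (gradedLU U) ↔ h.top.Isomorphic U := by
  constructor
  · rintro ⟨e, he, hY⟩
    refine h.top_isomorphic e (fun n c x => ?_) (he 0)
    have h1 := hY (X.emb c) n x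
    rw [← hW, vModule_Y, YB_emb, modeFld_apply] at h1
    exact h1.trans (X.isAssociatedModule_LU U c n (e x))
  · rintro ⟨E, hE⟩
    let φ : U.carrier ≃ₗ[ℂ] W.grading 0 := E.symm.restrictScalars ℂ
    obtain ⟨e, he⟩ := hs.exists_equiv φ
      (fun a x => congrArg Subtype.val (E.symm.map_smul a x))
      (fun b x => by
        have h1 : E.symm ⁅X.toG b, x⁆ = ⁅X.toG b, E.symm x⁆ := by
          rw [LinearEquiv.symm_apply_eq, hE, E.apply_symm_apply]
        exact congrArg Subtype.val h1)
    refine ⟨(e.restrictScalars ℂ).symm, fun n => ?_, fun a n x => ?_⟩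
    · refine SetLike.ext fun x => ?_
      rw [← he n]
      constructor
      · rintro ⟨_, ⟨z, hz, rfl⟩, rfl⟩
        change e.symm (e z) ∈ _
        rwa [e.symm_apply_apply]
      · exact fun hx => ⟨e x, ⟨x, hx, rfl⟩, e.symm_apply_apply x⟩
    · obtain ⟨a, rfl⟩ := X.toVB_surjective a
      rw [← hW]
      exact X.YL_map (e.symm.toLinearMap.restrictScalars ℂ)
        (fun _ _ _ => e.symm.map_smul _ _) a n x

variable (X) in
/-- The graded simple `ℕ`-graded `V_B`-modules are the modules `L(U)` for simple `U`. -/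
theorem isCompleteSetOfReps_gradedLU {ι : Type*}
    {H : ι → LieAlgebroidModule.{u, v, max u v w} A X.G}
    (hH : IsCompleteSetOfReps LieAlgebroidModule.IsSimple LieAlgebroidModule.Isomorphic H) :
    IsCompleteSetOfReps GradedModule.IsSimple GradedModule.Isomorphic
      (fun i => gradedLU (H i)) := by
  refine ⟨fun i => ?_, fun W hW => ?_⟩
  · obtain ⟨T, h⟩ := X.exists_isDegree_LU (H i)
    exact (h.isSimple_iff (W := gradedLU (H i)) rfl).1 (h.isSimple_LU (hH.1 i))
  · let := moduleOfVModule W.str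
    have := isScalarTower_ofVModule W.str
    have := isRestricted_ofVModule W.str
    have := isAdmissible_ofVModule W.str
    have hstr := vModule_ofVModule W.str
    obtain ⟨T, h⟩ := exists_isDegree_ofVModule (W := W)
    have hs := (h.isSimple_iff hstr).2 hW
    -- Existence and uniqueness of the index for `W` are those for its simple degree zero part.
    simpa only [h.isomorphic_gradedLU_iff hstr hs] using hH.2 h.top hs.top

end Classification

end VertexAlgebroid

end

/-! ### The main theorem -/

theorem theorem4p14 {A : Type u} {B : Type v} [CommRing A] [Algebra ℂ A] [AddCommGroup B]
    [Module ℂ B] (X : VertexAlgebroid A B) :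
    ∃ 𝒱 : VertexAlgebra X.VB,
      X.IsAssociated 𝒱 ∧ (∀ 𝒱' : VertexAlgebra X.VB, X.IsAssociated 𝒱' → 𝒱' = 𝒱) ∧
      𝒱.IsNGraded X.VBdeg ∧
      ∃ (𝒲 : ∀ U : LieAlgebroidModule.{u, v, max u v w} A X.G, 𝒱.VModule (X.LU U))
        (h𝒲 : ∀ U, (𝒲 U).IsNGraded X.VBdeg (X.LUdeg U)),
        (∀ U, X.IsAssociatedModule U (𝒲 U) ∧
          ∀ 𝒲' : 𝒱.VModule (X.LU U), X.IsAssociatedModule U 𝒲' → 𝒲' = 𝒲 U) ∧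
        ∀ {ι : Type*} (H : ι → LieAlgebroidModule.{u, v, max u v w} A X.G),
          IsCompleteSetOfReps LieAlgebroidModule.IsSimple LieAlgebroidModule.Isomorphic H →
          IsCompleteSetOfReps VertexAlgebra.GradedModule.IsSimple
            VertexAlgebra.GradedModule.Isomorphic
            (fun i => (⟨X.LU (H i), 𝒲 (H i), X.LUdeg (H i), h𝒲 (H i)⟩ :
              VertexAlgebra.GradedModule.{max u v, max u v w} 𝒱 X.VBdeg)) :=
  ⟨X.vertexAlgebra, X.isAssociated_vertexAlgebra, fun _ h => X.eq_vertexAlgebra h,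
    X.isNGraded_vertexAlgebra, fun U => X.vModule (X.LU U), fun U => X.isNGraded_LU U,
    fun U => ⟨X.isAssociatedModule_LU U, fun _ h => X.eq_vModule_LU U h⟩,
    fun _ hH => X.isCompleteSetOfReps_gradedLU hH⟩
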